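/- **Kokotsakis polyhedra.** A (quadrangular) Kokotsakis polyhedron is a polyhedral surface in $\mathbb R^3$, self-intersections between different faces being allowed, consisting of a simple planar base quadrilateral $A_1A_2A_3A_4$ (not necessarily convex), of four simple planar side quadrilaterals $A_1A_2B_2B_1$, $A_2A_3C_3C_2$, $A_3A_4B_4B_3$, $A_4A_1C_1C_4$, and of four non-degenerate triangles $A_iB_iC_i$. At $A_i$, let $\delta_i$ be the interior angle of the base, $\alpha_i$ the angle of the side face containing $A_iB_i$, $\gamma_i$ the angle of the side face containing $A_iC_i$, and $\beta_i=\angle B_iA_iC_i$; equivalently, the faces around $A_i$ cut out of a small sphere around $A_i$ a spherical quadrilateral $Q_i$ with consecutive sides $\alpha_i,\beta_i,\gamma_i,\delta_i$. Two such polyhedra are isometric if corresponding faces are congruent; a polyhedron is flexible if it has a continuous isometric deformation along which it is immediately no longer congruent to its initial position. Let $\varphi,\psi_2,\theta,\psi_1\in(-\pi,\pi]$ be the signed exterior dihedral angles at $A_1A_2$, $A_2A_3$, $A_3A_4$, $A_4A_1$ (zero if the side face continues the base plane outwards, with a common choice of the positive side of the base), and put $z=\tan\frac\varphi2$, $w_2=\tan\frac{\psi_2}2$,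 $u=\tan\frac\theta2$, $w_1=\tan\frac{\psi_1}2$ in $\mathbb RP^1=\mathbb R\cup\{\infty\}$. **Geometric assumptions.** Let $\delta_i,\lambda_i,\mu_i$ ($i=1,\dots,4$) be real numbers with $\lambda_i,\mu_i\neq0$ such that: 1. $\delta_i>0$, $\cos\delta_i\ne0$ and $\delta_1+\delta_2+\delta_3+\delta_4=2\pi$. 2. $\lambda_1=-\lambda_2$, $\mu_1=-\mu_4$, $\mu_2=-\mu_3$, $\lambda_3=-\lambda_4$, and, with $\nu_i=\frac{(\lambda_i-1)(\mu_i-1)}{\cos\delta_i}$, $$\frac{\nu_1^2}{\lambda_1\mu_1}=\frac{\nu_3^2}{\lambda_3\mu_3},\qquad \frac{\nu_2^2}{\lambda_2\mu_2}=\frac{\nu_4^2}{\lambda_4\mu_4},\qquad \frac{\nu_1^2}{\lambda_1\mu_1}+\frac{\nu_2^2}{\lambda_2\mu_2}=16 .$$ 3. There are well-defined angles $\alpha_i,\beta_i,\gamma_i\in(0,\pi)$ given by $$\tan\alpha_i=\frac{\lambda_i-1}{\lambda_i+1}\tan\delta_i,\qquad \tan\gamma_i=\frac{\mu_i-1}{\mu_i+1}\tan\delta_i,\qquad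 \cos\beta_i=\frac{\cos\alpha_i\cos\gamma_i}{\cos\delta_i}$$ (in particular $\lambda_i,\mu_i\neq-1$ and $\cos\alpha_i,\cos\gamma_i\ne0$). 4. For each $i$, $\alpha_i\pm\beta_i\pm\gamma_i\pm\delta_i\not\equiv0\pmod{2\pi}$ for every choice of signs. **Theorem.** Under these assumptions: (a) There is a Kokotsakis polyhedron with planar angles $(\alpha_i,\beta_i,\gamma_i,\delta_i)$ at $A_i$, $i=1,\dots,4$. (b) After a suitable cyclic re-enumeration of the vertices (a shift by an odd number exchanges the roles of $\alpha$ and $\gamma$, of $B$ and $C$, and of $\lambda$ and $\mu$) one has $\lambda_1,\mu_1>0$, $\lambda_3,\mu_3<0$ and $\zeta_1:=\frac{|\nu_1|}{4\sqrt{\lambda_1\mu_1}}>1$. (c) Every Kokotsakis polyhedron $K$ with these planar angles is flexible. In the enumeration of (b), the set of all $(z,w_1,u,w_2)\in(\mathbb RP^1)^4$ belonging to polyhedra isometric to $K$ is the union of four branches, which are pairwise disjoint, are simple closed curves, and are non-constant in each of the four variables. Up to the symmetry $(z,w_1,u,w_2)\mapsto-(z,w_1,u,w_2)$ they are given, for $t\in[0,2\pi)$,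 by $$\begin{aligned} z&=\operatorname{sgn}\nu_1\,\sqrt{\lambda_1}\,F(t)F(t+\tfrac\pi2),\\ w_1&=\sqrt{\mu_1}\,F(t)F(t-\tfrac\pi2),\\ u&=\operatorname{sgn}\nu_4\,\sqrt{-\lambda_3}\,\frac{\sqrt{\zeta_1+1}\pm\big(G(t)+G(t+\frac\pi2)\big)}{V(t)-V(t+\frac\pi2)},\\ w_2&=\sqrt{-\mu_3}\,\frac{\operatorname{sgn}(\nu_1\nu_2)\sqrt{\zeta_1+1}\pm\operatorname{sgn}(\nu_3\nu_4)\big(G(t)+G(t-\frac\pi2)\big)}{V(t)-V(t-\frac\pi2)}, \end{aligned}$$ with the same sign $\pm$ in $u$ and $w_2$, where $$F(t)=\sin t\sqrt{\zeta_1-1}+\sqrt{1+(\zeta_1-1)\sin^2t},\quad G(t)=\sin t\sqrt{1+(\zeta_1-1)\sin^2t},\quad V(t)=\sin t\sqrt{1+(\zeta_1-1)\cos^2t}.$$ Here a quotient $a/0$ with $a\ne0$ is read as $\infty$, and a quotient $0/0$, which occurs only at isolated $t$, as its limit $0$; with this convention the branches are continuous and $2\pi$-periodic in $t$. -/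

import Mathlib

open Real

noncomputable section

namespace Kokotsakis

/-- Euclidean three-space. -/
abbrev E3 : Type := EuclideanSpace ℝ (Fin 3)

/-- The cross product on Euclidean three-space. -/
def cross (u v : E3) : E3 :=
  WithLp.toLp 2 (crossProduct (WithLp.ofLp u) (WithLp.ofLp v))

/-! ### Planar quadrilaterals in space -/

/-- A non-degenerate simple planar quadrilateral with consecutive vertices `q 0, q 1, q 2, q 3`:
the vertices are coplanar, consecutive sides are not parallel, opposite sides do not meet.
It need not be convex. -/
structure IsPlanarQuad (q : Fin 4 → E3) : Prop where
  coplanar : Coplanar ℝ (Set.range q)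
  corner : ∀ i, ¬ Collinear ℝ {q i, q (i + 1), q (i + 2)}
  simple₁ : Disjoint (segment ℝ (q 0) (q 1)) (segment ℝ (q 2) (q 3))
  simple₂ : Disjoint (segment ℝ (q 1) (q 2)) (segment ℝ (q 3) (q 0))

/-- Twice the vector area of a quadrilateral: a normal vector, with respect to which the vertices
are listed counterclockwise. -/
def areaNormal (q : Fin 4 → E3) : E3 := cross (q 2 - q 0) (q 3 - q 1)

/-- The interior angle, in `[0, 2π)`, of a planar quadrilateral at its `i`-th vertex: the angle
through which the side towards `q (i + 1)` is turned counterclockwise, as seen from the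
tip of the area normal, to reach the side towards `q (i - 1)`. -/
def interiorAngle (q : Fin 4 → E3) (i : Fin 4) : ℝ :=
  toIcoMod Real.two_pi_pos 0 (Complex.arg
    ⟨‖areaNormal q‖ * inner ℝ (q (i + 1) - q i) (q (i - 1) - q i),
      inner ℝ (areaNormal q) (cross (q (i + 1) - q i) (q (i - 1) - q i))⟩)

/-! ### Kokotsakis polyhedra with quadrilateral base -/

/-- The side faces attached to the sides `A i A (i + 1)` of the base: the quadrilaterals
`A 0 A 1 B 1 B 0`, `A 1 A 2 C 2 C 1`, `A 2 A 3 B 3 B 2`, `A 3 A 0 C 0 C 3`. The vertices are listed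
so that each side face is oriented consistently with the base `A 0 A 1 A 2 A 3`. -/
def sideQuad (A B C : Fin 4 → E3) : Fin 4 → Fin 4 → E3 :=
  ![![A 1, A 0, B 0, B 1], ![A 2, A 1, C 1, C 2],
    ![A 3, A 2, B 2, B 3], ![A 0, A 3, C 3, C 0]]

/-- A Kokotsakis polyhedron with base `A 0 A 1 A 2 A 3`. Besides two base edges, the edges
`A i B i` and `A i C i` emanate from the vertex `A i`. The nine faces are the base, the four side
quadrilaterals, and the triangles `A i B i C i` between consecutive side quadrilaterals. The
surface is not required to be embedded: different faces may cross. -/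
structure KokotsakisPolyhedron where
  A : Fin 4 → E3
  B : Fin 4 → E3
  C : Fin 4 → E3
  base_quad : IsPlanarQuad A
  side_quad : ∀ i, IsPlanarQuad (sideQuad A B C i)
  triangle : ∀ i, ¬ Collinear ℝ {A i, B i, C i}

namespace KokotsakisPolyhedron

/-- The `i`-th side face. -/
def side (K : KokotsakisPolyhedron) (i : Fin 4) : Fin 4 → E3 := sideQuad K.A K.B K.C i

/-- All twelve vertices. -/
def vertices (K : KokotsakisPolyhedron) : Fin 3 × Fin 4 → E3 :=
  fun p => (![K.A, K.B, K.C] p.1) p.2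

/-- The planar angles at the vertex `A i` are `α i, β i, γ i, δ i`: here `δ i` is the angle of the
base, `β i` that of the triangle `A i B i C i`, `α i` that of the side face through `A i B i`,
and `γ i` that of the side face through `A i C i`. Equivalently, the spherical
quadrilateral cut out by the faces around `A i` has these side lengths, in this cyclic order. -/
structure HasPlanarAngles (K : KokotsakisPolyhedron) (α β γ δ : Fin 4 → ℝ) : Prop where
  base : ∀ i, interiorAngle K.A i = δ i
  tri : ∀ i, EuclideanGeometry.angle (K.B i) (K.A i) (K.C i) = β i
  α₀ : interiorAngle (K.side 0) 1 = α 0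
  α₁ : interiorAngle (K.side 0) 0 = α 1
  α₂ : interiorAngle (K.side 2) 1 = α 2
  α₃ : interiorAngle (K.side 2) 0 = α 3
  γ₀ : interiorAngle (K.side 3) 0 = γ 0
  γ₁ : interiorAngle (K.side 1) 1 = γ 1
  γ₂ : interiorAngle (K.side 1) 0 = γ 2
  γ₃ : interiorAngle (K.side 3) 1 = γ 3

/-- Two polyhedra are isometric if corresponding faces are congruent. -/
structure Isometric (K L : KokotsakisPolyhedron) : Prop where
  base : Congruent K.A L.A
  side : ∀ i, Congruent (K.side i) (L.side i)
  tri : ∀ i, Congruent ![K.A i, K.B i, K.C i] ![L.A i, L.B i, L.C i]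

/-- `K` is flexible if it has a continuous isometric deformation starting at `K` along
which it is immediately no longer congruent to `K` as a whole. -/
def IsFlexible (K : KokotsakisPolyhedron) : Prop :=
  ∃ P : unitInterval → KokotsakisPolyhedron,
    Continuous (fun s => (P s).vertices) ∧ P 0 = K ∧ (∀ s, K.Isometric (P s)) ∧
      ∀ s, 0 < s → ¬ Congruent K.vertices (P s).vertices

/-- The exterior dihedral angle, in `(-π, π]`, at the edge `A i A (i + 1)`: the signed angle about
this edge between the consistently oriented normals of the base and of the side face. It is `0` if
the side face continues the base plane outwards, `π` if it is folded back onto the base, and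
positive if the side face is bent towards the normal of the base. -/
def dihedral (K : KokotsakisPolyhedron) (i : Fin 4) : ℝ :=
  Complex.arg
    ⟨‖K.A (i + 1) - K.A i‖ * inner ℝ (areaNormal K.A) (areaNormal (K.side i)),
      inner ℝ (areaNormal (K.side i)) (cross (areaNormal K.A) (K.A (i + 1) - K.A i))⟩

end KokotsakisPolyhedron

/-- `tan (φ / 2)` for `φ ∈ (-π, π]`, as a point of the real projective line `ℝ ∪ {∞}`. -/
def halfTan (φ : ℝ) : OnePoint ℝ :=
  if φ = π then OnePoint.infty else ((Real.tan (φ / 2) : ℝ) : OnePoint ℝ)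

namespace KokotsakisPolyhedron

/-- The half-tangents of the four exterior dihedral angles at the base edges. -/
def halfTans (K : KokotsakisPolyhedron) : Fin 4 → OnePoint ℝ := fun i => halfTan (K.dihedral i)

/-- The configuration space of `K`: the half-tangents of the dihedral angles of all
polyhedra isometric to `K`. -/
def configSpace (K : KokotsakisPolyhedron) : Set (Fin 4 → OnePoint ℝ) :=
  {e | ∃ L : KokotsakisPolyhedron, K.Isometric L ∧ L.halfTans = e}

end KokotsakisPolyhedron

/-! ### Involution factors and the geometric assumptions -/

/-- The coefficient `ν` of a spherical quadrilateral with `cos δ ≠ 0`. -/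
def nuOf (δ lam mu : Fin 4 → ℝ) (i : Fin 4) : ℝ :=
  (lam i - 1) * (mu i - 1) / Real.cos (δ i)

/-- The geometric assumptions on the base angles `δ i` and the involution factors
`(lam i, mu i)`, with resulting angles `α i, β i, γ i`. -/
structure GeometricAssumptions (δ lam mu α β γ : Fin 4 → ℝ) : Prop where
  -- base angles of a quadrilateral without right angles
  δ_pos : ∀ i, 0 < δ i
  δ_sum : δ 0 + δ 1 + δ 2 + δ 3 = 2 * π
  δ_not_right : ∀ i, Real.cos (δ i) ≠ 0
  -- the factors are non-zero, and opposite at common vertices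
  lam_ne : ∀ i, lam i ≠ 0
  mu_ne : ∀ i, mu i ≠ 0
  lam_opp₁ : lam 0 = -lam 1
  mu_opp₁ : mu 0 = -mu 3
  mu_opp₂ : mu 1 = -mu 2
  lam_opp₂ : lam 2 = -lam 3
  -- proportionality of resultants
  prop₁ : nuOf δ lam mu 0 ^ 2 / (lam 0 * mu 0) = nuOf δ lam mu 2 ^ 2 / (lam 2 * mu 2)
  prop₂ : nuOf δ lam mu 1 ^ 2 / (lam 1 * mu 1) = nuOf δ lam mu 3 ^ 2 / (lam 3 * mu 3)
  prop₃ : nuOf δ lam mu 0 ^ 2 / (lam 0 * mu 0) + nuOf δ lam mu 1 ^ 2 / (lam 1 * mu 1) = 16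
  -- the angles determined by these data are well defined
  lam_add_one : ∀ i, lam i + 1 ≠ 0
  mu_add_one : ∀ i, mu i + 1 ≠ 0
  α_mem : ∀ i, α i ∈ Set.Ioo 0 π
  γ_mem : ∀ i, γ i ∈ Set.Ioo 0 π
  β_mem : ∀ i, β i ∈ Set.Ioo 0 π
  cos_α : ∀ i, Real.cos (α i) ≠ 0
  cos_γ : ∀ i, Real.cos (γ i) ≠ 0
  tan_α : ∀ i, Real.tan (α i) = (lam i - 1) / (lam i + 1) * Real.tan (δ i)
  tan_γ : ∀ i, Real.tan (γ i) = (mu i - 1) / (mu i + 1) * Real.tan (δ i)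
  cos_β : ∀ i, Real.cos (β i) = Real.cos (α i) * Real.cos (γ i) / Real.cos (δ i)
  -- all four spherical quadrilaterals are elliptic
  elliptic : ∀ i, ∀ s₁ s₂ s₃ : ℤˣ, ∀ m : ℤ,
    α i + ((s₁ : ℤ) : ℝ) * β i + ((s₂ : ℤ) : ℝ) * γ i + ((s₃ : ℤ) : ℝ) * δ i ≠ 2 * π * m

/-! ### Cyclic re-enumeration of the vertices

In the re-enumeration by `k`, the new vertex `i` is the old vertex `i + k`. If `k` is odd, the two
kinds of base edges (those carrying `lam` and those carrying `mu`) are exchanged. -/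

def shiftLam (lam mu : Fin 4 → ℝ) (k i : Fin 4) : ℝ :=
  if Even (k : ℕ) then lam (i + k) else mu (i + k)

def shiftMu (lam mu : Fin 4 → ℝ) (k i : Fin 4) : ℝ :=
  if Even (k : ℕ) then mu (i + k) else lam (i + k)

/-! ### The explicit branches -/

/-- The quotient `a / b` in `ℝ ∪ {∞}`, with `a / 0 = ∞` for `a ≠ 0`. In the branches below `0 / 0`
occurs only at isolated parameters, where the limit of the quotient is `0`. -/
def projQuot (a b : ℝ) : OnePoint ℝ :=
  if b = 0 then (if a = 0 then ((0 : ℝ) : OnePoint ℝ) else OnePoint.infty)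
  else ((a / b : ℝ) : OnePoint ℝ)

/-- `ζ₁ = |ν₁| / (4 √(λ₁ μ₁))`. -/
def zetaOne (lam mu nu : Fin 4 → ℝ) : ℝ := |nu 0| / (4 * √(lam 0 * mu 0))

def auxF (ζ t : ℝ) : ℝ := Real.sin t * √(ζ - 1) + √(1 + (ζ - 1) * Real.sin t ^ 2)

def auxG (ζ t : ℝ) : ℝ := Real.sin t * √(1 + (ζ - 1) * Real.sin t ^ 2)

def auxV (ζ t : ℝ) : ℝ := Real.sin t * √(1 + (ζ - 1) * Real.cos t ^ 2)

/-- The branch with overall sign `η` and choice of sign `ε`, at the parameter `t`. The entry `i` is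
the variable at the edge `A i A (i + 1)`; in order, these are `z, w₂, u, w₁`. -/
def branch (lam mu nu : Fin 4 → ℝ) (η ε : ℤˣ) (t : ℝ) : Fin 4 → OnePoint ℝ :=
  let ζ := zetaOne lam mu nu
  let h : ℝ := ((η : ℤ) : ℝ)
  let e : ℝ := ((ε : ℤ) : ℝ)
  ![((h * (Real.sign (nu 0) * √(lam 0) * (auxF ζ t * auxF ζ (t + π / 2))) : ℝ) : OnePoint ℝ),
    projQuot
      (h * (√(-mu 2) * (Real.sign (nu 0 * nu 1) * √(ζ + 1)
        + e * Real.sign (nu 2 * nu 3) * (auxG ζ t + auxG ζ (t - π / 2)))))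
      (auxV ζ t - auxV ζ (t - π / 2)),
    projQuot
      (h * (Real.sign (nu 3) * √(-lam 2) * (√(ζ + 1)
        + e * (auxG ζ t + auxG ζ (t + π / 2)))))
      (auxV ζ t - auxV ζ (t + π / 2)),
    ((h * (√(mu 0) * (auxF ζ t * auxF ζ (t - π / 2))) : ℝ) : OnePoint ℝ)]

end Kokotsakis

end

/-!
The proof separates a purely algebraic problem about four half-tangents from the geometry.

*Geometry.* Number the base edges so that edge `i` joins `A i` to `A (i + 1)`, and unfold a
polyhedron into its flat pattern: the base and four side faces hinged to it (`FlapPattern`). Folding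
the side faces by arbitrary dihedral angles gives a polyhedron isometric to the original one exactly
when all four triangle angles at the base vertices come out as `β i`. Hence the configuration
space is the solution set of four equations, one for each base vertex
(`KokotsakisPolyhedron.configSpace_eq`), each relating the dihedral angles at two adjacent edges. As
`cos β cos δ = cos α cos γ`, the spherical quadrilaterals are orthodiagonal, and the equation at a
vertex factorises into `(z + a / z) (w + b / w) = ν` (`sphCos_eq_iff`, `Coupled`). The factor
belonging to an edge changes sign from one of its end points to the other.

*Choosing the enumeration.* With `ρ i = ν i ^ 2 / (λ i μ i)` the assumptions say that
`ρ i + ρ (i + 1) = 16` and `ρ (i + 2) = ρ i`. The sign of `ρ i` records whether the factors at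
the two edges through `A i` have equal signs, and `ρ i > 16` if both are negative, since then
`(λ i - 1) ^ 2 > 4 |λ i|`, and the same for `μ i`. This forces `ρ i > 16` somewhere, and some
cyclic shift brings the signs into the order required (`exists_shift`, `exists_normalForm`).

*Solving the system.* After division of each half-tangent by the square root of the absolute value
of its factor, and with `κ = √(ζ ^ 2 - 1)`, the system reads
`ζ s₀ s₃ = 1`, `-c₀ = κ s₀ s₁`, `c₁ c₂ = ζ s₁ s₂`, `-c₃ = κ s₂ s₃` up to signs, where `c`, `s`
are the cosines and sines of the scaled angles (`NormSystem`). The first equation means that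
`z = ± exp X` and `w = ± exp Y` with `cosh X cosh Y = ζ`. Writing `X = x + y`, `Y = x - y`
turns this into `sinh² x + sinh² y = ζ - 1`, the circle `sinh x = √(ζ - 1) sin t`,
`sinh y = √(ζ - 1) cos t`. The second and fourth equations determine `s₁` and `s₂`, and the third
one determines `c₁` and `c₂` up to a common sign: this gives the four branches
(`exists_normBranch_of_normSystem`). In terms of cosines and sines they are visibly continuous, also
where the quotients take the form `0 / 0`.

*Existence and flexibility.* A base with the angles `δ i` is circumscribed about a circle
(`exists_planarQuad`), low trapezoids serve as side faces (`exists_flapPattern`), and any point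
of a branch folds this pattern into a polyhedron. Every polyhedron lies on a branch, and moving along
it changes the cosine of a dihedral angle at once, so that the vertices are no longer congruent
(`GeometricAssumptions.isFlexible`).
-/

noncomputable section

namespace Kokotsakis

/-! ### Arguments and angles -/

lemma cos_toIcoMod (x : ℝ) : Real.cos (toIcoMod Real.two_pi_pos 0 x) = Real.cos x := by
  rw [toIcoMod, zsmul_eq_mul, Real.cos_sub_int_mul_two_pi]

lemma sin_toIcoMod (x : ℝ) : Real.sin (toIcoMod Real.two_pi_pos 0 x) = Real.sin x := by
  rw [toIcoMod, zsmul_eq_mul, Real.sin_sub_int_mul_two_pi]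

lemma toIcoMod_two_pi_mem (x : ℝ) : toIcoMod Real.two_pi_pos 0 x ∈ Set.Ico 0 (2 * π) := by
  simpa using toIcoMod_mem_Ico Real.two_pi_pos 0 x

lemma cos_sin_arg_mk {r c s : ℝ} (hr : 0 < r) (h : c ^ 2 + s ^ 2 = 1) :
    Real.cos (Complex.arg ⟨r * c, r * s⟩) = c ∧ Real.sin (Complex.arg ⟨r * c, r * s⟩) = s := by
  have hnorm : ‖(⟨r * c, r * s⟩ : ℂ)‖ = r := by
    rw [Complex.norm_def, Complex.normSq_mk, Real.sqrt_eq_iff_mul_self_eq_of_pos hr]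
    linear_combination (-r ^ 2) * h
  have hz : (⟨r * c, r * s⟩ : ℂ) ≠ 0 := by
    rw [← norm_pos_iff, hnorm]; exact hr
  rw [Complex.cos_arg hz, Complex.sin_arg, hnorm]
  exact ⟨mul_div_cancel_left₀ _ hr.ne', mul_div_cancel_left₀ _ hr.ne'⟩

lemma exists_mem_Ico_cos_sin {x y : ℝ} (h : x ^ 2 + y ^ 2 = 1) :
    ∃ t ∈ Set.Ico 0 (2 * π), Real.cos t = x ∧ Real.sin t = y := by
  obtain ⟨h1, h2⟩ := cos_sin_arg_mk one_pos h
  exact ⟨_, toIcoMod_two_pi_mem _, (cos_toIcoMod _).trans h1, (sin_toIcoMod _).trans h2⟩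

lemma eq_of_cos_eq_of_sin_eq {t t' : ℝ} (ht : t ∈ Set.Ico 0 (2 * π))
    (ht' : t' ∈ Set.Ico 0 (2 * π)) (hc : Real.cos t = Real.cos t')
    (hs : Real.sin t = Real.sin t') : t = t' := by
  obtain ⟨m, hm⟩ := Real.Angle.angle_eq_iff_two_pi_dvd_sub.mp (Real.Angle.cos_sin_inj hc hs)
  have hpi := Real.two_pi_pos
  have h1 : (m : ℝ) < 1 := by
    by_contra! h
    nlinarith [ht.2, ht'.1]
  have h2 : (-1 : ℝ) < m := by
    by_contra! h
    nlinarith [ht.1, ht'.2]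
  have h3 : m = 0 := by
    have h4 : m < 1 := by exact_mod_cast h1
    have h5 : -1 < m := by exact_mod_cast h2
    omega
  rw [h3] at hm
  simp only [Int.cast_zero, mul_zero] at hm
  linarith

/-! ### The half-angle parametrization of the circle -/

/-- The cosine of the angle whose half-tangent is the given point of `ℝ ∪ {∞}`. -/
def hcos (x : OnePoint ℝ) : ℝ := x.elim (-1) fun y => (1 - y ^ 2) / (1 + y ^ 2)

/-- The sine of the angle whose half-tangent is the given point of `ℝ ∪ {∞}`. -/
def hsin (x : OnePoint ℝ) : ℝ := x.elim 0 fun y => 2 * y / (1 + y ^ 2)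

@[simp] lemma hcos_infty : hcos OnePoint.infty = -1 := rfl
@[simp] lemma hsin_infty : hsin OnePoint.infty = 0 := rfl
@[simp] lemma hcos_coe (y : ℝ) : hcos (y : OnePoint ℝ) = (1 - y ^ 2) / (1 + y ^ 2) := rfl
@[simp] lemma hsin_coe (y : ℝ) : hsin (y : OnePoint ℝ) = 2 * y / (1 + y ^ 2) := rfl

lemma hcos_sq_add_hsin_sq (x : OnePoint ℝ) : hcos x ^ 2 + hsin x ^ 2 = 1 := by
  induction x using OnePoint.rec with
  | infty => simp
  | coe y =>
    have : 1 + y ^ 2 ≠ 0 := by positivity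
    simp only [hcos_coe, hsin_coe]
    field_simp
    ring

lemma one_add_hcos_coe (y : ℝ) : 1 + hcos (y : OnePoint ℝ) = 2 / (1 + y ^ 2) := by
  have : 1 + y ^ 2 ≠ 0 := by positivity
  simp only [hcos_coe]
  field_simp
  ring

lemma ext_of_hcos_hsin {x y : OnePoint ℝ} (hc : hcos x = hcos y) (hs : hsin x = hsin y) :
    x = y := by
  have key : ∀ z : ℝ, hcos (z : OnePoint ℝ) ≠ -1 := fun z h => by
    have h1 := one_add_hcos_coe z
    have : 0 < 2 / (1 + z ^ 2) := by positivity
    linarith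
  induction x using OnePoint.rec with
  | infty =>
    induction y using OnePoint.rec with
    | infty => rfl
    | coe y => exact absurd hc.symm (key y)
  | coe x =>
    induction y using OnePoint.rec with
    | infty => exact absurd hc (key x)
    | coe y =>
      have h : ∀ z : ℝ, z = hsin (z : OnePoint ℝ) / (1 + hcos (z : OnePoint ℝ)) := fun z => by
        have : 1 + z ^ 2 ≠ 0 := by positivity
        rw [one_add_hcos_coe, hsin_coe]
        field_simp
      rw [h x, h y, hc, hs]

lemma continuous_hcos : Continuous hcos := by
  rw [continuous_iff_continuousAt]
  intro x
  induction x using OnePoint.rec with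
  | infty =>
    rw [OnePoint.continuousAt_infty', Filter.coclosedCompact_eq_cocompact]
    have h : (hcos ∘ ((↑) : ℝ → OnePoint ℝ)) = fun y => 2 * (1 + y ^ 2)⁻¹ - 1 := by
      funext y
      have := one_add_hcos_coe y
      simp only [Function.comp_apply]
      rw [eq_sub_iff_add_eq', this, div_eq_mul_inv]
    rw [h]
    have h2 : Filter.Tendsto (fun y : ℝ => 1 + y ^ 2) (Filter.cocompact ℝ) Filter.atTop := by
      apply Filter.tendsto_atTop_add_const_left
      have := (Filter.tendsto_pow_atTop (α := ℝ) two_ne_zero).comp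
        (tendsto_norm_cocompact_atTop (E := ℝ))
      refine this.congr fun y => ?_
      simp
    have h3 := (h2.inv_tendsto_atTop.const_mul 2).sub_const 1
    simpa using h3
  | coe y =>
    rw [OnePoint.continuousAt_coe]
    have : Continuous fun y : ℝ => (1 - y ^ 2) / (1 + y ^ 2) :=
      Continuous.div (by fun_prop) (by fun_prop) fun y => by positivity
    exact this.continuousAt

lemma continuous_hsin : Continuous hsin := by
  rw [continuous_iff_continuousAt]
  intro x
  induction x using OnePoint.rec with
  | infty =>
    -- `|sin| = √(1 - cos²)` reduces the limit at infinity to that of the cosine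
    have h1 : Filter.Tendsto (fun x => √(1 - hcos x ^ 2)) (nhds OnePoint.infty) (nhds 0) := by
      have : Continuous fun x => √(1 - hcos x ^ 2) :=
        ((continuous_const.sub (continuous_hcos.pow 2))).sqrt
      have h := this.tendsto OnePoint.infty
      simpa using h
    have h2 : (fun x => √(1 - hcos x ^ 2)) = fun x => ‖hsin x‖ := by
      funext x
      rw [← hcos_sq_add_hsin_sq x, add_sub_cancel_left, Real.sqrt_sq_eq_abs, Real.norm_eq_abs]
    rw [h2] at h1
    exact tendsto_zero_iff_norm_tendsto_zero.mpr h1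
  | coe y =>
    rw [OnePoint.continuousAt_coe]
    have : Continuous fun y : ℝ => 2 * y / (1 + y ^ 2) :=
      Continuous.div (by fun_prop) (by fun_prop) fun y => by positivity
    exact this.continuousAt

/-- Since `ℝ ∪ {∞}` is compact, the half-angle parametrization is an embedding into the plane, and
continuity of maps to `ℝ ∪ {∞}` can be tested on cosine and sine. -/
lemma continuous_of_hcos_hsin {X : Type*} [TopologicalSpace X] {f : X → OnePoint ℝ}
    (hc : Continuous fun x => hcos (f x)) (hs : Continuous fun x => hsin (f x)) :
    Continuous f := by
  have h : Topology.IsClosedEmbedding fun x : OnePoint ℝ => (hcos x, hsin x) :=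
    (continuous_hcos.prodMk continuous_hsin).isClosedEmbedding fun x y hxy =>
      ext_of_hcos_hsin (Prod.ext_iff.mp hxy).1 (Prod.ext_iff.mp hxy).2
  rw [h.isEmbedding.continuous_iff]
  exact hc.prodMk hs

lemma hcos_halfTan {φ : ℝ} (h : φ ∈ Set.Ioc (-π) π) : hcos (halfTan φ) = Real.cos φ := by
  unfold halfTan
  split_ifs with hφ
  · simp [hφ]
  · have hc : Real.cos (φ / 2) ≠ 0 := by
      have : φ < π := lt_of_le_of_ne h.2 hφ
      exact (Real.cos_pos_of_mem_Ioo ⟨by linarith [h.1], by linarith⟩).ne'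
    have e : φ = 2 * (φ / 2) := by ring
    rw [hcos_coe]
    conv_rhs => rw [e, Real.cos_two_mul]
    rw [Real.tan_eq_sin_div_cos]
    have h1 := Real.sin_sq_add_cos_sq (φ / 2)
    have h2 : Real.sin (φ / 2) ^ 2 = 1 - Real.cos (φ / 2) ^ 2 := by linarith
    field_simp
    rw [h2]
    ring

lemma hsin_halfTan {φ : ℝ} (h : φ ∈ Set.Ioc (-π) π) : hsin (halfTan φ) = Real.sin φ := by
  unfold halfTan
  split_ifs with hφ
  · simp [hφ]
  · have hc : Real.cos (φ / 2) ≠ 0 := by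
      have : φ < π := lt_of_le_of_ne h.2 hφ
      exact (Real.cos_pos_of_mem_Ioo ⟨by linarith [h.1], by linarith⟩).ne'
    have e : φ = 2 * (φ / 2) := by ring
    rw [hsin_coe]
    conv_rhs => rw [e, Real.sin_two_mul]
    rw [Real.tan_eq_sin_div_cos]
    have h1 := Real.sin_sq_add_cos_sq (φ / 2)
    have h2 : Real.sin (φ / 2) ^ 2 = 1 - Real.cos (φ / 2) ^ 2 := by linarith
    field_simp
    rw [h2]
    ring

/-! ### Scaling and quotients on the projective line -/

/-- Multiplication by a real number on `ℝ ∪ {∞}`, fixing `∞`. -/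
def scale (r : ℝ) : OnePoint ℝ → OnePoint ℝ := OnePoint.map (r * ·)

@[simp] lemma scale_infty (r : ℝ) : scale r OnePoint.infty = OnePoint.infty := rfl
@[simp] lemma scale_coe (r y : ℝ) : scale r (y : OnePoint ℝ) = ((r * y : ℝ) : OnePoint ℝ) := rfl

lemma scale_inv_scale {r : ℝ} (hr : r ≠ 0) (x : OnePoint ℝ) : scale r (scale r⁻¹ x) = x := by
  induction x using OnePoint.rec with
  | infty => rfl
  | coe y => simp [hr]

lemma scale_injective {r : ℝ} (hr : r ≠ 0) : Function.Injective (scale r) := by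
  intro x y h
  have := congrArg (scale r⁻¹) h
  have h2 : ∀ x, scale r⁻¹ (scale r x) = x := fun x => by
    simpa using scale_inv_scale (inv_ne_zero hr) x
  rwa [h2, h2] at this

lemma continuous_scale {r : ℝ} (hr : r ≠ 0) : Continuous (scale r) :=
  (Homeomorph.mulLeft₀ r hr).onePointCongr.continuous

/-- The denominator in the formulas for cosine and sine after scaling the half-tangent. -/
def scaleDen (r : ℝ) (x : OnePoint ℝ) : ℝ := (1 + hcos x) + r ^ 2 * (1 - hcos x)

lemma abs_hcos_le_one (x : OnePoint ℝ) : |hcos x| ≤ 1 := by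
  rw [← sq_le_one_iff_abs_le_one]
  nlinarith [hcos_sq_add_hsin_sq x, sq_nonneg (hsin x)]

lemma scaleDen_pos {r : ℝ} (hr : r ≠ 0) (x : OnePoint ℝ) : 0 < scaleDen r x := by
  have h := abs_le.mp (abs_hcos_le_one x)
  have h2 : 0 < r ^ 2 := by positivity
  unfold scaleDen
  rcases h.1.lt_or_eq with h1 | h1
  · have : 0 ≤ r ^ 2 * (1 - hcos x) := mul_nonneg h2.le (by linarith [h.2])
    linarith
  · rw [← h1]
    linarith

lemma hcos_scale {r : ℝ} (hr : r ≠ 0) (x : OnePoint ℝ) :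
    hcos (scale r x) * scaleDen r x = (1 + hcos x) - r ^ 2 * (1 - hcos x) := by
  unfold scaleDen
  induction x using OnePoint.rec with
  | infty => simp
  | coe y =>
    have h1 : 1 + y ^ 2 ≠ 0 := by positivity
    have h2 : 1 + (r * y) ^ 2 ≠ 0 := by positivity
    simp only [scale_coe, hcos_coe]
    field_simp
    ring

lemma hsin_scale {r : ℝ} (hr : r ≠ 0) (x : OnePoint ℝ) :
    hsin (scale r x) * scaleDen r x = 2 * r * hsin x := by
  unfold scaleDen
  induction x using OnePoint.rec with
  | infty => simp
  | coe y =>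
    have h1 : 1 + y ^ 2 ≠ 0 := by positivity
    have h2 : 1 + (r * y) ^ 2 ≠ 0 := by positivity
    simp only [scale_coe, hcos_coe, hsin_coe]
    field_simp
    ring

lemma projQuot_mul_left {r : ℝ} (hr : r ≠ 0) (x y : ℝ) :
    projQuot (r * x) y = scale r (projQuot x y) := by
  unfold projQuot
  by_cases hy : y = 0
  · by_cases hx : x = 0 <;> simp [hx, hy, hr]
  · simp [hy, mul_div_assoc]

/-- If `d² + s² = k²` with `k ≠ 0`, then `(k + d) / s` is the half-tangent of an angle with
cosine `-d / k` and sine `s / k`. For `s = 0` and `d = -k` the convention `0 / 0 = 0`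
gives the right value. -/
lemma hcos_projQuot {k d s : ℝ} (hk : k ≠ 0) (h : d ^ 2 + s ^ 2 = k ^ 2) :
    hcos (projQuot (k + d) s) = -d / k := by
  unfold projQuot
  by_cases hs : s = 0
  · by_cases hd : k + d = 0
    · have : d = -k := by linarith
      subst this
      simp [hs, hk]
    · have : d = k := by
        have : (k + d) * (d - k) = 0 := by rw [hs] at h; linear_combination h
        rcases mul_eq_zero.mp this with h | h
        · exact absurd h hd
        · linarith
      subst this
      simp only [hs, hd, if_true, if_false, hcos_infty]
      field_simp
  · have hkd : 0 < s ^ 2 + (k + d) ^ 2 := by positivity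
    simp only [hs, if_false, hcos_coe]
    have e : 1 + ((k + d) / s) ^ 2 = (s ^ 2 + (k + d) ^ 2) / s ^ 2 := by field_simp
    rw [e]
    field_simp
    linear_combination (k + d) * h

lemma hsin_projQuot {k d s : ℝ} (hk : k ≠ 0) (h : d ^ 2 + s ^ 2 = k ^ 2) :
    hsin (projQuot (k + d) s) = s / k := by
  unfold projQuot
  by_cases hs : s = 0
  · by_cases hd : k + d = 0 <;> simp [hs, hd]
  · have hkd : 0 < s ^ 2 + (k + d) ^ 2 := by positivity
    simp only [hs, if_false, hsin_coe]
    have e : 1 + ((k + d) / s) ^ 2 = (s ^ 2 + (k + d) ^ 2) / s ^ 2 := by field_simp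
    rw [e]
    field_simp
    linear_combination -h

/-! ### The curve `cosh X cosh Y = ζ` -/

/-- Half the sum of the two coordinates on the curve `cosh X cosh Y = ζ`. -/
def halfSum (ζ t : ℝ) : ℝ := Real.arsinh (√(ζ - 1) * Real.sin t)

/-- Half the difference of the two coordinates on the curve `cosh X cosh Y = ζ`. -/
def halfDiff (ζ t : ℝ) : ℝ := Real.arsinh (√(ζ - 1) * Real.cos t)

/-- The first coordinate on the curve `cosh X cosh Y = ζ`: the logarithm of the first variable of a
branch, up to sign and scale. -/
def curveX (ζ t : ℝ) : ℝ := halfSum ζ t + halfDiff ζ t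

/-- The second coordinate on the curve `cosh X cosh Y = ζ`: the logarithm of the last variable of a
branch, up to sign and scale. -/
def curveY (ζ t : ℝ) : ℝ := halfSum ζ t - halfDiff ζ t

section

variable {ζ : ℝ} (hζ : 1 < ζ)

include hζ

lemma sqrt_sub_one_pos : 0 < √(ζ - 1) := Real.sqrt_pos.mpr (by linarith)

lemma sq_sqrt_sub_one : √(ζ - 1) ^ 2 = ζ - 1 := Real.sq_sqrt (by linarith)

lemma cosh_halfSum (t : ℝ) : Real.cosh (halfSum ζ t) = √(1 + (ζ - 1) * Real.sin t ^ 2) := by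
  rw [halfSum, Real.cosh_arsinh, mul_pow, sq_sqrt_sub_one hζ]

lemma cosh_halfDiff (t : ℝ) : Real.cosh (halfDiff ζ t) = √(1 + (ζ - 1) * Real.cos t ^ 2) := by
  rw [halfDiff, Real.cosh_arsinh, mul_pow, sq_sqrt_sub_one hζ]

lemma cosh_curveX_mul_cosh_curveY (t : ℝ) :
    Real.cosh (curveX ζ t) * Real.cosh (curveY ζ t) = ζ := by
  have h1 : Real.sinh (halfSum ζ t) = √(ζ - 1) * Real.sin t := Real.sinh_arsinh _
  have h2 : Real.sinh (halfDiff ζ t) = √(ζ - 1) * Real.cos t := Real.sinh_arsinh _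
  rw [curveX, curveY, Real.cosh_add, Real.cosh_sub]
  have h3 := Real.cosh_sq (halfSum ζ t)
  have h4 := Real.cosh_sq (halfDiff ζ t)
  have h5 := Real.sin_sq_add_cos_sq t
  have h6 := sq_sqrt_sub_one hζ
  rw [h1] at h3 ⊢
  rw [h2] at h4 ⊢
  linear_combination (Real.cosh (halfDiff ζ t)) ^ 2 * h3 +
    (1 + (√(ζ - 1) * Real.sin t) ^ 2) * h4 + √(ζ - 1) ^ 2 * h5 + h6

lemma exists_curve_param {X Y : ℝ} (h : Real.cosh X * Real.cosh Y = ζ) :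
    ∃ t ∈ Set.Ico 0 (2 * π), curveX ζ t = X ∧ curveY ζ t = Y := by
  have hk := sqrt_sub_one_pos hζ
  have h1 : Real.sinh ((X + Y) / 2) ^ 2 + Real.sinh ((X - Y) / 2) ^ 2 = ζ - 1 := by
    have e1 := Real.cosh_sq ((X + Y) / 2)
    have e2 := Real.cosh_sq ((X - Y) / 2)
    have eX : X = (X + Y) / 2 + (X - Y) / 2 := by ring
    have eY : Y = (X + Y) / 2 - (X - Y) / 2 := by ring
    have : Real.cosh ((X + Y) / 2 + (X - Y) / 2) * Real.cosh ((X + Y) / 2 - (X - Y) / 2) = ζ := by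
      rw [← eX, ← eY, h]
    rw [Real.cosh_add, Real.cosh_sub] at this
    linear_combination this - Real.cosh ((X - Y) / 2) ^ 2 * e1 -
      (1 + Real.sinh ((X + Y) / 2) ^ 2) * e2
  obtain ⟨t, ht, hc, hs⟩ := exists_mem_Ico_cos_sin
    (x := Real.sinh ((X - Y) / 2) / √(ζ - 1)) (y := Real.sinh ((X + Y) / 2) / √(ζ - 1)) (by
      rw [div_pow, div_pow, sq_sqrt_sub_one hζ, ← add_div, add_comm, h1]
      exact div_self (by linarith))
  have ha : halfSum ζ t = (X + Y) / 2 := by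
    rw [halfSum, hs, mul_div_cancel₀ _ hk.ne', Real.arsinh_sinh]
  have hb : halfDiff ζ t = (X - Y) / 2 := by
    rw [halfDiff, hc, mul_div_cancel₀ _ hk.ne', Real.arsinh_sinh]
  refine ⟨t, ht, ?_, ?_⟩
  · rw [curveX, ha, hb]; ring
  · rw [curveY, ha, hb]; ring

lemma cos_sin_eq_of_curve_eq {t t' : ℝ} (hX : curveX ζ t = curveX ζ t')
    (hY : curveY ζ t = curveY ζ t') : Real.cos t = Real.cos t' ∧ Real.sin t = Real.sin t' := by
  have hk := sqrt_sub_one_pos hζ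
  unfold curveX at hX
  unfold curveY at hY
  have h1 : halfSum ζ t = halfSum ζ t' := by linarith
  have h2 : halfDiff ζ t = halfDiff ζ t' := by linarith
  exact ⟨mul_left_cancel₀ hk.ne' (Real.arsinh_injective h2),
    mul_left_cancel₀ hk.ne' (Real.arsinh_injective h1)⟩

lemma auxF_eq (t : ℝ) : auxF ζ t = Real.exp (halfSum ζ t) := by
  rw [halfSum, Real.exp_arsinh, auxF, mul_pow, sq_sqrt_sub_one hζ, mul_comm]

lemma auxF_add (t : ℝ) : auxF ζ (t + π / 2) = Real.exp (halfDiff ζ t) := by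
  rw [halfDiff, Real.exp_arsinh, auxF, mul_pow, sq_sqrt_sub_one hζ, mul_comm,
    Real.sin_add_pi_div_two]

lemma auxF_sub (t : ℝ) : auxF ζ (t - π / 2) = Real.exp (-halfDiff ζ t) := by
  rw [halfDiff, ← Real.arsinh_neg, Real.exp_arsinh, auxF, neg_sq, mul_pow, sq_sqrt_sub_one hζ,
    Real.sin_sub_pi_div_two, neg_sq]
  ring

lemma sqrt_mul_auxG_add (t : ℝ) : √(ζ - 1) * (auxG ζ t + auxG ζ (t + π / 2)) =
    Real.cosh (curveY ζ t) * Real.sinh (curveX ζ t) := by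
  rw [auxG, auxG, Real.sin_add_pi_div_two, ← cosh_halfSum hζ, ← cosh_halfDiff hζ, mul_add,
    ← mul_assoc, ← mul_assoc, ← Real.sinh_arsinh (√(ζ - 1) * Real.sin t),
    ← Real.sinh_arsinh (√(ζ - 1) * Real.cos t), ← halfSum, ← halfDiff, curveX, curveY,
    Real.cosh_sub, Real.sinh_add]
  linear_combination (-Real.sinh (halfSum ζ t) * Real.cosh (halfSum ζ t)) *
    Real.cosh_sq (halfDiff ζ t) - Real.sinh (halfDiff ζ t) * Real.cosh (halfDiff ζ t) *
    Real.cosh_sq (halfSum ζ t)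

lemma sqrt_mul_auxG_sub (t : ℝ) : √(ζ - 1) * (auxG ζ t + auxG ζ (t - π / 2)) =
    Real.cosh (curveX ζ t) * Real.sinh (curveY ζ t) := by
  rw [auxG, auxG, Real.sin_sub_pi_div_two, neg_sq, ← cosh_halfSum hζ, ← cosh_halfDiff hζ, mul_add,
    ← mul_assoc, ← mul_assoc, mul_neg, ← Real.sinh_arsinh (√(ζ - 1) * Real.sin t),
    ← Real.sinh_arsinh (√(ζ - 1) * Real.cos t), ← halfSum, ← halfDiff, curveX, curveY,
    Real.cosh_add, Real.sinh_sub]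
  linear_combination (-Real.sinh (halfSum ζ t) * Real.cosh (halfSum ζ t)) *
    Real.cosh_sq (halfDiff ζ t) + Real.sinh (halfDiff ζ t) * Real.cosh (halfDiff ζ t) *
    Real.cosh_sq (halfSum ζ t)

lemma sqrt_mul_auxV_sub_add (t : ℝ) : √(ζ - 1) * (auxV ζ t - auxV ζ (t + π / 2)) =
    Real.sinh (curveY ζ t) := by
  rw [auxV, auxV, Real.sin_add_pi_div_two, Real.cos_add_pi_div_two, neg_sq, ← cosh_halfSum hζ,
    ← cosh_halfDiff hζ, mul_sub,
    ← mul_assoc, ← mul_assoc, ← Real.sinh_arsinh (√(ζ - 1) * Real.sin t),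
    ← Real.sinh_arsinh (√(ζ - 1) * Real.cos t), ← halfSum, ← halfDiff, curveY, Real.sinh_sub]
  ring

lemma sqrt_mul_auxV_sub_sub (t : ℝ) : √(ζ - 1) * (auxV ζ t - auxV ζ (t - π / 2)) =
    Real.sinh (curveX ζ t) := by
  rw [auxV, auxV, Real.sin_sub_pi_div_two, Real.cos_sub_pi_div_two, ← cosh_halfSum hζ,
    ← cosh_halfDiff hζ, mul_sub,
    ← mul_assoc, ← mul_assoc, mul_neg, ← Real.sinh_arsinh (√(ζ - 1) * Real.sin t),
    ← Real.sinh_arsinh (√(ζ - 1) * Real.cos t), ← halfSum, ← halfDiff, curveX, Real.sinh_add]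
  ring

lemma sq_add_sq_curve (t : ℝ) :
    (Real.cosh (curveX ζ t) * Real.sinh (curveY ζ t)) ^ 2 + Real.sinh (curveX ζ t) ^ 2 =
      ζ ^ 2 - 1 := by
  have h := cosh_curveX_mul_cosh_curveY hζ t
  have h1 := Real.cosh_sq (curveX ζ t)
  have h2 := Real.cosh_sq (curveY ζ t)
  linear_combination -h1 - Real.cosh (curveX ζ t) ^ 2 * h2 +
    (Real.cosh (curveX ζ t) * Real.cosh (curveY ζ t) + ζ) * h

lemma sq_add_sq_curve' (t : ℝ) :
    (Real.cosh (curveY ζ t) * Real.sinh (curveX ζ t)) ^ 2 + Real.sinh (curveY ζ t) ^ 2 =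
      ζ ^ 2 - 1 := by
  have h := cosh_curveX_mul_cosh_curveY hζ t
  have h1 := Real.cosh_sq (curveX ζ t)
  have h2 := Real.cosh_sq (curveY ζ t)
  linear_combination -h2 - Real.cosh (curveY ζ t) ^ 2 * h1 +
    (Real.cosh (curveX ζ t) * Real.cosh (curveY ζ t) + ζ) * h

end

lemma continuous_curveX (ζ : ℝ) : Continuous (curveX ζ) := by
  unfold curveX halfSum halfDiff
  exact (Real.continuous_arsinh.comp (by fun_prop)).add (Real.continuous_arsinh.comp (by fun_prop))

lemma continuous_curveY (ζ : ℝ) : Continuous (curveY ζ) := by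
  unfold curveY halfSum halfDiff
  exact (Real.continuous_arsinh.comp (by fun_prop)).sub (Real.continuous_arsinh.comp (by fun_prop))

/-! ### The normalised branches -/

/-- A branch with the factors `√|λ|` and `√|μ|` removed from its four variables; `σ i` is the sign
of `ν i`, and `h`, `e` are the two signs that number the branches. -/
def normBranch (σ : Fin 4 → ℝ) (ζ h e t : ℝ) : Fin 4 → OnePoint ℝ :=
  ![((h * (σ 0 * (auxF ζ t * auxF ζ (t + π / 2))) : ℝ) : OnePoint ℝ),
    projQuot (h * (σ 0 * σ 1 * √(ζ + 1) + e * (σ 2 * σ 3) * (auxG ζ t + auxG ζ (t - π / 2))))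
      (auxV ζ t - auxV ζ (t - π / 2)),
    projQuot (h * (σ 3 * (√(ζ + 1) + e * (auxG ζ t + auxG ζ (t + π / 2)))))
      (auxV ζ t - auxV ζ (t + π / 2)),
    ((h * (auxF ζ t * auxF ζ (t - π / 2)) : ℝ) : OnePoint ℝ)]

lemma hcos_sign_mul_exp {h : ℝ} (hh : h ^ 2 = 1) (x : ℝ) :
    hcos ((h * Real.exp x : ℝ) : OnePoint ℝ) = -(Real.sinh x / Real.cosh x) := by
  have hx := Real.cosh_pos x
  have e : 1 + (h * Real.exp x) ^ 2 = 2 * Real.exp x * Real.cosh x := by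
    rw [mul_pow, hh, Real.cosh_eq, Real.exp_neg]
    field_simp
    ring
  have e2 : 1 - (h * Real.exp x) ^ 2 = -(2 * Real.exp x * Real.sinh x) := by
    rw [mul_pow, hh, Real.sinh_eq, Real.exp_neg]
    field_simp
    ring
  rw [hcos_coe, e, e2]
  have := Real.exp_pos x
  field_simp

lemma hsin_sign_mul_exp {h : ℝ} (hh : h ^ 2 = 1) (x : ℝ) :
    hsin ((h * Real.exp x : ℝ) : OnePoint ℝ) = h / Real.cosh x := by
  have hx := Real.cosh_pos x
  have e : 1 + (h * Real.exp x) ^ 2 = 2 * Real.exp x * Real.cosh x := by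
    rw [mul_pow, hh, Real.cosh_eq, Real.exp_neg]
    field_simp
    ring
  rw [hsin_coe, e]
  have := Real.exp_pos x
  field_simp

section

variable {σ : Fin 4 → ℝ} {ζ h e : ℝ} (hζ : 1 < ζ) (hσ : ∀ i, σ i ^ 2 = 1) (hh : h ^ 2 = 1)
  (he : e ^ 2 = 1)

include hζ

lemma sqrt_sq_sub_one : √(ζ ^ 2 - 1) = √(ζ - 1) * √(ζ + 1) := by
  rw [← Real.sqrt_mul (by linarith)]
  congr 1
  ring

lemma sqrt_sq_sub_one_pos : 0 < √(ζ ^ 2 - 1) := Real.sqrt_pos.mpr (by nlinarith)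

lemma sq_sqrt_sq_sub_one : √(ζ ^ 2 - 1) ^ 2 = ζ ^ 2 - 1 := Real.sq_sqrt (by nlinarith)

lemma normBranch_zero (t : ℝ) :
    normBranch σ ζ h e t 0 = ((h * σ 0 * Real.exp (curveX ζ t) : ℝ) : OnePoint ℝ) := by
  simp only [normBranch, Matrix.cons_val_zero]
  rw [auxF_eq hζ, auxF_add hζ, ← Real.exp_add, ← curveX, mul_assoc]

lemma normBranch_three (t : ℝ) :
    normBranch σ ζ h e t 3 = ((h * Real.exp (curveY ζ t) : ℝ) : OnePoint ℝ) := by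
  simp only [normBranch, Matrix.cons_val]
  rw [auxF_eq hζ, auxF_sub hζ, ← Real.exp_add, ← sub_eq_add_neg, ← curveY]

include hh

lemma hcos_normBranch_three (t : ℝ) : hcos (normBranch σ ζ h e t 3) =
    -(Real.sinh (curveY ζ t) / Real.cosh (curveY ζ t)) := by
  rw [normBranch_three hζ, hcos_sign_mul_exp hh]

lemma hsin_normBranch_three (t : ℝ) : hsin (normBranch σ ζ h e t 3) =
    h / Real.cosh (curveY ζ t) := by
  rw [normBranch_three hζ, hsin_sign_mul_exp hh]

include hσ

lemma hcos_normBranch_zero (t : ℝ) : hcos (normBranch σ ζ h e t 0) =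
    -(Real.sinh (curveX ζ t) / Real.cosh (curveX ζ t)) := by
  rw [normBranch_zero hζ, hcos_sign_mul_exp (by rw [mul_pow, hh, hσ, one_mul])]

lemma hsin_normBranch_zero (t : ℝ) : hsin (normBranch σ ζ h e t 0) =
    h * σ 0 / Real.cosh (curveX ζ t) := by
  rw [normBranch_zero hζ, hsin_sign_mul_exp (by rw [mul_pow, hh, hσ, one_mul])]

include he

/-- The second variable of a normalised branch in the form to which `hcos_projQuot` applies:
`k`, `d`, `s` are the constant term and the varying part of its numerator, and its denominator. -/
lemma normBranch_one_aux (t : ℝ) : ∃ k d s : ℝ, normBranch σ ζ h e t 1 = projQuot (k + d) s ∧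
    k ≠ 0 ∧ d ^ 2 + s ^ 2 = k ^ 2 ∧
    d = k * (e * (σ 0 * σ 1 * σ 2 * σ 3) * (Real.cosh (curveX ζ t) * Real.sinh (curveY ζ t)) /
      √(ζ ^ 2 - 1)) ∧ s = k * (h * (σ 0 * σ 1) * Real.sinh (curveX ζ t) / √(ζ ^ 2 - 1)) := by
  have hk := sqrt_sub_one_pos hζ
  have hk1 : 0 < √(ζ + 1) := Real.sqrt_pos.mpr (by linarith)
  have hg := sqrt_mul_auxG_sub hζ t
  have hv := sqrt_mul_auxV_sub_sub hζ t
  have hsq := sq_add_sq_curve hζ t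
  have h0 := hσ 0; have h1 := hσ 1; have h2 := hσ 2; have h3 := hσ 3
  have h01 : (h * (σ 0 * σ 1)) ^ 2 = 1 := by rw [mul_pow, mul_pow, hh, h0, h1]; ring
  refine ⟨h * (σ 0 * σ 1) * √(ζ + 1), h * (e * (σ 2 * σ 3) * (auxG ζ t + auxG ζ (t - π / 2))),
    auxV ζ t - auxV ζ (t - π / 2), ?_, ?_, ?_, ?_, ?_⟩
  · simp only [normBranch, Matrix.cons_val]
    congr 1
    ring
  · have : h * (σ 0 * σ 1) ≠ 0 := fun h => by rw [h] at h01; norm_num at h01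
    positivity
  · have e1 : √(ζ + 1) ^ 2 = ζ + 1 := Real.sq_sqrt (by linarith)
    have e2 := sq_sqrt_sub_one hζ
    have : (h * (e * (σ 2 * σ 3))) ^ 2 = 1 := by
      rw [mul_pow, mul_pow, mul_pow, hh, h2, h3, he]; ring
    have e3 : ∀ x, (h * (e * (σ 2 * σ 3) * x)) ^ 2 = x ^ 2 := fun x => by
      linear_combination x ^ 2 * this
    rw [e3, mul_pow _ (√(ζ + 1)), h01, e1]
    rw [← hg, ← hv, mul_pow, mul_pow, e2] at hsq
    have hne : ζ - 1 ≠ 0 := by linarith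
    apply mul_left_cancel₀ hne
    linear_combination hsq
  · rw [← hg, sqrt_sq_sub_one hζ]
    generalize auxG ζ (t - π / 2) = g
    field_simp
    linear_combination (-(h * e * σ 2 * σ 3 * (auxG ζ t + g))) * (σ 1 ^ 2 * h0 + h1)
  · rw [← hv, sqrt_sq_sub_one hζ]
    generalize auxV ζ (t - π / 2) = g
    field_simp
    linear_combination (-(auxV ζ t - g)) * h01

lemma hcos_normBranch_one (t : ℝ) : hcos (normBranch σ ζ h e t 1) =
    -(e * (σ 0 * σ 1 * σ 2 * σ 3) * (Real.cosh (curveX ζ t) * Real.sinh (curveY ζ t)) /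
      √(ζ ^ 2 - 1)) := by
  obtain ⟨k, d, s, h1, hk, hds, hd, hs⟩ := normBranch_one_aux hζ hσ hh he t
  rw [h1, hcos_projQuot hk hds, neg_div, hd, mul_div_cancel_left₀ _ hk]

lemma hsin_normBranch_one (t : ℝ) : hsin (normBranch σ ζ h e t 1) =
    h * (σ 0 * σ 1) * Real.sinh (curveX ζ t) / √(ζ ^ 2 - 1) := by
  obtain ⟨k, d, s, h1, hk, hds, hd, hs⟩ := normBranch_one_aux hζ hσ hh he t
  rw [h1, hsin_projQuot hk hds, hs, mul_div_cancel_left₀ _ hk]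

/-- The third variable of a normalised branch in the form to which `hcos_projQuot` applies. -/
lemma normBranch_two_aux (t : ℝ) : ∃ k d s : ℝ, normBranch σ ζ h e t 2 = projQuot (k + d) s ∧
    k ≠ 0 ∧ d ^ 2 + s ^ 2 = k ^ 2 ∧
    d = k * (e * (Real.cosh (curveY ζ t) * Real.sinh (curveX ζ t)) / √(ζ ^ 2 - 1)) ∧
    s = k * (h * σ 3 * Real.sinh (curveY ζ t) / √(ζ ^ 2 - 1)) := by
  have hk := sqrt_sub_one_pos hζ
  have hk1 : 0 < √(ζ + 1) := Real.sqrt_pos.mpr (by linarith)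
  have hg := sqrt_mul_auxG_add hζ t
  have hv := sqrt_mul_auxV_sub_add hζ t
  have hsq := sq_add_sq_curve' hζ t
  have h3 := hσ 3
  have h03 : (h * σ 3) ^ 2 = 1 := by rw [mul_pow, hh, h3]; ring
  refine ⟨h * σ 3 * √(ζ + 1), h * (σ 3 * (e * (auxG ζ t + auxG ζ (t + π / 2)))),
    auxV ζ t - auxV ζ (t + π / 2), ?_, ?_, ?_, ?_, ?_⟩
  · simp only [normBranch, Matrix.cons_val]
    congr 1
    ring
  · have : h * σ 3 ≠ 0 := fun h => by rw [h] at h03; norm_num at h03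
    positivity
  · have e1 : √(ζ + 1) ^ 2 = ζ + 1 := Real.sq_sqrt (by linarith)
    have e2 := sq_sqrt_sub_one hζ
    have e3 : ∀ x, (h * (σ 3 * (e * x))) ^ 2 = x ^ 2 := fun x => by
      linear_combination x ^ 2 * e ^ 2 * h03 + x ^ 2 * he
    rw [e3, mul_pow _ (√(ζ + 1)), h03, e1]
    rw [← hg, ← hv, mul_pow, mul_pow, e2] at hsq
    have hne : ζ - 1 ≠ 0 := by linarith
    apply mul_left_cancel₀ hne
    linear_combination hsq
  · rw [← hg, sqrt_sq_sub_one hζ]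
    field_simp
  · rw [← hv, sqrt_sq_sub_one hζ]
    generalize auxV ζ (t + π / 2) = g
    field_simp
    linear_combination (-(auxV ζ t - g)) * h03

lemma hcos_normBranch_two (t : ℝ) : hcos (normBranch σ ζ h e t 2) =
    -(e * (Real.cosh (curveY ζ t) * Real.sinh (curveX ζ t)) / √(ζ ^ 2 - 1)) := by
  obtain ⟨k, d, s, h1, hk, hds, hd, hs⟩ := normBranch_two_aux hζ hσ hh he t
  rw [h1, hcos_projQuot hk hds, neg_div, hd, mul_div_cancel_left₀ _ hk]

lemma hsin_normBranch_two (t : ℝ) : hsin (normBranch σ ζ h e t 2) =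
    h * σ 3 * Real.sinh (curveY ζ t) / √(ζ ^ 2 - 1) := by
  obtain ⟨k, d, s, h1, hk, hds, hd, hs⟩ := normBranch_two_aux hζ hσ hh he t
  rw [h1, hsin_projQuot hk hds, hs, mul_div_cancel_left₀ _ hk]

lemma continuous_normBranch : Continuous (normBranch σ ζ h e) := by
  have hX := continuous_curveX ζ
  have hY := continuous_curveY ζ
  have hcX := fun t => (Real.cosh_pos (curveX ζ t)).ne'
  have hcY := fun t => (Real.cosh_pos (curveY ζ t)).ne'
  have c1 := Real.continuous_cosh
  have c2 := Real.continuous_sinh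
  refine continuous_pi fun j => ?_
  fin_cases j
  · refine continuous_of_hcos_hsin ?_ ?_
    · simp only [Fin.zero_eta, hcos_normBranch_zero hζ hσ hh]
      exact ((c2.comp hX).div (c1.comp hX) hcX).neg
    · simp only [Fin.zero_eta, hsin_normBranch_zero hζ hσ hh]
      exact continuous_const.div (c1.comp hX) hcX
  · refine continuous_of_hcos_hsin ?_ ?_
    · simp only [Fin.mk_one, hcos_normBranch_one hζ hσ hh he]
      fun_prop
    · simp only [Fin.mk_one, hsin_normBranch_one hζ hσ hh he]
      fun_prop
  · refine continuous_of_hcos_hsin ?_ ?_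
    · simp only [Fin.reduceFinMk, hcos_normBranch_two hζ hσ hh he]
      fun_prop
    · simp only [Fin.reduceFinMk, hsin_normBranch_two hζ hσ hh he]
      fun_prop
  · refine continuous_of_hcos_hsin ?_ ?_
    · simp only [Fin.reduceFinMk, hcos_normBranch_three hζ hh]
      exact ((c2.comp hY).div (c1.comp hY) hcY).neg
    · simp only [Fin.reduceFinMk, hsin_normBranch_three hζ hh]
      exact continuous_const.div (c1.comp hY) hcY

end

/-! ### Solving the normalised system -/

/-- The equations between the four half-tangents `x i`, with the factors `√|λ|` and `√|μ|`
removed, written in terms of the cosines and sines of the corresponding angles. -/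
structure NormSystem (σ : Fin 4 → ℝ) (ζ : ℝ) (x : Fin 4 → OnePoint ℝ) : Prop where
  eq₀ : ζ * σ 0 * (hsin (x 0) * hsin (x 3)) = 1
  eq₁ : -hcos (x 0) = σ 1 * √(ζ ^ 2 - 1) * (hsin (x 1) * hsin (x 0))
  eq₂ : hcos (x 2) * hcos (x 1) = σ 2 * ζ * (hsin (x 2) * hsin (x 1))
  eq₃ : -hcos (x 3) = σ 3 * √(ζ ^ 2 - 1) * (hsin (x 3) * hsin (x 2))

lemma sq_intCast_units (η : ℤˣ) : (((η : ℤ) : ℝ)) ^ 2 = 1 := by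
  rcases Int.units_eq_one_or η with h | h <;> simp [h]

lemma exists_units_of_sq_eq_one {e : ℝ} (he : e ^ 2 = 1) : ∃ ε : ℤˣ, (((ε : ℤ) : ℝ)) = e := by
  rcases sq_eq_one_iff.mp he with h | h
  · exact ⟨1, by simp [h]⟩
  · exact ⟨-1, by simp [h]⟩

lemma exists_sign_mul_exp {x : OnePoint ℝ} (hx : hsin x ≠ 0) :
    ∃ h X : ℝ, h ^ 2 = 1 ∧ x = ((h * Real.exp X : ℝ) : OnePoint ℝ) := by
  induction x using OnePoint.rec with
  | infty => exact absurd rfl hx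
  | coe y =>
    have hy : y ≠ 0 := fun h => hx (by simp [h])
    rcases hy.lt_or_gt with h | h
    · refine ⟨-1, Real.log (-y), by norm_num, ?_⟩
      rw [Real.exp_log (by linarith)]
      simp
    · refine ⟨1, Real.log y, by norm_num, ?_⟩
      rw [Real.exp_log h, one_mul]

lemma exists_common_sign {p q P Q : ℝ} (hp : p ^ 2 = P ^ 2) (hq : q ^ 2 = Q ^ 2)
    (hpq : p * q = P * Q) : ∃ e : ℝ, e ^ 2 = 1 ∧ p = e * P ∧ q = e * Q := by
  by_cases hP : P = 0
  · have hp0 : p = 0 := by simpa [hP] using hp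
    rcases sq_eq_sq_iff_eq_or_eq_neg.mp hq with h | h
    · exact ⟨1, by norm_num, by simp [hP, hp0], by simp [h]⟩
    · exact ⟨-1, by norm_num, by simp [hP, hp0], by simp [h]⟩
  · rcases sq_eq_sq_iff_eq_or_eq_neg.mp hp with h | h
    · refine ⟨1, by norm_num, by simp [h], ?_⟩
      rw [h] at hpq
      simpa using mul_left_cancel₀ hP hpq
    · refine ⟨-1, by norm_num, by simp [h], ?_⟩
      rw [h, neg_mul, ← mul_neg] at hpq
      have := mul_left_cancel₀ hP hpq
      linarith

lemma sign_mul_exp_inj {h h' x x' : ℝ} (hh : h ^ 2 = 1) (hh' : h' ^ 2 = 1)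
    (H : h * Real.exp x = h' * Real.exp x') : h = h' ∧ x = x' := by
  have hx := Real.exp_pos x
  have hx' := Real.exp_pos x'
  have : h = h' := by
    rcases sq_eq_one_iff.mp hh with r | r <;>
      rcases sq_eq_one_iff.mp hh' with r' | r' <;> subst r <;> subst r' <;>
      first | rfl | linarith
  refine ⟨this, ?_⟩
  subst this
  have hne : h ≠ 0 := fun h0 => by simp [h0] at hh
  exact Real.exp_injective (mul_left_cancel₀ hne H)

section

variable {σ : Fin 4 → ℝ} {ζ h e : ℝ} (hζ : 1 < ζ) (hσ : ∀ i, σ i ^ 2 = 1)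

include hζ hσ

lemma normSystem_normBranch (hh : h ^ 2 = 1) (he : e ^ 2 = 1) (t : ℝ) :
    NormSystem σ ζ (normBranch σ ζ h e t) := by
  have hX := Real.cosh_pos (curveX ζ t)
  have hY := Real.cosh_pos (curveY ζ t)
  have hXY := cosh_curveX_mul_cosh_curveY hζ t
  have hk := sqrt_sq_sub_one_pos hζ
  have s0 := hσ 0; have s1 := hσ 1; have s2 := hσ 2; have s3 := hσ 3
  refine ⟨?_, ?_, ?_, ?_⟩
  · rw [hsin_normBranch_zero hζ hσ hh, hsin_normBranch_three hζ hh]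
    have : ζ * σ 0 * (h * σ 0 / Real.cosh (curveX ζ t) * (h / Real.cosh (curveY ζ t))) =
        ζ * (h ^ 2 * σ 0 ^ 2) / (Real.cosh (curveX ζ t) * Real.cosh (curveY ζ t)) := by
      field_simp
    rw [this, hXY, hh, s0]
    field_simp
  · rw [hcos_normBranch_zero hζ hσ hh, hsin_normBranch_zero hζ hσ hh,
      hsin_normBranch_one hζ hσ hh he]
    field_simp
    linear_combination (-Real.sinh (curveX ζ t)) * (hh + h ^ 2 * s0 + h ^ 2 * σ 0 ^ 2 * s1)
  · rw [hcos_normBranch_one hζ hσ hh he, hsin_normBranch_one hζ hσ hh he,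
      hcos_normBranch_two hζ hσ hh he, hsin_normBranch_two hζ hσ hh he]
    field_simp
    linear_combination (σ 0 * σ 1 * σ 2 * σ 3) * Real.sinh (curveX ζ t) *
      Real.sinh (curveY ζ t) * (ζ * (he - hh) + e ^ 2 * (hXY))
  · rw [hcos_normBranch_three hζ hh, hsin_normBranch_three hζ hh,
      hsin_normBranch_two hζ hσ hh he]
    field_simp
    linear_combination (-Real.sinh (curveY ζ t)) * (hh + h ^ 2 * s3)

/-- Every solution of the normalised system lies on a branch: `x 0` and `x 3` are signed exponentials
of the coordinates of a point of the curve, and the rest is determined up to one sign. -/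
lemma exists_normBranch_of_normSystem {x : Fin 4 → OnePoint ℝ} (hx : NormSystem σ ζ x) :
    ∃ η ε : ℤˣ, ∃ t ∈ Set.Ico 0 (2 * π), x = normBranch σ ζ ((η : ℤ) : ℝ) ((ε : ℤ) : ℝ) t := by
  have hk := sqrt_sq_sub_one_pos hζ
  have hk2 := sq_sqrt_sq_sub_one hζ
  have s0 := hσ 0; have s1 := hσ 1; have s2 := hσ 2; have s3 := hσ 3
  obtain ⟨e₀, e₁, e₂, e₃⟩ := hx
  have hx0 : hsin (x 0) ≠ 0 := fun h => by simp [h] at e₀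
  have hx3 : hsin (x 3) ≠ 0 := fun h => by simp [h] at e₀
  obtain ⟨h0, X, hh0, hX⟩ := exists_sign_mul_exp hx0
  obtain ⟨h, Y, hh, hY⟩ := exists_sign_mul_exp hx3
  have hcX := Real.cosh_pos X
  have hcY := Real.cosh_pos Y
  have c0 := hcos_sign_mul_exp hh0 X
  have c3 := hcos_sign_mul_exp hh Y
  have i0 := hsin_sign_mul_exp hh0 X
  have i3 := hsin_sign_mul_exp hh Y
  rw [← hX] at c0 i0
  rw [← hY] at c3 i3
  -- the first equation fixes the relative sign of `x 0` and `x 3`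
  have hs : (σ 0 * h0 * h) ^ 2 = 1 := by rw [mul_pow, mul_pow, s0, hh0, hh]; norm_num
  have hprod : ζ * (σ 0 * h0 * h) = Real.cosh X * Real.cosh Y := by
    rw [i0, i3] at e₀
    field_simp at e₀
    linear_combination e₀
  have hsgn : σ 0 * h0 * h = 1 := by
    rcases sq_eq_one_iff.mp hs with h | h
    · exact h
    · rw [h] at hprod
      have := mul_pos hcX hcY
      linarith
  rw [hsgn, mul_one] at hprod
  have hh0' : h0 = h * σ 0 := by
    linear_combination (-h0) * hh - h0 * h ^ 2 * s0 + h * σ 0 * hsgn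
  obtain ⟨t, ht, htX, htY⟩ := exists_curve_param hζ hprod.symm
  have q1 := sq_add_sq_curve hζ t
  have q2 := sq_add_sq_curve' hζ t
  rw [htX, htY] at q1 q2
  have i1 : hsin (x 1) = h * (σ 0 * σ 1) * Real.sinh X / √(ζ ^ 2 - 1) := by
    rw [c0, i0, hh0'] at e₁
    field_simp at e₁ ⊢
    linear_combination (-(σ 0 * h * σ 1)) * e₁ + hsin (x 1) * √(ζ ^ 2 - 1) *
      (-(hh) - h ^ 2 * s0 - h ^ 2 * σ 0 ^ 2 * s1)
  have i2 : hsin (x 2) = h * σ 3 * Real.sinh Y / √(ζ ^ 2 - 1) := by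
    rw [c3, i3] at e₃
    field_simp at e₃ ⊢
    linear_combination (-(h * σ 3)) * e₃ + hsin (x 2) * √(ζ ^ 2 - 1) *
      (-(hh) - h ^ 2 * s3)
  have u1 := hcos_sq_add_hsin_sq (x 1)
  have u2 := hcos_sq_add_hsin_sq (x 2)
  -- the cosines of `x 1` and `x 2` are determined up to a common sign
  obtain ⟨e, he, hp, hq⟩ := exists_common_sign
    (p := -(hcos (x 1) * √(ζ ^ 2 - 1) * (σ 0 * σ 1 * σ 2 * σ 3)))
    (q := -(hcos (x 2) * √(ζ ^ 2 - 1))) (P := Real.cosh X * Real.sinh Y)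
    (Q := Real.cosh Y * Real.sinh X) (by
      rw [i1] at u1
      field_simp at u1
      have w : (σ 0 * σ 1 * σ 2 * σ 3) ^ 2 = 1 := by simp [mul_pow, s0, s1, s2, s3]
      have w2 : h ^ 2 * σ 0 ^ 2 * σ 1 ^ 2 = 1 := by simp [s0, s1, hh]
      linear_combination hcos (x 1) ^ 2 * √(ζ ^ 2 - 1) ^ 2 * w + u1 - q1 -
        Real.sinh X ^ 2 * w2 + hk2) (by
      rw [i2] at u2
      field_simp at u2
      have w2 : h ^ 2 * σ 3 ^ 2 = 1 := by simp [s3, hh]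
      linear_combination u2 - q2 - Real.sinh Y ^ 2 * w2 + hk2) (by
      rw [i1, i2] at e₂
      field_simp at e₂
      have w : σ 2 ^ 2 * h ^ 2 * σ 0 ^ 2 * σ 1 ^ 2 * σ 3 ^ 2 = 1 := by simp [s0, s1, s2, s3, hh]
      linear_combination (σ 0 * σ 1 * σ 2 * σ 3) * e₂ + ζ * Real.sinh X * Real.sinh Y * w +
        Real.sinh X * Real.sinh Y * hprod)
  obtain ⟨η, hη⟩ := exists_units_of_sq_eq_one hh
  obtain ⟨ε, hε⟩ := exists_units_of_sq_eq_one he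
  refine ⟨η, ε, t, ht, ?_⟩
  rw [hη, hε]
  funext j
  fin_cases j
  · simp only [Fin.zero_eta]
    rw [normBranch_zero hζ, hX, htX, hh0']
  · apply ext_of_hcos_hsin <;> simp only [Fin.mk_one]
    · rw [hcos_normBranch_one hζ hσ hh he, htX, htY]
      field_simp
      have w : (σ 0 * σ 1 * σ 2 * σ 3) ^ 2 = 1 := by simp [mul_pow, s0, s1, s2, s3]
      linear_combination (-(σ 0 * σ 1 * σ 2 * σ 3)) * hp - hcos (x 1) * √(ζ ^ 2 - 1) * w
    · rw [hsin_normBranch_one hζ hσ hh he, htX, i1]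
  · apply ext_of_hcos_hsin <;> simp only [Fin.reduceFinMk]
    · rw [hcos_normBranch_two hζ hσ hh he, htX, htY]
      field_simp
      linear_combination -hq
    · rw [hsin_normBranch_two hζ hσ hh he, htY, i2]
  · simp only [Fin.reduceFinMk]
    rw [normBranch_three hζ, hY, htY]

/-- Points of the normalised branches determine both signs and the curve coordinates. The sign `e`
can be read off because `sinh X` and `sinh Y` do not vanish simultaneously. -/
lemma normBranch_inj {h' e' t t' : ℝ} (hh : h ^ 2 = 1) (he : e ^ 2 = 1) (hh' : h' ^ 2 = 1)
    (he' : e' ^ 2 = 1) (H : normBranch σ ζ h e t = normBranch σ ζ h' e' t') :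
    h = h' ∧ e = e' ∧ curveX ζ t = curveX ζ t' ∧ curveY ζ t = curveY ζ t' := by
  have hk := sqrt_sq_sub_one_pos hζ
  have H3 := congrFun H 3
  rw [normBranch_three hζ, normBranch_three hζ, OnePoint.coe_eq_coe] at H3
  obtain ⟨rfl, hY⟩ := sign_mul_exp_inj hh hh' H3
  have H0 := congrFun H 0
  rw [normBranch_zero hζ, normBranch_zero hζ, OnePoint.coe_eq_coe] at H0
  have w : (h * σ 0) ^ 2 = 1 := by rw [mul_pow, hh, hσ, one_mul]
  obtain ⟨-, hX⟩ := sign_mul_exp_inj w w H0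
  refine ⟨rfl, ?_, hX, hY⟩
  have hcX := Real.cosh_pos (curveX ζ t)
  have hcY := Real.cosh_pos (curveY ζ t)
  have H1 := congrArg hcos (congrFun H 1)
  have H2 := congrArg hcos (congrFun H 2)
  rw [hcos_normBranch_one hζ hσ hh he, hcos_normBranch_one hζ hσ hh he', ← hX, ← hY] at H1
  rw [hcos_normBranch_two hζ hσ hh he, hcos_normBranch_two hζ hσ hh he', ← hX, ← hY] at H2
  by_cases hsX : Real.sinh (curveX ζ t) = 0
  · have hsY : Real.sinh (curveY ζ t) ≠ 0 := fun h0 => by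
      have := sq_add_sq_curve hζ t
      rw [hsX, h0] at this
      nlinarith
    have hne : ∀ i, σ i ≠ 0 := fun i h0 => by simpa [h0] using hσ i
    have n0 := hne 0; have n1 := hne 1; have n2 := hne 2; have n3 := hne 3
    field_simp at H1
    linarith
  · field_simp at H2
    linarith

end

lemma auxF_periodic (ζ : ℝ) : Function.Periodic (auxF ζ) (2 * π) := fun t => by
  simp [auxF]

lemma auxG_periodic (ζ : ℝ) : Function.Periodic (auxG ζ) (2 * π) := fun t => by
  simp [auxG]

lemma auxV_periodic (ζ : ℝ) : Function.Periodic (auxV ζ) (2 * π) := fun t => by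
  simp [auxV]

lemma normBranch_periodic (σ : Fin 4 → ℝ) (ζ h e : ℝ) :
    Function.Periodic (normBranch σ ζ h e) (2 * π) := fun t => by
  have e1 : t + 2 * π + π / 2 = t + π / 2 + 2 * π := by ring
  have e2 : t + 2 * π - π / 2 = t - π / 2 + 2 * π := by ring
  simp only [normBranch, e1, e2, (auxF_periodic ζ) _, (auxG_periodic ζ) _, (auxV_periodic ζ) _]

lemma normBranch_nonconstant {σ : Fin 4 → ℝ} {ζ h e : ℝ} (hζ : 1 < ζ) (hσ : ∀ i, σ i ^ 2 = 1)
    (hh : h ^ 2 = 1) (he : e ^ 2 = 1) (j : Fin 4) :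
    ∃ t t', normBranch σ ζ h e t j ≠ normBranch σ ζ h e t' j := by
  have hk := sqrt_sq_sub_one_pos hζ
  have hk' := sqrt_sub_one_pos hζ
  have hne : ∀ i, σ i ≠ 0 := fun i h0 => by simpa [h0] using hσ i
  have n0 := hne 0; have n1 := hne 1; have n3 := hne 3
  have nh : h ≠ 0 := fun h0 => by simp [h0] at hh
  -- at `t = ± π / 2` both coordinates are `± arsinh √(ζ - 1)`
  have hX : Real.sinh (curveX ζ (π / 2)) = √(ζ - 1) := by simp [curveX, halfSum, halfDiff]
  have hY : Real.sinh (curveY ζ (π / 2)) = √(ζ - 1) := by simp [curveY, halfSum, halfDiff]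
  have hX' : Real.sinh (curveX ζ (-(π / 2))) = -√(ζ - 1) := by
    simp [curveX, halfSum, halfDiff]
  have hY' : Real.sinh (curveY ζ (-(π / 2))) = -√(ζ - 1) := by
    simp [curveY, halfSum, halfDiff]
  refine ⟨π / 2, -(π / 2), fun H => ?_⟩
  have Hc := congrArg hcos H
  have Hs := congrArg hsin H
  have p1 := Real.cosh_pos (curveX ζ (π / 2))
  have p2 := Real.cosh_pos (curveY ζ (π / 2))
  have p3 := Real.cosh_pos (curveX ζ (-(π / 2)))
  have p4 := Real.cosh_pos (curveY ζ (-(π / 2)))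
  have pos : ∀ {x y : ℝ}, 0 < x → 0 < y → -(√(ζ - 1) / x) ≠ -(-√(ζ - 1) / y) := fun hx hy h0 => by
    have h1 := div_pos hk' hx
    have h2 := div_pos hk' hy
    rw [neg_div, neg_neg] at h0
    linarith
  fin_cases j
  · simp only [Fin.zero_eta, hcos_normBranch_zero hζ hσ hh, hX, hX'] at Hc
    exact pos p1 p3 Hc
  · simp only [Fin.mk_one, hsin_normBranch_one hζ hσ hh he, hX, hX'] at Hs
    field_simp at Hs
    linarith
  · simp only [Fin.reduceFinMk, hsin_normBranch_two hζ hσ hh he, hY, hY'] at Hs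
    field_simp at Hs
    linarith
  · simp only [Fin.reduceFinMk, hcos_normBranch_three hζ hh, hY, hY'] at Hc
    exact pos p2 p4 Hc

/-! ### The coupled equations and their branches -/

/-- The relation `(z + a / z) (w + b / w) = ν` between two half-tangents `z` and `w`, written in
terms of the angles so that it makes sense for `0` and `∞`. -/
def Coupled (a b ν : ℝ) (x y : OnePoint ℝ) : Prop :=
  (a + 1 + (a - 1) * hcos x) * (b + 1 + (b - 1) * hcos y) = ν * (hsin x * hsin y)

lemma scaleDen_mul_of_pos {r : ℝ} (hr : r ≠ 0) (x : OnePoint ℝ) :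
    scaleDen r x * (r ^ 2 + 1 + (r ^ 2 - 1) * hcos (scale r x)) = 4 * r ^ 2 := by
  have h := hcos_scale hr x
  have h2 : scaleDen r x = (1 + hcos x) + r ^ 2 * (1 - hcos x) := rfl
  linear_combination (r ^ 2 - 1) * h + (r ^ 2 + 1) * h2

lemma scaleDen_mul_of_neg {r : ℝ} (hr : r ≠ 0) (x : OnePoint ℝ) :
    scaleDen r x * (-r ^ 2 + 1 + (-r ^ 2 - 1) * hcos (scale r x)) = -(4 * r ^ 2 * hcos x) := by
  have h := hcos_scale hr x
  have h2 : scaleDen r x = (1 + hcos x) + r ^ 2 * (1 - hcos x) := rfl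
  linear_combination (-r ^ 2 - 1) * h + (-r ^ 2 + 1) * h2

/-- Removing the factors `r`, `s` from the half-tangents turns a coupled equation into an
equation between cosines and sines: here `A` and `B` are the two factors on its left-hand
side, in normalised form. -/
lemma coupled_scale_iff {a b ν r s A B : ℝ} {x y : OnePoint ℝ} (hr : r ≠ 0) (hs : s ≠ 0)
    (hA : scaleDen r x * (a + 1 + (a - 1) * hcos (scale r x)) = 4 * r ^ 2 * A)
    (hB : scaleDen s y * (b + 1 + (b - 1) * hcos (scale s y)) = 4 * s ^ 2 * B) :
    Coupled a b ν (scale r x) (scale s y) ↔ 4 * r * s * (A * B) = ν * (hsin x * hsin y) := by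
  have h1 := scaleDen_pos hr x
  have h2 := scaleDen_pos hs y
  have h3 := hsin_scale hr x
  have h4 := hsin_scale hs y
  unfold Coupled
  rw [← mul_right_inj' (mul_pos h1 h2).ne']
  have e1 : scaleDen r x * scaleDen s y * ((a + 1 + (a - 1) * hcos (scale r x)) *
      (b + 1 + (b - 1) * hcos (scale s y))) = 4 * r * s * (4 * r * s * (A * B)) := by
    calc _ = (scaleDen r x * (a + 1 + (a - 1) * hcos (scale r x))) *
        (scaleDen s y * (b + 1 + (b - 1) * hcos (scale s y))) := by ring
      _ = _ := by rw [hA, hB]; ring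
  have e2 : scaleDen r x * scaleDen s y * (ν * (hsin (scale r x) * hsin (scale s y))) =
      4 * r * s * (ν * (hsin x * hsin y)) := by
    calc _ = ν * ((hsin (scale r x) * scaleDen r x) * (hsin (scale s y) * scaleDen s y)) := by ring
      _ = _ := by rw [h3, h4]; ring
  rw [e1, e2, mul_right_inj']
  simp [hr, hs]

/-- The sign conditions and the normal forms of the coefficients `ν i` that the geometric
assumptions imply, in a suitable enumeration of the vertices. -/
structure NormalForm (lam mu nu : Fin 4 → ℝ) : Prop where
  lam_zero : 0 < lam 0
  mu_zero : 0 < mu 0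
  lam_two : lam 2 < 0
  mu_two : mu 2 < 0
  one_lt_zeta : 1 < zetaOne lam mu nu
  abs_nu_one : |nu 1| = 4 * (√(-mu 2) * √(lam 0)) * √(zetaOne lam mu nu ^ 2 - 1)
  abs_nu_two : |nu 2| = 4 * (√(-lam 2) * √(-mu 2)) * zetaOne lam mu nu
  abs_nu_three : |nu 3| = 4 * (√(mu 0) * √(-lam 2)) * √(zetaOne lam mu nu ^ 2 - 1)

/-- The factors removed from the four variables in `normBranch`. -/
def branchScale (lam mu : Fin 4 → ℝ) : Fin 4 → ℝ := ![√(lam 0), √(-mu 2), √(-lam 2), √(mu 0)]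

namespace NormalForm

variable {lam mu nu : Fin 4 → ℝ} (H : NormalForm lam mu nu)

include H

lemma branchScale_pos (j : Fin 4) : 0 < branchScale lam mu j := by
  have h0 := H.lam_zero
  have h1 := H.mu_zero
  have h2 := H.lam_two
  have h3 := H.mu_two
  fin_cases j <;> simp [branchScale, *]

lemma abs_nu_zero : |nu 0| = 4 * (√(lam 0) * √(mu 0)) * zetaOne lam mu nu := by
  have h0 := Real.sqrt_pos.mpr H.lam_zero
  have h1 := Real.sqrt_pos.mpr H.mu_zero
  rw [zetaOne, Real.sqrt_mul H.lam_zero.le]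
  field_simp

lemma nu_ne_zero (i : Fin 4) : nu i ≠ 0 := by
  have h0 := Real.sqrt_pos.mpr H.lam_zero
  have h1 := Real.sqrt_pos.mpr H.mu_zero
  have h2 : 0 < √(-lam 2) := Real.sqrt_pos.mpr (by linarith [H.lam_two])
  have h3 : 0 < √(-mu 2) := Real.sqrt_pos.mpr (by linarith [H.mu_two])
  have hζ : 0 < zetaOne lam mu nu := by linarith [H.one_lt_zeta]
  have hk := sqrt_sq_sub_one_pos H.one_lt_zeta
  rw [← abs_pos]
  fin_cases i <;> simp only [Fin.zero_eta, Fin.mk_one, Fin.reduceFinMk]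
  · rw [H.abs_nu_zero]; positivity
  · rw [H.abs_nu_one]; positivity
  · rw [H.abs_nu_two]; positivity
  · rw [H.abs_nu_three]; positivity

lemma sign_nu_sq (i : Fin 4) : Real.sign (nu i) ^ 2 = 1 := by
  rcases Real.sign_apply_eq_of_ne_zero _ (H.nu_ne_zero i) with h | h <;> rw [h] <;> norm_num

lemma branch_eq (η ε : ℤˣ) (t : ℝ) (j : Fin 4) : branch lam mu nu η ε t j =
    scale (branchScale lam mu j) (normBranch (fun i => Real.sign (nu i)) (zetaOne lam mu nu)
      ((η : ℤ) : ℝ) ((ε : ℤ) : ℝ) t j) := by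
  have p := fun j => (H.branchScale_pos j).ne'
  have hs : ∀ x y : ℝ, Real.sign (x * y) = Real.sign x * Real.sign y := fun x y => by
    rcases lt_trichotomy x 0 with hx | rfl | hx <;> rcases lt_trichotomy y 0 with hy | rfl | hy <;>
      simp [Real.sign_of_neg, Real.sign_of_pos, mul_pos_of_neg_of_neg, mul_neg_of_neg_of_pos,
        mul_neg_of_pos_of_neg, *]
  fin_cases j
  · simp only [Fin.zero_eta, branch, normBranch, branchScale, Matrix.cons_val_zero, scale_coe]
    congr 1
    ring
  · have p1 := p 1
    simp only [Fin.mk_one, branch, normBranch, branchScale, Matrix.cons_val] at p1 ⊢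
    rw [← projQuot_mul_left p1, hs, hs]
    congr 1
    ring
  · have p2 := p 2
    simp only [Fin.reduceFinMk, branch, normBranch, branchScale, Matrix.cons_val] at p2 ⊢
    rw [← projQuot_mul_left p2]
    congr 1
    ring
  · simp only [Fin.reduceFinMk, branch, normBranch, branchScale, Matrix.cons_val, scale_coe]
    congr 1
    ring

/-- After scaling, the four coupled equations become the normalised system. -/
lemma coupled_iff (x : Fin 4 → OnePoint ℝ) :
    (Coupled (lam 0) (mu 0) (nu 0) (scale (branchScale lam mu 0) (x 0))
        (scale (branchScale lam mu 3) (x 3)) ∧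
      Coupled (-mu 2) (-lam 0) (nu 1) (scale (branchScale lam mu 1) (x 1))
        (scale (branchScale lam mu 0) (x 0)) ∧
      Coupled (lam 2) (mu 2) (nu 2) (scale (branchScale lam mu 2) (x 2))
        (scale (branchScale lam mu 1) (x 1)) ∧
      Coupled (-mu 0) (-lam 2) (nu 3) (scale (branchScale lam mu 3) (x 3))
        (scale (branchScale lam mu 2) (x 2))) ↔
      NormSystem (fun i => Real.sign (nu i)) (zetaOne lam mu nu) x := by
  have p := H.branchScale_pos
  have p0 := p 0; have p1 := p 1; have p2 := p 2; have p3 := p 3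
  have e0 : lam 0 = branchScale lam mu 0 ^ 2 := (Real.sq_sqrt H.lam_zero.le).symm
  have e3 : mu 0 = branchScale lam mu 3 ^ 2 := (Real.sq_sqrt H.mu_zero.le).symm
  have e1 : -mu 2 = branchScale lam mu 1 ^ 2 := (Real.sq_sqrt (by linarith [H.mu_two])).symm
  have e2 : -lam 2 = branchScale lam mu 2 ^ 2 := (Real.sq_sqrt (by linarith [H.lam_two])).symm
  have n : ∀ i, nu i = Real.sign (nu i) * |nu i| := fun i => by
    rcases lt_trichotomy (nu i) 0 with h | h | h
    · rw [Real.sign_of_neg h, abs_of_neg h]; ring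
    · exact absurd h (H.nu_ne_zero i)
    · rw [Real.sign_of_pos h, abs_of_pos h]; ring
  have s := H.sign_nu_sq
  have n0 : nu 0 = Real.sign (nu 0) * (4 * (branchScale lam mu 0 * branchScale lam mu 3) *
    zetaOne lam mu nu) := (n 0).trans (congrArg _ H.abs_nu_zero)
  have n1 : nu 1 = Real.sign (nu 1) * (4 * (branchScale lam mu 1 * branchScale lam mu 0) *
    √(zetaOne lam mu nu ^ 2 - 1)) := (n 1).trans (congrArg _ H.abs_nu_one)
  have n2 : nu 2 = Real.sign (nu 2) * (4 * (branchScale lam mu 2 * branchScale lam mu 1) *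
    zetaOne lam mu nu) := (n 2).trans (congrArg _ H.abs_nu_two)
  have n3 : nu 3 = Real.sign (nu 3) * (4 * (branchScale lam mu 3 * branchScale lam mu 2) *
    √(zetaOne lam mu nu ^ 2 - 1)) := (n 3).trans (congrArg _ H.abs_nu_three)
  have pos : ∀ (j : Fin 4) (a : ℝ), a = branchScale lam mu j ^ 2 →
      scaleDen (branchScale lam mu j) (x j) *
        (a + 1 + (a - 1) * hcos (scale (branchScale lam mu j) (x j))) =
        4 * branchScale lam mu j ^ 2 * 1 := fun j a ha => by
    rw [ha, scaleDen_mul_of_pos (p j).ne', mul_one]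
  have neg : ∀ (j : Fin 4) (a : ℝ), a = -branchScale lam mu j ^ 2 →
      scaleDen (branchScale lam mu j) (x j) *
        (a + 1 + (a - 1) * hcos (scale (branchScale lam mu j) (x j))) =
        4 * branchScale lam mu j ^ 2 * (-hcos (x j)) := fun j a ha => by
    rw [ha, scaleDen_mul_of_neg (p j).ne', mul_neg]
  rw [coupled_scale_iff p0.ne' p3.ne' (pos 0 _ e0) (pos 3 _ e3),
    coupled_scale_iff p1.ne' p0.ne' (pos 1 _ e1) (neg 0 _ (by rw [e0])),
    coupled_scale_iff p2.ne' p1.ne' (neg 2 _ (by linarith)) (neg 1 _ (by linarith)),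
    coupled_scale_iff p3.ne' p2.ne' (neg 3 _ (by linarith)) (pos 2 _ e2)]
  have key : ∀ {r s z A B ν σ : ℝ}, 0 < r → 0 < s → ν = σ * (4 * (r * s) * z) →
      (4 * r * s * A = ν * B ↔ A = σ * z * B) := fun {r s z A B ν σ} hr hs hν => by
    have h4 : 4 * r * s ≠ 0 := by positivity
    rw [hν, ← mul_right_inj' h4 (b := A)]
    constructor <;> intro h <;> linear_combination h
  rw [key p0 p3 n0, key p1 p0 n1, key p2 p1 n2, key p3 p2 n3]
  constructor
  · rintro ⟨h0, h1, h2, h3⟩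
    exact ⟨by linear_combination -h0, by linear_combination h1, by linear_combination h2,
      by linear_combination h3⟩
  · rintro ⟨h0, h1, h2, h3⟩
    exact ⟨by linear_combination -h0, by linear_combination h1, by linear_combination h2,
      by linear_combination h3⟩

/-- The solutions of the four coupled equations are exactly the points of the branches. -/
lemma coupled_iff_exists_branch (x : Fin 4 → OnePoint ℝ) :
    (Coupled (lam 0) (mu 0) (nu 0) (x 0) (x 3) ∧ Coupled (-mu 2) (-lam 0) (nu 1) (x 1) (x 0) ∧
      Coupled (lam 2) (mu 2) (nu 2) (x 2) (x 1) ∧ Coupled (-mu 0) (-lam 2) (nu 3) (x 3) (x 2)) ↔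
    ∃ η ε : ℤˣ, ∃ t ∈ Set.Ico 0 (2 * π), ∀ j, x j = branch lam mu nu η ε t j := by
  have hx : ∀ j, scale (branchScale lam mu j) (scale (branchScale lam mu j)⁻¹ (x j)) = x j :=
    fun j => scale_inv_scale (H.branchScale_pos j).ne' _
  have h := H.coupled_iff fun j => scale (branchScale lam mu j)⁻¹ (x j)
  simp only [hx] at h
  rw [h]
  constructor
  · intro hs
    obtain ⟨η, ε, t, ht, he⟩ := exists_normBranch_of_normSystem H.one_lt_zeta H.sign_nu_sq hs
    refine ⟨η, ε, t, ht, fun j => ?_⟩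
    rw [H.branch_eq, ← congrFun he j, hx]
  · rintro ⟨η, ε, t, -, he⟩
    have : (fun j => scale (branchScale lam mu j)⁻¹ (x j)) =
        normBranch (fun i => Real.sign (nu i)) (zetaOne lam mu nu)
          ((η : ℤ) : ℝ) ((ε : ℤ) : ℝ) t := by
      funext j
      apply scale_injective (H.branchScale_pos j).ne'
      rw [hx, he, H.branch_eq]
    rw [this]
    exact normSystem_normBranch H.one_lt_zeta H.sign_nu_sq (sq_intCast_units η)
      (sq_intCast_units ε) t

lemma continuous_branch (η ε : ℤˣ) : Continuous (branch lam mu nu η ε) := by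
  refine continuous_pi fun j => ?_
  simp only [H.branch_eq]
  exact (continuous_scale (H.branchScale_pos j).ne').comp ((continuous_apply j).comp
    (continuous_normBranch H.one_lt_zeta H.sign_nu_sq (sq_intCast_units η) (sq_intCast_units ε)))

lemma periodic_branch (η ε : ℤˣ) : Function.Periodic (branch lam mu nu η ε) (2 * π) := fun t => by
  funext j
  rw [H.branch_eq, H.branch_eq, normBranch_periodic]

lemma branch_nonconstant (η ε : ℤˣ) (j : Fin 4) :
    ∃ t t', branch lam mu nu η ε t j ≠ branch lam mu nu η ε t' j := by
  obtain ⟨t, t', h⟩ := normBranch_nonconstant H.one_lt_zeta H.sign_nu_sq (sq_intCast_units η)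
    (sq_intCast_units ε) j
  refine ⟨t, t', fun h' => h ?_⟩
  rw [H.branch_eq, H.branch_eq] at h'
  exact scale_injective (H.branchScale_pos j).ne' h'

lemma branch_inj {η ε η' ε' : ℤˣ} {t t' : ℝ}
    (h : branch lam mu nu η ε t = branch lam mu nu η' ε' t') :
    η = η' ∧ ε = ε' ∧ curveX (zetaOne lam mu nu) t = curveX (zetaOne lam mu nu) t' ∧
      curveY (zetaOne lam mu nu) t = curveY (zetaOne lam mu nu) t' := by
  have h' : normBranch (fun i => Real.sign (nu i)) (zetaOne lam mu nu) ((η : ℤ) : ℝ)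
      ((ε : ℤ) : ℝ) t = normBranch (fun i => Real.sign (nu i)) (zetaOne lam mu nu)
      ((η' : ℤ) : ℝ) ((ε' : ℤ) : ℝ) t' := by
    funext j
    apply scale_injective (H.branchScale_pos j).ne'
    rw [← H.branch_eq, ← H.branch_eq, h]
  obtain ⟨h1, h2, h3⟩ := normBranch_inj H.one_lt_zeta H.sign_nu_sq (sq_intCast_units η)
    (sq_intCast_units ε) (sq_intCast_units η') (sq_intCast_units ε') h'
  exact ⟨Units.ext (by exact_mod_cast h1), Units.ext (by exact_mod_cast h2), h3⟩

lemma injOn_branch (η ε : ℤˣ) : Set.InjOn (branch lam mu nu η ε) (Set.Ico 0 (2 * π)) :=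
  fun _ ht _ ht' h => by
    obtain ⟨-, -, h3, h4⟩ := H.branch_inj h
    obtain ⟨hc, hs⟩ := cos_sin_eq_of_curve_eq H.one_lt_zeta h3 h4
    exact eq_of_cos_eq_of_sin_eq ht ht' hc hs

lemma disjoint_range_branch {η ε η' ε' : ℤˣ} (hne : (η, ε) ≠ (η', ε')) :
    Disjoint (Set.range (branch lam mu nu η ε)) (Set.range (branch lam mu nu η' ε')) := by
  rw [Set.disjoint_left]
  rintro _ ⟨t, rfl⟩ ⟨t', h⟩
  obtain ⟨h1, h2, -⟩ := H.branch_inj h.symm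
  exact hne (by rw [h1, h2])

/-- Along a branch, the cosines of the dihedral angles at the edges `0` and `3` determine the
curve coordinates: the corresponding half-tangents are exponentials with constant sign. -/
lemma curve_eq_of_hcos_branch_eq {η ε : ℤˣ} {t t' : ℝ}
    (h0 : hcos (branch lam mu nu η ε t 0) = hcos (branch lam mu nu η ε t' 0))
    (h3 : hcos (branch lam mu nu η ε t 3) = hcos (branch lam mu nu η ε t' 3)) :
    curveX (zetaOne lam mu nu) t = curveX (zetaOne lam mu nu) t' ∧
      curveY (zetaOne lam mu nu) t = curveY (zetaOne lam mu nu) t' := by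
  have key : ∀ {r h x x' : ℝ}, 0 < r → h ^ 2 = 1 →
      hcos ((r * (h * Real.exp x) : ℝ) : OnePoint ℝ) =
        hcos ((r * (h * Real.exp x') : ℝ) : OnePoint ℝ) → x = x' :=
    fun {r h x x'} hr hh e => by
      have e1 := one_add_hcos_coe (r * (h * Real.exp x))
      have e2 := one_add_hcos_coe (r * (h * Real.exp x'))
      rw [e, e2] at e1
      have p1 : 0 < 1 + (r * (h * Real.exp x)) ^ 2 := by positivity
      have p2 : 0 < 1 + (r * (h * Real.exp x')) ^ 2 := by positivity
      field_simp at e1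
      have e3 : r ^ 2 * Real.exp x ^ 2 = r ^ 2 * Real.exp x' ^ 2 := by
        linear_combination e1 + r ^ 2 * (Real.exp x' ^ 2 - Real.exp x ^ 2) * hh
      have e4 := mul_left_cancel₀ (by positivity) e3
      exact Real.exp_injective
        ((pow_left_inj₀ (Real.exp_pos x).le (Real.exp_pos x').le two_ne_zero).mp e4)
  have w : (((η : ℤ) : ℝ) * Real.sign (nu 0)) ^ 2 = 1 := by
    rw [mul_pow, sq_intCast_units, H.sign_nu_sq, one_mul]
  rw [H.branch_eq, H.branch_eq, normBranch_zero H.one_lt_zeta, normBranch_zero H.one_lt_zeta,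
    scale_coe, scale_coe] at h0
  rw [H.branch_eq, H.branch_eq, normBranch_three H.one_lt_zeta, normBranch_three H.one_lt_zeta,
    scale_coe, scale_coe] at h3
  exact ⟨key (H.branchScale_pos 0) w h0, key (H.branchScale_pos 3) (sq_intCast_units η) h3⟩

end NormalForm

/-! ### The cross product -/

lemma inner_eq_sum (u v : E3) : inner ℝ u v = u 0 * v 0 + u 1 * v 1 + u 2 * v 2 := by
  simp only [PiLp.inner_apply, Fin.sum_univ_three, RCLike.inner_apply, conj_trivial]
  ring

lemma cross_zero_apply (u v : E3) : cross u v 0 = u 1 * v 2 - u 2 * v 1 := by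
  simp [cross, crossProduct]

lemma cross_one_apply (u v : E3) : cross u v 1 = u 2 * v 0 - u 0 * v 2 := by
  simp [cross, crossProduct]

lemma cross_two_apply (u v : E3) : cross u v 2 = u 0 * v 1 - u 1 * v 0 := by
  simp [cross, crossProduct]

lemma E3_ext {u v : E3} (h0 : u 0 = v 0) (h1 : u 1 = v 1) (h2 : u 2 = v 2) : u = v := by
  ext i
  fin_cases i <;> assumption

lemma cross_add_left (u v w : E3) : cross (u + v) w = cross u w + cross v w := by
  apply E3_ext <;> simp only [cross_zero_apply, cross_one_apply, cross_two_apply,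
    PiLp.add_apply] <;> ring

lemma cross_smul_left (r : ℝ) (u v : E3) : cross (r • u) v = r • cross u v := by
  apply E3_ext <;> simp only [cross_zero_apply, cross_one_apply, cross_two_apply,
    PiLp.smul_apply, smul_eq_mul] <;> ring

lemma cross_anticomm' (u v : E3) : cross u v = -cross v u := by
  apply E3_ext <;> simp only [cross_zero_apply, cross_one_apply, cross_two_apply,
    PiLp.neg_apply] <;> ring

lemma cross_add_right (u v w : E3) : cross u (v + w) = cross u v + cross u w := by
  apply E3_ext <;> simp only [cross_zero_apply, cross_one_apply, cross_two_apply,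
    PiLp.add_apply] <;> ring

lemma cross_smul_right (r : ℝ) (u v : E3) : cross u (r • v) = r • cross u v := by
  apply E3_ext <;> simp only [cross_zero_apply, cross_one_apply, cross_two_apply,
    PiLp.smul_apply, smul_eq_mul] <;> ring

@[simp] lemma cross_self' (u : E3) : cross u u = 0 := by
  apply E3_ext <;> simp only [cross_zero_apply, cross_one_apply, cross_two_apply,
    PiLp.zero_apply] <;> ring

lemma cross_neg_right (u v : E3) : cross u (-v) = -cross u v := by
  rw [← neg_one_smul ℝ v, cross_smul_right, neg_one_smul]

@[simp] lemma inner_self_cross (u v : E3) : inner ℝ u (cross u v) = 0 := by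
  simp only [inner_eq_sum, cross_zero_apply, cross_one_apply, cross_two_apply]
  ring

@[simp] lemma inner_self_cross_right (u v : E3) : inner ℝ v (cross u v) = 0 := by
  simp only [inner_eq_sum, cross_zero_apply, cross_one_apply, cross_two_apply]
  ring

lemma inner_cross_rotate (u v w : E3) : inner ℝ u (cross v w) = inner ℝ v (cross w u) := by
  simp only [inner_eq_sum, cross_zero_apply, cross_one_apply, cross_two_apply]
  ring

lemma inner_cross_cross (a b c d : E3) : inner ℝ (cross a b) (cross c d) =
    inner ℝ a c * inner ℝ b d - inner ℝ a d * inner ℝ b c := by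
  simp only [inner_eq_sum, cross_zero_apply, cross_one_apply, cross_two_apply]
  ring

lemma cross_cross_eq (a b c : E3) :
    cross a (cross b c) = (inner ℝ a c : ℝ) • b - (inner ℝ a b : ℝ) • c := by
  apply E3_ext <;> simp only [inner_eq_sum, cross_zero_apply, cross_one_apply, cross_two_apply,
    PiLp.sub_apply, PiLp.smul_apply, smul_eq_mul] <;> ring

/-- The square of a triple product is a Gram determinant. -/
lemma inner_cross_sq (x n u : E3) : (inner ℝ x (cross n u) : ℝ) ^ 2 =
    inner ℝ x x * (inner ℝ n n * inner ℝ u u - inner ℝ n u ^ 2) -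
      inner ℝ x n * (inner ℝ x n * inner ℝ u u - inner ℝ n u * inner ℝ x u) +
      inner ℝ x u * (inner ℝ x n * inner ℝ n u - inner ℝ n n * inner ℝ x u) := by
  simp only [inner_eq_sum, cross_zero_apply, cross_one_apply, cross_two_apply]
  ring

/-- An ordered pair of orthogonal unit vectors `u`, `n`; it is completed to a right-handed frame by
`cross n u`. -/
structure IsFrame (u n : E3) : Prop where
  inner_u : (inner ℝ u u : ℝ) = 1
  inner_n : (inner ℝ n n : ℝ) = 1
  inner_un : (inner ℝ u n : ℝ) = 0

namespace IsFrame

variable {u n : E3} (H : IsFrame u n)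

include H

lemma inner_nu : (inner ℝ n u : ℝ) = 0 := by rw [real_inner_comm]; exact H.inner_un

lemma inner_m : (inner ℝ (cross n u) (cross n u) : ℝ) = 1 := by
  rw [inner_cross_cross, H.inner_n, H.inner_u, H.inner_nu, H.inner_un]
  norm_num

lemma cross_n_m : cross n (cross n u) = -u := by
  rw [cross_cross_eq, H.inner_nu, H.inner_n]
  simp

lemma cross_u_m : cross u (cross n u) = n := by
  rw [cross_cross_eq, H.inner_u, H.inner_un]
  simp

lemma cross_m_u : cross (cross n u) u = -n := by
  rw [cross_anticomm', H.cross_u_m]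

/-- Every vector is the sum of its components along the frame. -/
lemma decomp (x : E3) : x = (inner ℝ x u : ℝ) • u + (inner ℝ x (cross n u) : ℝ) • cross n u +
    (inner ℝ x n : ℝ) • n := by
  set y := x - ((inner ℝ x u : ℝ) • u + (inner ℝ x (cross n u) : ℝ) • cross n u +
    (inner ℝ x n : ℝ) • n) with hy
  have hu := H.inner_u
  have hn := H.inner_n
  have hun := H.inner_un
  have hnu := H.inner_nu
  have hm := H.inner_m
  have mu : (inner ℝ (cross n u) u : ℝ) = 0 := by rw [real_inner_comm]; simp
  have mn : (inner ℝ (cross n u) n : ℝ) = 0 := by rw [real_inner_comm]; simp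
  have y1 : (inner ℝ y u : ℝ) = 0 := by
    rw [hy]
    simp only [inner_sub_left, inner_add_left, real_inner_smul_left, hu, hnu, mu]
    ring
  have y2 : (inner ℝ y n : ℝ) = 0 := by
    rw [hy]
    simp only [inner_sub_left, inner_add_left, real_inner_smul_left, hn, hun, mn]
    ring
  have y3 : (inner ℝ y (cross n u) : ℝ) = 0 := by
    rw [hy]
    simp only [inner_sub_left, inner_add_left, real_inner_smul_left, hm, inner_self_cross,
      inner_self_cross_right]
    ring
  have h := inner_cross_sq y n u
  rw [y1, y2, y3, hn, hu, hnu] at h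
  have h0 : (inner ℝ y y : ℝ) = 0 := by linarith
  exact sub_eq_zero.mp (inner_self_eq_zero.mp h0)

lemma eq_of_inner_n_eq_zero {v : E3} {c s : ℝ} (hv : (inner ℝ v n : ℝ) = 0)
    (hc : (inner ℝ u v : ℝ) = c) (hs : (inner ℝ n (cross u v) : ℝ) = s) :
    v = c • u + s • cross n u := by
  conv_lhs => rw [H.decomp v]
  rw [hv, zero_smul, add_zero, real_inner_comm u v, hc, inner_cross_rotate v n u, hs]

end IsFrame

/-! ### Unit vectors and planar quadrilaterals -/

/-- The unit vector in the direction of `v` (zero if `v = 0`). -/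
def unit (v : E3) : E3 := ‖v‖⁻¹ • v

lemma norm_smul_unit (v : E3) : ‖v‖ • unit v = v := by
  by_cases h : v = 0
  · simp [h, unit]
  · rw [unit, smul_smul, mul_inv_cancel₀ (norm_ne_zero_iff.mpr h), one_smul]

lemma inner_unit_self {v : E3} (h : v ≠ 0) : (inner ℝ (unit v) (unit v) : ℝ) = 1 := by
  have := norm_ne_zero_iff.mpr h
  rw [unit, real_inner_smul_left, real_inner_smul_right, real_inner_self_eq_norm_sq]
  field_simp

lemma unit_neg (v : E3) : unit (-v) = -unit v := by simp [unit]

lemma inner_norm_mul_unit (u v : E3) :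
    (inner ℝ u v : ℝ) = ‖u‖ * ‖v‖ * inner ℝ (unit u) (unit v) := by
  conv_lhs => rw [← norm_smul_unit u, ← norm_smul_unit v]
  rw [real_inner_smul_left, real_inner_smul_right, mul_assoc]

lemma unit_smul_of_pos {r : ℝ} (hr : 0 < r) (v : E3) : unit (r • v) = unit v := by
  rw [unit, unit, norm_smul, Real.norm_of_nonneg hr.le, smul_smul]
  congr 1
  field_simp

lemma unit_of_inner_self {v : E3} (h : (inner ℝ v v : ℝ) = 1) : unit v = v := by
  rw [real_inner_self_eq_norm_sq] at h
  have : ‖v‖ = 1 := by nlinarith [norm_nonneg v]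
  simp [unit, this]

lemma inner_cross_eq_zero_of_finrank_le {S : Submodule ℝ E3} (hS : Module.finrank ℝ S ≤ 2)
    {a b c : E3} (ha : a ∈ S) (hb : b ∈ S) (hc : c ∈ S) : (inner ℝ a (cross b c) : ℝ) = 0 := by
  have hdep : ¬ LinearIndependent ℝ ![(⟨a, ha⟩ : S), ⟨b, hb⟩, ⟨c, hc⟩] := fun h => by
    have := h.fintype_card_le_finrank
    simp at this
    omega
  rw [Fintype.not_linearIndependent_iff] at hdep
  obtain ⟨g, hg, i, hi⟩ := hdep
  have hg' : g 0 • a + g 1 • b + g 2 • c = 0 := by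
    have := congrArg Subtype.val hg
    simpa [Fin.sum_univ_three] using this
  have key : ∀ x : E3, g 0 * inner ℝ a x + g 1 * inner ℝ b x + g 2 * inner ℝ c x = 0 := fun x => by
    have := congrArg (fun y => (inner ℝ y x : ℝ)) hg'
    simpa [inner_add_left, real_inner_smul_left] using this
  fin_cases i
  · have := key (cross b c)
    simp only [inner_self_cross, inner_self_cross_right, mul_zero, add_zero] at this
    exact (mul_eq_zero.mp this).resolve_left hi
  · have := key (cross c a)
    rw [inner_cross_rotate]
    simp only [inner_self_cross, inner_self_cross_right, mul_zero, add_zero, zero_add] at this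
    exact (mul_eq_zero.mp this).resolve_left hi
  · have := key (cross a b)
    rw [← inner_cross_rotate]
    simp only [inner_self_cross, inner_self_cross_right, mul_zero, zero_add] at this
    exact (mul_eq_zero.mp this).resolve_left hi

/-- If `x` and `y` are parallel, i.e. `cross x y = 0`, and `x ≠ 0`, then `y` is a multiple
of `x`. -/
lemma exists_smul_of_cross_eq_zero {x y : E3} (hx : x ≠ 0) (h : cross x y = 0) :
    ∃ r : ℝ, y = r • x := by
  have h1 := cross_cross_eq x x y
  rw [h] at h1
  have h0 : cross x 0 = 0 := by simpa using cross_smul_right 0 x 0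
  rw [h0, eq_comm, sub_eq_zero] at h1
  have hxx : (inner ℝ x x : ℝ) ≠ 0 := inner_self_ne_zero.mpr hx
  refine ⟨inner ℝ x y / inner ℝ x x, ?_⟩
  rw [div_eq_inv_mul, mul_smul, h1, smul_smul, inv_mul_cancel₀ hxx, one_smul]

namespace IsPlanarQuad

variable {q : Fin 4 → E3} (H : IsPlanarQuad q)

include H

lemma ne (i : Fin 4) : q (i + 1) ≠ q i := fun h => H.corner i (by
  rw [h, Set.insert_eq_of_mem (by simp)]
  exact collinear_pair ℝ _ _)

lemma ne_sub_one (i : Fin 4) : q (i - 1) ≠ q i := fun h => by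
  have := H.ne (i - 1)
  rw [sub_add_cancel] at this
  exact this h.symm

lemma ne_two (i : Fin 4) : q (i + 2) ≠ q i := fun h => H.corner i (by
  rw [h, Set.insert_eq_of_mem (by simp), Set.pair_comm]
  exact collinear_pair ℝ _ _)

lemma inner_areaNormal_sub (i j : Fin 4) : (inner ℝ (areaNormal q) (q i - q j) : ℝ) = 0 := by
  have hS := coplanar_iff_finrank_le_two.mp H.coplanar
  have hm : ∀ i j, q i - q j ∈ vectorSpan ℝ (Set.range q) := fun i j =>
    vsub_mem_vectorSpan ℝ (Set.mem_range_self i) (Set.mem_range_self j)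
  rw [real_inner_comm]
  exact inner_cross_eq_zero_of_finrank_le hS (hm i j) (hm 2 0) (hm 3 1)

/-- The vector area vanishes only if the diagonals are parallel; but then two opposite sides are
themselves the diagonals of a trapezoid, and cross. -/
lemma areaNormal_ne_zero : areaNormal q ≠ 0 := fun h => by
  have h20 : q 2 - q 0 ≠ 0 := sub_ne_zero.mpr (H.ne_two 0)
  obtain ⟨c, hc⟩ := exists_smul_of_cross_eq_zero h20 h
  have h31 : q 3 - q 1 ≠ 0 := sub_ne_zero.mpr (H.ne_two 1)
  have e2 : q 2 = q 0 + (q 2 - q 0) := by abel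
  have e3 : q 3 = q 1 + c • (q 2 - q 0) := by rw [← hc]; abel
  rcases lt_trichotomy c 0 with hneg | rfl | hpos
  · have hc0 : (1 : ℝ) - c ≠ 0 := by linarith
    have m1 : (-c / (1 - c)) • q 0 + (1 / (1 - c)) • q 1 ∈ segment ℝ (q 0) (q 1) :=
      ⟨_, _, div_nonneg (by linarith) (by linarith), div_nonneg (by linarith) (by linarith),
        by field_simp; ring, rfl⟩
    refine Set.disjoint_left.mp H.simple₁ m1
      ⟨-c / (1 - c), 1 / (1 - c), div_nonneg (by linarith) (by linarith),
        div_nonneg (by linarith) (by linarith), by field_simp; ring, ?_⟩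
    rw [e3]
    nth_rw 1 [e2]
    match_scalars <;> field_simp
    all_goals ring
  · rw [zero_smul] at hc
    exact h31 hc
  · have hc0 : (1 : ℝ) + c ≠ 0 := by linarith
    have m1 : (1 / (1 + c)) • q 1 + (c / (1 + c)) • q 2 ∈ segment ℝ (q 1) (q 2) :=
      ⟨_, _, by positivity, by positivity, by field_simp, rfl⟩
    refine Set.disjoint_left.mp H.simple₂ m1
      ⟨1 / (1 + c), c / (1 + c), by positivity, by positivity, by field_simp, ?_⟩
    rw [e3]
    nth_rw 2 [e2]
    match_scalars <;> field_simp
    ring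

lemma inner_unit_areaNormal_sub (i j : Fin 4) :
    (inner ℝ (unit (areaNormal q)) (unit (q i - q j)) : ℝ) = 0 := by
  rw [unit, unit, real_inner_smul_left, real_inner_smul_right, H.inner_areaNormal_sub]
  ring

lemma isFrame {i j : Fin 4} (h : q i ≠ q j) :
    IsFrame (unit (q i - q j)) (unit (areaNormal q)) where
  inner_u := inner_unit_self (sub_ne_zero.mpr h)
  inner_n := inner_unit_self H.areaNormal_ne_zero
  inner_un := by rw [real_inner_comm, H.inner_unit_areaNormal_sub]

end IsPlanarQuad

/-- Cosine and sine of an interior angle in terms of unit vectors along the sides and the unit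
normal. -/
lemma interiorAngle_cos_sin {q : Fin 4 → E3} {i : Fin 4} (h1 : q (i + 1) ≠ q i)
    (h2 : q (i - 1) ≠ q i) (hn : areaNormal q ≠ 0)
    (hp : ∀ j k, (inner ℝ (areaNormal q) (q j - q k) : ℝ) = 0) :
    Real.cos (interiorAngle q i) = inner ℝ (unit (q (i + 1) - q i)) (unit (q (i - 1) - q i)) ∧
    Real.sin (interiorAngle q i) = inner ℝ (unit (areaNormal q))
      (cross (unit (q (i + 1) - q i)) (unit (q (i - 1) - q i))) := by
  have nu := norm_pos_iff.mpr (sub_ne_zero.mpr h1)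
  have nv := norm_pos_iff.mpr (sub_ne_zero.mpr h2)
  have nn := norm_pos_iff.mpr hn
  rw [interiorAngle, cos_toIcoMod, sin_toIcoMod]
  have hu := inner_unit_self (sub_ne_zero.mpr h1)
  have hv := inner_unit_self (sub_ne_zero.mpr h2)
  have hnn := inner_unit_self hn
  have pu := hp (i + 1) i
  have pv := hp (i - 1) i
  set u := q (i + 1) - q i
  set v := q (i - 1) - q i
  set n := areaNormal q
  have hnu : (inner ℝ (unit n) (unit u) : ℝ) = 0 := by
    rw [unit, unit, real_inner_smul_left, real_inner_smul_right, pu]; ring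
  have hnv : (inner ℝ (unit n) (unit v) : ℝ) = 0 := by
    rw [unit, unit, real_inner_smul_left, real_inner_smul_right, pv]; ring
  have e1 : ‖n‖ * inner ℝ u v = ‖n‖ * ‖u‖ * ‖v‖ * inner ℝ (unit u) (unit v) := by
    rw [inner_norm_mul_unit u v]; ring
  have e2 : (inner ℝ n (cross u v) : ℝ) =
      ‖n‖ * ‖u‖ * ‖v‖ * inner ℝ (unit n) (cross (unit u) (unit v)) := by
    conv_lhs => rw [← norm_smul_unit n, ← norm_smul_unit u, ← norm_smul_unit v]
    rw [cross_smul_left, cross_smul_right, real_inner_smul_left, real_inner_smul_right,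
      real_inner_smul_right]
    ring
  have hsq := inner_cross_sq (unit n) (unit u) (unit v)
  rw [hu, hv, hnn, hnu, hnv] at hsq
  rw [e1, e2]
  have hr : 0 < ‖n‖ * ‖u‖ * ‖v‖ := by positivity
  generalize ‖n‖ * ‖u‖ * ‖v‖ = r at hr
  generalize (inner ℝ (unit u) (unit v) : ℝ) = c at *
  generalize (inner ℝ (unit n) (cross (unit u) (unit v)) : ℝ) = s at *
  exact cos_sin_arg_mk hr (by linarith)

lemma interiorAngle_mem (q : Fin 4 → E3) (i : Fin 4) : interiorAngle q i ∈ Set.Ico 0 (2 * π) :=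
  toIcoMod_two_pi_mem _

namespace IsPlanarQuad

variable {q : Fin 4 → E3} (H : IsPlanarQuad q)

include H

/-- The next side turned counterclockwise by the interior angle is the previous side. -/
lemma unit_sub_one_eq (i : Fin 4) : unit (q (i - 1) - q i) =
    Real.cos (interiorAngle q i) • unit (q (i + 1) - q i) +
      Real.sin (interiorAngle q i) • cross (unit (areaNormal q)) (unit (q (i + 1) - q i)) := by
  obtain ⟨hc, hs⟩ := interiorAngle_cos_sin (H.ne i) (H.ne_sub_one i) H.areaNormal_ne_zero
    H.inner_areaNormal_sub
  refine (H.isFrame (H.ne i)).eq_of_inner_n_eq_zero ?_ hc.symm hs.symm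
  rw [real_inner_comm, H.inner_unit_areaNormal_sub]

/-- The previous side turned clockwise by the interior angle is the next side. -/
lemma unit_add_one_eq (i : Fin 4) : unit (q (i + 1) - q i) =
    Real.cos (interiorAngle q i) • unit (q (i - 1) - q i) -
      Real.sin (interiorAngle q i) • cross (unit (areaNormal q)) (unit (q (i - 1) - q i)) := by
  obtain ⟨hc, hs⟩ := interiorAngle_cos_sin (H.ne i) (H.ne_sub_one i) H.areaNormal_ne_zero
    H.inner_areaNormal_sub
  rw [sub_eq_add_neg (_ • _), ← neg_smul]
  refine (H.isFrame (H.ne_sub_one i)).eq_of_inner_n_eq_zero ?_ ?_ ?_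
  · rw [real_inner_comm, H.inner_unit_areaNormal_sub]
  · rw [real_inner_comm, hc]
  · rw [cross_anticomm', inner_neg_right, hs]

end IsPlanarQuad

lemma inner_sub_sub_of_congruent {ι : Type*} {q q' : ι → E3} (h : Congruent q q') (a b c d : ι) :
    (inner ℝ (q a - q b) (q c - q d) : ℝ) = inner ℝ (q' a - q' b) (q' c - q' d) := by
  have hd : ∀ a b, ‖q a - q b‖ = ‖q' a - q' b‖ := fun a b => by
    rw [← dist_eq_norm, ← dist_eq_norm]; exact h.dist_eq a b
  have h1 : ∀ a b c, (inner ℝ (q a - q b) (q c - q b) : ℝ) =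
      inner ℝ (q' a - q' b) (q' c - q' b) := fun a b c => by
    have e := norm_sub_sq_real (q a - q b) (q c - q b)
    have e' := norm_sub_sq_real (q' a - q' b) (q' c - q' b)
    rw [sub_sub_sub_cancel_right] at e e'
    rw [hd, hd, hd] at e
    linarith
  have s : ∀ p : ι → E3, (inner ℝ (p a - p b) (p c - p d) : ℝ) =
      inner ℝ (p a - p b) (p c - p b) - inner ℝ (p a - p b) (p d - p b) := fun p => by
    rw [← inner_sub_right, sub_sub_sub_cancel_right]
  rw [s, s, h1, h1]

/-- Interior angles are determined by the mutual distances of the vertices. -/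
lemma interiorAngle_congr {q q' : Fin 4 → E3} (h : Congruent q q') (i : Fin 4) :
    interiorAngle q i = interiorAngle q' i := by
  have hin := inner_sub_sub_of_congruent h
  have hn : ‖areaNormal q‖ = ‖areaNormal q'‖ := by
    rw [← sq_eq_sq₀ (norm_nonneg _) (norm_nonneg _), ← real_inner_self_eq_norm_sq,
      ← real_inner_self_eq_norm_sq, areaNormal, areaNormal, inner_cross_cross, inner_cross_cross]
    simp only [hin]
  rw [interiorAngle, interiorAngle, hn]
  congr 3
  · rw [hin]
  · rw [areaNormal, areaNormal, inner_cross_cross, inner_cross_cross]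
    simp only [hin]

/-! ### Quadrilaterals in plane coordinates -/

lemma collinear_iff_cross_eq_zero (a b c : E3) :
    Collinear ℝ {a, b, c} ↔ cross (b - a) (c - a) = 0 := by
  constructor
  · intro h
    obtain ⟨v, hv⟩ := (collinear_iff_of_mem (p₀ := a) (by simp)).mp h
    obtain ⟨r, hr⟩ := hv b (by simp)
    obtain ⟨s, hs⟩ := hv c (by simp)
    rw [hr, hs, vadd_eq_add, vadd_eq_add, add_sub_cancel_right, add_sub_cancel_right,
      cross_smul_left, cross_smul_right, cross_self', smul_zero, smul_zero]
  · intro h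
    by_cases hb : b - a = 0
    · rw [sub_eq_zero.mp hb, Set.insert_eq_of_mem (by simp)]
      exact collinear_pair ℝ _ _
    · obtain ⟨r, hr⟩ := exists_smul_of_cross_eq_zero hb h
      rw [collinear_iff_of_mem (p₀ := a) (by simp)]
      refine ⟨b - a, ?_⟩
      rintro p (rfl | rfl | rfl)
      · exact ⟨0, by simp⟩
      · exact ⟨1, by simp⟩
      · exact ⟨r, by rw [← hr]; simp⟩

/-- The determinant of two plane vectors. -/
def det₂ (x y : ℝ × ℝ) : ℝ := x.1 * y.2 - x.2 * y.1

/-- A non-degenerate simple quadrilateral in plane coordinates. -/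
structure IsSimpleQuad (x : Fin 4 → ℝ × ℝ) : Prop where
  corner : ∀ i, det₂ (x (i + 1) - x i) (x (i + 2) - x i) ≠ 0
  simple₁ : Disjoint (segment ℝ (x 0) (x 1)) (segment ℝ (x 2) (x 3))
  simple₂ : Disjoint (segment ℝ (x 1) (x 2)) (segment ℝ (x 3) (x 0))

/-- Twice the signed area of a quadrilateral in plane coordinates. -/
def area₂ (x : Fin 4 → ℝ × ℝ) : ℝ := det₂ (x 2 - x 0) (x 3 - x 1)

/-- The affine map with origin `o` and axes `e`, `r` from plane coordinates into space. -/
def place (o e r : E3) : (ℝ × ℝ) →ᵃ[ℝ] E3 :=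
  ((LinearMap.fst ℝ ℝ ℝ).smulRight e + (LinearMap.snd ℝ ℝ ℝ).smulRight r).toAffineMap +
    AffineMap.const ℝ (ℝ × ℝ) o

lemma place_apply (o e r : E3) (x : ℝ × ℝ) : place o e r x = x.1 • e + x.2 • r + o := by
  simp [place]

lemma place_sub_place (o e r : E3) (x y : ℝ × ℝ) :
    place o e r x - place o e r y = (x - y).1 • e + (x - y).2 • r := by
  rw [place_apply, place_apply, Prod.fst_sub, Prod.snd_sub, sub_smul, sub_smul]
  abel

lemma cross_place_sub (o e r : E3) (x y z w : ℝ × ℝ) :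
    cross (place o e r x - place o e r y) (place o e r z - place o e r w) =
      det₂ (x - y) (z - w) • cross e r := by
  rw [place_sub_place, place_sub_place, cross_add_left, cross_add_right, cross_add_right,
    cross_smul_left, cross_smul_left, cross_smul_right, cross_smul_right, cross_smul_left,
    cross_smul_left, cross_smul_right, cross_smul_right, cross_self', cross_self',
    cross_anticomm' r e, det₂]
  module

lemma areaNormal_place (o e r : E3) (x : Fin 4 → ℝ × ℝ) :
    areaNormal (place o e r ∘ x) = area₂ x • cross e r := cross_place_sub _ _ _ _ _ _ _

section

variable {o e r : E3} (H : IsFrame e r)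

include H

lemma norm_cross_frame : ‖cross e r‖ = 1 := by
  have h : (inner ℝ (cross e r) (cross e r) : ℝ) = 1 := by
    rw [inner_cross_cross, H.inner_u, H.inner_n, H.inner_un, H.inner_nu]; norm_num
  rw [real_inner_self_eq_norm_sq] at h
  exact (pow_eq_one_iff_of_nonneg (norm_nonneg _) two_ne_zero).mp h

lemma cross_frame_ne_zero : cross e r ≠ 0 := by
  rw [← norm_ne_zero_iff, norm_cross_frame H]
  exact one_ne_zero

lemma inner_place_sub (x y z w : ℝ × ℝ) :
    (inner ℝ (place o e r x - place o e r y) (place o e r z - place o e r w) : ℝ) =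
      (x - y).1 * (z - w).1 + (x - y).2 * (z - w).2 := by
  rw [place_sub_place, place_sub_place]
  simp only [inner_add_left, inner_add_right, real_inner_smul_left, real_inner_smul_right,
    H.inner_u, H.inner_n, H.inner_un, H.inner_nu]
  ring

lemma dist_place (x y : ℝ × ℝ) : dist (place o e r x) (place o e r y) =
    √((x - y).1 ^ 2 + (x - y).2 ^ 2) := by
  rw [dist_eq_norm, @norm_eq_sqrt_real_inner E3, inner_place_sub H, pow_two, pow_two]

lemma place_injective : Function.Injective (place o e r) := fun x y h => by
  have h1 := inner_place_sub (o := o) H x y x y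
  rw [h, sub_self, inner_zero_left] at h1
  have hx : (x - y).1 = 0 := by nlinarith [sq_nonneg (x - y).1, sq_nonneg (x - y).2]
  have hy : (x - y).2 = 0 := by nlinarith [sq_nonneg (x - y).1, sq_nonneg (x - y).2]
  exact sub_eq_zero.mp (Prod.ext hx hy)

lemma isPlanarQuad_place_iff {x : Fin 4 → ℝ × ℝ} :
    IsPlanarQuad (place o e r ∘ x) ↔ IsSimpleQuad x := by
  have hinj := place_injective (o := o) H
  have hcorner : ∀ i, (¬ Collinear ℝ {(place o e r ∘ x) i, (place o e r ∘ x) (i + 1),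
      (place o e r ∘ x) (i + 2)}) ↔ det₂ (x (i + 1) - x i) (x (i + 2) - x i) ≠ 0 := fun i => by
    rw [collinear_iff_cross_eq_zero]
    simp only [Function.comp_apply]
    rw [cross_place_sub, smul_eq_zero, not_or, and_iff_left (cross_frame_ne_zero H)]
  have hseg : ∀ a b c d, Disjoint (segment ℝ ((place o e r ∘ x) a) ((place o e r ∘ x) b))
      (segment ℝ ((place o e r ∘ x) c) ((place o e r ∘ x) d)) ↔
      Disjoint (segment ℝ (x a) (x b)) (segment ℝ (x c) (x d)) := fun a b c d => by
    simp only [Function.comp_apply]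
    rw [← image_segment, ← image_segment, Set.disjoint_image_iff hinj]
  constructor
  · intro h
    exact ⟨fun i => (hcorner i).mp (h.corner i), (hseg _ _ _ _).mp h.simple₁,
      (hseg _ _ _ _).mp h.simple₂⟩
  · intro h
    refine ⟨?_, fun i => (hcorner i).mpr (h.corner i), (hseg _ _ _ _).mpr h.simple₁,
      (hseg _ _ _ _).mpr h.simple₂⟩
    rw [coplanar_iff_finrank_le_two]
    have hle : vectorSpan ℝ (Set.range (place o e r ∘ x)) ≤
        LinearMap.range (place o e r).linear := by
      rw [vectorSpan_def, Submodule.span_le]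
      rintro _ ⟨_, ⟨i, rfl⟩, _, ⟨j, rfl⟩, rfl⟩
      exact ⟨x i - x j, by
        rw [← vsub_eq_sub (x i), AffineMap.linearMap_vsub]; rfl⟩
    calc Module.finrank ℝ (vectorSpan ℝ (Set.range (place o e r ∘ x)))
        ≤ Module.finrank ℝ (LinearMap.range (place o e r).linear) := Submodule.finrank_mono hle
      _ ≤ Module.finrank ℝ (ℝ × ℝ) := LinearMap.finrank_range_le _
      _ = 2 := by simp

end

/-- Interior angles can be computed in plane coordinates. The sign `ω` tells whether the
vertices are listed counterclockwise with respect to the coordinates. -/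
lemma interiorAngle_place {o e r : E3} (H : IsFrame e r) {x : Fin 4 → ℝ × ℝ}
    (hx : IsSimpleQuad x) {ω θ l l' c s c' s' : ℝ} {i : Fin 4} (hω : unit (areaNormal
      (place o e r ∘ x)) = ω • cross e r) (hl : 0 < l) (hl' : 0 < l')
    (h1 : x (i + 1) - x i = (l * c, l * s)) (h2 : x (i - 1) - x i = (l' * c', l' * s'))
    (hcs : c ^ 2 + s ^ 2 = 1) (hcs' : c' ^ 2 + s' ^ 2 = 1) (hθ : θ ∈ Set.Ico 0 (2 * π))
    (hcos : c * c' + s * s' = Real.cos θ) (hsin : ω * (c * s' - s * c') = Real.sin θ) :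
    interiorAngle (place o e r ∘ x) i = θ := by
  have hq := (isPlanarQuad_place_iff (o := o) H).mpr hx
  obtain ⟨hc, hs⟩ := interiorAngle_cos_sin (hq.ne i) (hq.ne_sub_one i) hq.areaNormal_ne_zero
    hq.inner_areaNormal_sub
  have key : ∀ {j : Fin 4} {l c s : ℝ}, 0 < l → x j - x i = (l * c, l * s) →
      c ^ 2 + s ^ 2 = 1 →
      unit ((place o e r ∘ x) j - (place o e r ∘ x) i) = c • e + s • r :=
    fun {j l c s} hl h hcs => by
      simp only [Function.comp_apply]
      rw [place_sub_place, h, mul_smul, mul_smul, ← smul_add, unit_smul_of_pos hl,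
        unit_of_inner_self]
      simp only [inner_add_left, inner_add_right, real_inner_smul_left, real_inner_smul_right,
        H.inner_u, H.inner_n, H.inner_un, H.inner_nu]
      linear_combination hcs
  rw [key hl h1 hcs, key hl' h2 hcs'] at hc hs
  apply eq_of_cos_eq_of_sin_eq (interiorAngle_mem _ _) hθ
  · rw [hc, ← hcos]
    simp only [inner_add_left, inner_add_right, real_inner_smul_left, real_inner_smul_right,
      H.inner_u, H.inner_n, H.inner_un, H.inner_nu]
    ring
  · rw [hs, ← hsin, hω]
    have : cross (c • e + s • r) (c' • e + s' • r) = (c * s' - s * c') • cross e r := by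
      simp only [cross_add_left, cross_add_right, cross_smul_left, cross_smul_right, cross_self']
      rw [cross_anticomm' r e]
      module
    rw [this, real_inner_smul_left, real_inner_smul_right, real_inner_self_eq_norm_sq,
      norm_cross_frame H]
    ring

/-! ### Uniform notation for the side faces -/

/-- The angle at `A i` of the `i`-th side face. -/
def angP (α γ : Fin 4 → ℝ) : Fin 4 → ℝ := ![α 0, γ 1, α 2, γ 3]

/-- The angle at `A i` of the side face number `i - 1`. -/
def angQ (α γ : Fin 4 → ℝ) : Fin 4 → ℝ := ![γ 0, α 1, γ 2, α 3]

namespace KokotsakisPolyhedron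

/-- The vertex adjacent to `A i` in the `i`-th side face, outside the base. -/
def P (K : KokotsakisPolyhedron) : Fin 4 → E3 := ![K.B 0, K.C 1, K.B 2, K.C 3]

/-- The vertex adjacent to `A i` in the side face number `i - 1`, outside the base. -/
def Q (K : KokotsakisPolyhedron) : Fin 4 → E3 := ![K.C 0, K.B 1, K.C 2, K.B 3]

lemma side_eq (K : KokotsakisPolyhedron) (i : Fin 4) :
    K.side i = ![K.A (i + 1), K.A i, K.P i, K.Q (i + 1)] := by
  fin_cases i <;> rfl

lemma ext_of_P_Q {K L : KokotsakisPolyhedron} (hA : K.A = L.A) (hP : K.P = L.P)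
    (hQ : K.Q = L.Q) : K = L := by
  have hB : K.B = L.B := by
    funext i
    fin_cases i
    exacts [congrFun hP 0, congrFun hQ 1, congrFun hP 2, congrFun hQ 3]
  have hC : K.C = L.C := by
    funext i
    fin_cases i
    exacts [congrFun hQ 0, congrFun hP 1, congrFun hQ 2, congrFun hP 3]
  cases K
  cases L
  simp_all

/-- The planar angles in the uniform notation. -/
structure UniformAngles (K : KokotsakisPolyhedron) (p q β δ : Fin 4 → ℝ) : Prop where
  base : ∀ i, interiorAngle K.A i = δ i
  tri : ∀ i, EuclideanGeometry.angle (K.P i) (K.A i) (K.Q i) = β i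
  angle_p : ∀ i, interiorAngle (K.side i) 1 = p i
  angle_q : ∀ i, interiorAngle (K.side i) 0 = q (i + 1)

lemma hasPlanarAngles_iff {K : KokotsakisPolyhedron} {α β γ δ : Fin 4 → ℝ} :
    K.HasPlanarAngles α β γ δ ↔ K.UniformAngles (angP α γ) (angQ α γ) β δ := by
  constructor
  · rintro ⟨h1, h2, a0, a1, a2, a3, g0, g1, g2, g3⟩
    refine ⟨h1, fun i => ?_, fun i => ?_, fun i => ?_⟩
    · fin_cases i
      exacts [h2 0, (EuclideanGeometry.angle_comm _ _ _).trans (h2 1), h2 2,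
        (EuclideanGeometry.angle_comm _ _ _).trans (h2 3)]
    · fin_cases i <;> assumption
    · fin_cases i <;> assumption
  · rintro ⟨h1, h2, p, q⟩
    refine ⟨h1, fun i => ?_, p 0, q 0, p 2, q 2, q 3, p 1, q 1, p 3⟩
    fin_cases i
    exacts [h2 0, (EuclideanGeometry.angle_comm _ _ _).trans (h2 1), h2 2,
      (EuclideanGeometry.angle_comm _ _ _).trans (h2 3)]

end KokotsakisPolyhedron

/-! ### The equation at a vertex of the base -/

/-- The unit vector along the base edge `A i A (i + 1)`. -/
def eDir (A : Fin 4 → E3) (i : Fin 4) : E3 := unit (A (i + 1) - A i)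

/-- The unit normal of the base. -/
def nDir (A : Fin 4 → E3) : E3 := unit (areaNormal A)

/-- The direction in which the `i`-th side face extends from its base edge, if its exterior dihedral
angle has cosine `c` and sine `s`. -/
def foldDir (A : Fin 4 → E3) (i : Fin 4) (c s : ℝ) : E3 :=
  -c • cross (nDir A) (eDir A i) + s • nDir A

/-- The cosine of the side opposite to `β` in a spherical quadrilateral with
sides `p, β, q, δ`: here `(c, s)` and `(c', s')` are cosine and sine of the exterior
angles between `δ` and `p`, and between `δ` and `q`. -/
def sphCos (p q δ c s c' s' : ℝ) : ℝ :=
  cos p * cos q * cos δ - cos p * sin q * sin δ * c' - sin p * cos q * sin δ * c -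
    sin p * sin q * cos δ * c * c' + sin p * sin q * s * s'

lemma IsPlanarQuad.frame {A : Fin 4 → E3} (hA : IsPlanarQuad A) (i : Fin 4) :
    IsFrame (eDir A i) (nDir A) := hA.isFrame (hA.ne i)

lemma isFrame_foldDir {A : Fin 4 → E3} (hA : IsPlanarQuad A) (i : Fin 4) {c s : ℝ}
    (h : c ^ 2 + s ^ 2 = 1) : IsFrame (eDir A i) (foldDir A i c s) where
  inner_u := (hA.frame i).inner_u
  inner_n := by
    have H := hA.frame i
    simp only [foldDir, inner_add_left, inner_add_right, real_inner_smul_left,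
      real_inner_smul_right, H.inner_n, H.inner_m, inner_self_cross, real_inner_comm (nDir A)]
    linear_combination h
  inner_un := by
    have H := hA.frame i
    simp only [foldDir, inner_add_right, real_inner_smul_right, H.inner_un,
      inner_self_cross_right]
    ring

/-- The outer normal of a folded side face. -/
lemma cross_eDir_foldDir {A : Fin 4 → E3} (hA : IsPlanarQuad A) (i : Fin 4) (c s : ℝ) :
    cross (eDir A i) (foldDir A i c s) =
      -(c • nDir A + s • cross (nDir A) (eDir A i)) := by
  have H := hA.frame i
  rw [foldDir, cross_add_right, cross_smul_right, cross_smul_right, H.cross_u_m,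
    cross_anticomm' (eDir A i)]
  module

/-- The cosine of the angle between two folded edges at `A i`, one in each adjacent side face. -/
lemma inner_fold_directions {A : Fin 4 → E3} (hA : IsPlanarQuad A) (i : Fin 4)
    (p q c s c' s' : ℝ) :
    (inner ℝ (cos p • eDir A i + sin p • foldDir A i c s)
      (-(cos q) • eDir A (i - 1) + sin q • foldDir A (i - 1) c' s') : ℝ) =
    sphCos p q (interiorAngle A i) c s c' s' := by
  have H := hA.frame i
  have h := hA.unit_sub_one_eq i
  have h2 : eDir A (i - 1) = -unit (A (i - 1) - A i) := by
    rw [← unit_neg, neg_sub, eDir, sub_add_cancel]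
  rw [h, ← eDir, ← nDir] at h2
  have h3 : cross (nDir A) (eDir A (i - 1)) = sin (interiorAngle A i) • eDir A i -
      cos (interiorAngle A i) • cross (nDir A) (eDir A i) := by
    rw [h2, cross_neg_right, cross_add_right, cross_smul_right, cross_smul_right, H.cross_n_m]
    module
  rw [foldDir, foldDir, h3, h2, sphCos]
  generalize interiorAngle A i = δ
  have a1 := H.inner_u
  have a2 := H.inner_n
  have a3 := H.inner_un
  have a4 := H.inner_nu
  have a5 := H.inner_m
  have a6 : (inner ℝ (cross (nDir A) (eDir A i)) (eDir A i) : ℝ) = 0 := by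
    rw [real_inner_comm]; simp
  have a7 : (inner ℝ (cross (nDir A) (eDir A i)) (nDir A) : ℝ) = 0 := by
    rw [real_inner_comm]; simp
  simp only [inner_add_left, inner_add_right, inner_neg_right, inner_sub_right,
    real_inner_smul_left, real_inner_smul_right, a1, a2, a3, a4, a5, a6, a7, inner_self_cross,
    inner_self_cross_right]
  ring

/-- In the orthodiagonal case `cos β cos δ = cos p cos q`, with involution factors `a` and `b`, the
relation between the dihedral angles factorises. -/
lemma sphCos_eq_iff {p q δ β a b c s c' s' : ℝ} (hp : sin p ≠ 0) (hcp : cos p ≠ 0)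
    (hcq : cos q ≠ 0) (hδ : cos δ ≠ 0) (ha : a + 1 ≠ 0) (hb : b + 1 ≠ 0)
    (htp : tan p = (a - 1) / (a + 1) * tan δ) (htq : tan q = (b - 1) / (b + 1) * tan δ)
    (hβ : cos β = cos p * cos q / cos δ) :
    sphCos p q δ c s c' s' = cos β ↔
      (a + 1 + (a - 1) * c) * (b + 1 + (b - 1) * c') =
        (a - 1) * (b - 1) / cos δ * (s * s') := by
  have sp : sin p = (a - 1) / (a + 1) * (sin δ / cos δ) * cos p := by
    rw [← tan_eq_sin_div_cos, ← htp, tan_mul_cos hcp]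
  have sq : sin q = (b - 1) / (b + 1) * (sin δ / cos δ) * cos q := by
    rw [← tan_eq_sin_div_cos, ← htq, tan_mul_cos hcq]
  have hsδ : sin δ ≠ 0 := fun h => hp (by rw [sp, h]; simp)
  have hsc := sin_sq_add_cos_sq δ
  have key : sphCos p q δ c s c' s' - cos β = -(cos p * cos q * sin δ ^ 2 / cos δ) *
      (((a + 1 + (a - 1) * c) * (b + 1 + (b - 1) * c') -
        (a - 1) * (b - 1) / cos δ * (s * s')) / ((a + 1) * (b + 1))) := by
    rw [sphCos, hβ, sp, sq]
    field_simp
    linear_combination (cos δ * (a + 1) * (b + 1)) * hsc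
  have hne : -(cos p * cos q * sin δ ^ 2 / cos δ) ≠ 0 := by
    rw [neg_ne_zero]; positivity
  have hab : (a + 1) * (b + 1) ≠ 0 := mul_ne_zero ha hb
  rw [← sub_eq_zero, key, mul_eq_zero, or_iff_right hne, div_eq_zero_iff, or_iff_left hab,
    sub_eq_zero]

namespace KokotsakisPolyhedron

variable (K : KokotsakisPolyhedron)

lemma A_ne (i : Fin 4) : K.A (i + 1) ≠ K.A i := K.base_quad.ne i

lemma P_ne (i : Fin 4) : K.P i ≠ K.A i := by
  have h : IsPlanarQuad (K.side i) := K.side_quad i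
  simpa [side_eq] using h.ne 1

lemma Q_ne (i : Fin 4) : K.Q (i + 1) ≠ K.A (i + 1) := by
  have h : IsPlanarQuad (K.side i) := K.side_quad i
  have := h.ne 3
  simpa [side_eq, eq_comm] using this

lemma inner_eDir_areaNormal_side (i : Fin 4) :
    (inner ℝ (unit (areaNormal (K.side i))) (eDir K.A i) : ℝ) = 0 := by
  have h : IsPlanarQuad (K.side i) := K.side_quad i
  simpa [side_eq, eDir] using h.inner_unit_areaNormal_sub 0 1

/-- The unit normal of a side face is the normal of the base, turned by the dihedral angle. -/
lemma unit_areaNormal_side (i : Fin 4) : unit (areaNormal (K.side i)) =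
    cos (K.dihedral i) • nDir K.A + sin (K.dihedral i) • cross (nDir K.A) (eDir K.A i) := by
  have h : IsPlanarQuad (K.side i) := K.side_quad i
  have H := K.base_quad.frame i
  have hd := H.decomp (unit (areaNormal (K.side i)))
  rw [K.inner_eDir_areaNormal_side i, zero_smul, zero_add] at hd
  have h1 := inner_unit_self h.areaNormal_ne_zero
  set N := unit (areaNormal (K.side i)) with hN
  have hsq : (inner ℝ N (nDir K.A) : ℝ) ^ 2 +
      (inner ℝ N (cross (nDir K.A) (eDir K.A i)) : ℝ) ^ 2 = 1 := by
    have e1 := inner_cross_sq N (nDir K.A) (eDir K.A i)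
    rw [h1, H.inner_n, H.inner_u, H.inner_nu, K.inner_eDir_areaNormal_side i] at e1
    linear_combination e1
  have hr : 0 < ‖K.A (i + 1) - K.A i‖ * ‖areaNormal K.A‖ * ‖areaNormal (K.side i)‖ := by
    have := norm_pos_iff.mpr (sub_ne_zero.mpr (K.A_ne i))
    have := norm_pos_iff.mpr K.base_quad.areaNormal_ne_zero
    have := norm_pos_iff.mpr h.areaNormal_ne_zero
    positivity
  obtain ⟨hc, hs⟩ := cos_sin_arg_mk hr hsq
  have hdih : K.dihedral i = Complex.arg
      ⟨‖K.A (i + 1) - K.A i‖ * ‖areaNormal K.A‖ * ‖areaNormal (K.side i)‖ *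
        inner ℝ N (nDir K.A), ‖K.A (i + 1) - K.A i‖ * ‖areaNormal K.A‖ *
        ‖areaNormal (K.side i)‖ * inner ℝ N (cross (nDir K.A) (eDir K.A i))⟩ := by
    rw [dihedral]
    congr 2
    · rw [inner_norm_mul_unit (areaNormal K.A), ← nDir, real_inner_comm]
      ring
    · conv_lhs => rw [← norm_smul_unit (areaNormal (K.side i)), ← norm_smul_unit (areaNormal K.A),
        ← norm_smul_unit (K.A (i + 1) - K.A i)]
      rw [cross_smul_left, cross_smul_right, real_inner_smul_left, real_inner_smul_right,
        real_inner_smul_right, hN, nDir, eDir]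
      ring
  rw [hdih, hc, hs]
  conv_lhs => rw [hd]
  rw [add_comm]

lemma cross_areaNormal_side_eDir (i : Fin 4) :
    cross (unit (areaNormal (K.side i))) (eDir K.A i) =
      -foldDir K.A i (cos (K.dihedral i)) (sin (K.dihedral i)) := by
  have H := K.base_quad.frame i
  rw [K.unit_areaNormal_side, cross_add_left, cross_smul_left, cross_smul_left, H.cross_m_u,
    foldDir]
  module

lemma unit_P_sub (i : Fin 4) : unit (K.P i - K.A i) =
    cos (interiorAngle (K.side i) 1) • eDir K.A i + sin (interiorAngle (K.side i) 1) •
      foldDir K.A i (cos (K.dihedral i)) (sin (K.dihedral i)) := by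
  have h : IsPlanarQuad (K.side i) := K.side_quad i
  have e := h.unit_add_one_eq 1
  have c := K.cross_areaNormal_side_eDir i
  have e0 : K.side i (1 - 1) - K.side i 1 = K.A (i + 1) - K.A i := by simp [side_eq]
  have e1 : K.side i (1 + 1) - K.side i 1 = K.P i - K.A i := by simp [side_eq]
  rw [e0, e1, ← eDir, c] at e
  rw [e]
  module

lemma unit_Q_sub (i : Fin 4) : unit (K.Q (i + 1) - K.A (i + 1)) =
    -cos (interiorAngle (K.side i) 0) • eDir K.A i + sin (interiorAngle (K.side i) 0) •
      foldDir K.A i (cos (K.dihedral i)) (sin (K.dihedral i)) := by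
  have h : IsPlanarQuad (K.side i) := K.side_quad i
  have e := h.unit_sub_one_eq 0
  have c := K.cross_areaNormal_side_eDir i
  have e0 : K.side i (0 + 1) - K.side i 0 = -(K.A (i + 1) - K.A i) := by simp [side_eq]
  have e1 : K.side i (0 - 1) - K.side i 0 = K.Q (i + 1) - K.A (i + 1) := by simp [side_eq]
  rw [e0, e1, unit_neg, ← eDir, cross_neg_right, c] at e
  rw [e]
  module

/-- The relation between the dihedral angles at the two base edges through `A i`. -/
lemma sphCos_eq {p q β δ : Fin 4 → ℝ} (h : K.UniformAngles p q β δ) (i : Fin 4) :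
    sphCos (p i) (q i) (δ i) (cos (K.dihedral i)) (sin (K.dihedral i))
      (cos (K.dihedral (i - 1))) (sin (K.dihedral (i - 1))) = cos (β i) := by
  have hP := K.unit_P_sub i
  have hQ := K.unit_Q_sub (i - 1)
  rw [h.angle_p] at hP
  rw [h.angle_q, sub_add_cancel] at hQ
  rw [← h.base, ← inner_fold_directions K.base_quad, ← hP, ← hQ, ← h.tri,
    EuclideanGeometry.angle, InnerProductGeometry.cos_angle, vsub_eq_sub, vsub_eq_sub, unit, unit,
    real_inner_smul_left, real_inner_smul_right]
  field_simp

end KokotsakisPolyhedron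

/-! ### Folding a flat pattern -/

/-- A side face in plane coordinates: the base edge is the segment of length `l` on the first axis,
the adjacent edges have lengths `ρ`, `τ` and the angles at the base are `p`, `q`. The order of the
vertices is that of `sideQuad`. -/
def flat (l ρ τ p q : ℝ) : Fin 4 → ℝ × ℝ :=
  ![(l, 0), (0, 0), (ρ * cos p, ρ * sin p), (l - τ * cos q, τ * sin q)]

/-- The base and the four side faces before they are folded up: `ρ i` and `τ i` are the lengths of
the edges that leave `A i` in the side faces number `i` and `i - 1`, and `p i`, `q i` are the
angles of these faces at `A i`. The areas of the side faces are negative because `flat` lists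
their vertices clockwise. -/
structure FlapPattern where
  A : Fin 4 → E3
  ρ : Fin 4 → ℝ
  τ : Fin 4 → ℝ
  p : Fin 4 → ℝ
  q : Fin 4 → ℝ
  quad : IsPlanarQuad A
  ρ_pos : ∀ i, 0 < ρ i
  τ_pos : ∀ i, 0 < τ i
  p_mem : ∀ i, p i ∈ Set.Ioo 0 π
  q_mem : ∀ i, q i ∈ Set.Ioo 0 π
  simple : ∀ i, IsSimpleQuad (flat ‖A (i + 1) - A i‖ (ρ i) (τ (i + 1)) (p i) (q (i + 1)))
  area_neg : ∀ i, area₂ (flat ‖A (i + 1) - A i‖ (ρ i) (τ (i + 1)) (p i) (q (i + 1))) < 0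

namespace FlapPattern

variable (F : FlapPattern) (x : Fin 4 → OnePoint ℝ)

/-- The `i`-th side face in plane coordinates. -/
def flatSide (i : Fin 4) : Fin 4 → ℝ × ℝ :=
  flat ‖F.A (i + 1) - F.A i‖ (F.ρ i) (F.τ (i + 1)) (F.p i) (F.q (i + 1))

/-- The second axis of the plane of the `i`-th side face, when folded according to the
half-tangent `x i`. -/
def axis (i : Fin 4) : E3 := foldDir F.A i (hcos (x i)) (hsin (x i))

/-- The direction of the edge at `A i` in the side face number `i`. -/
def dirP (i : Fin 4) : E3 := cos (F.p i) • eDir F.A i + sin (F.p i) • F.axis x i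

/-- The direction of the edge at `A i` in the side face number `i - 1`. -/
def dirQ (i : Fin 4) : E3 := -cos (F.q i) • eDir F.A (i - 1) + sin (F.q i) • F.axis x (i - 1)

/-- The end point of the edge at `A i` in the side face number `i`. -/
def foldP (i : Fin 4) : E3 := F.A i + F.ρ i • F.dirP x i

/-- The end point of the edge at `A i` in the side face number `i - 1`. -/
def foldQ (i : Fin 4) : E3 := F.A i + F.τ i • F.dirQ x i

/-- The vertices `B i` after folding. -/
def foldB : Fin 4 → E3 := ![F.foldP x 0, F.foldQ x 1, F.foldP x 2, F.foldQ x 3]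

/-- The vertices `C i` after folding. -/
def foldC : Fin 4 → E3 := ![F.foldQ x 0, F.foldP x 1, F.foldQ x 2, F.foldP x 3]

lemma isFrame_axis (i : Fin 4) : IsFrame (eDir F.A i) (F.axis x i) :=
  isFrame_foldDir F.quad i (hcos_sq_add_hsin_sq _)

lemma inner_dirP_self (i : Fin 4) : (inner ℝ (F.dirP x i) (F.dirP x i) : ℝ) = 1 := by
  have H := F.isFrame_axis x i
  simp only [dirP, inner_add_left, inner_add_right, real_inner_smul_left, real_inner_smul_right,
    H.inner_u, H.inner_n, H.inner_un, H.inner_nu]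
  linear_combination sin_sq_add_cos_sq (F.p i)

lemma inner_dirQ_self (i : Fin 4) : (inner ℝ (F.dirQ x i) (F.dirQ x i) : ℝ) = 1 := by
  have H := F.isFrame_axis x (i - 1)
  simp only [dirQ, inner_add_left, inner_add_right, real_inner_smul_left, real_inner_smul_right,
    H.inner_u, H.inner_n, H.inner_un, H.inner_nu]
  linear_combination sin_sq_add_cos_sq (F.q i)

/-- Each folded side face is a copy of the flat one in the plane spanned by its base edge and
its axis. -/
lemma sideQuad_fold (i : Fin 4) : sideQuad F.A (F.foldB x) (F.foldC x) i =
    place (F.A i) (eDir F.A i) (F.axis x i) ∘ F.flatSide i := by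
  have h1 : sideQuad F.A (F.foldB x) (F.foldC x) i =
      ![F.A (i + 1), F.A i, F.foldP x i, F.foldQ x (i + 1)] := by
    fin_cases i <;> rfl
  have h2 : F.A (i + 1) = ‖F.A (i + 1) - F.A i‖ • eDir F.A i + F.A i := by
    rw [eDir, norm_smul_unit]; abel
  rw [h1]
  funext j
  fin_cases j
  · simp only [Fin.zero_eta, Matrix.cons_val_zero, Function.comp_apply, place_apply, flatSide, flat,
      zero_smul, add_zero]
    exact h2
  · simp [place_apply, flatSide, flat]
  · simp only [Fin.reduceFinMk, Matrix.cons_val, Function.comp_apply, place_apply, flatSide, flat,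
      foldP, dirP]
    module
  · simp only [Fin.reduceFinMk, Matrix.cons_val, Function.comp_apply, place_apply, flatSide, flat,
      foldQ, dirQ, add_sub_cancel_right]
    nth_rw 1 [h2]
    module

lemma not_collinear_of_inner_eq_cos {u v o : E3} {r s β : ℝ} (hu : (inner ℝ u u : ℝ) = 1)
    (hv : (inner ℝ v v : ℝ) = 1) (huv : (inner ℝ u v : ℝ) = cos β) (hβ : β ∈ Set.Ioo 0 π)
    (hr : 0 < r) (hs : 0 < s) : ¬ Collinear ℝ {o, o + r • u, o + s • v} := by
  rw [collinear_iff_cross_eq_zero, add_sub_cancel_left, add_sub_cancel_left, cross_smul_left,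
    cross_smul_right, smul_smul, smul_eq_zero, not_or]
  refine ⟨by positivity, fun h => ?_⟩
  have h2 := inner_cross_cross u v u v
  rw [h, inner_zero_left, hu, hv, real_inner_comm u v, huv] at h2
  have h3 := sin_pos_of_mem_Ioo hβ
  have h4 := sin_sq_add_cos_sq β
  nlinarith

lemma inner_dirP_dirQ (i : Fin 4) : (inner ℝ (F.dirP x i) (F.dirQ x i) : ℝ) =
    sphCos (F.p i) (F.q i) (interiorAngle F.A i) (hcos (x i)) (hsin (x i))
      (hcos (x (i - 1))) (hsin (x (i - 1))) :=
  inner_fold_directions F.quad i _ _ _ _ _ _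

/-- The half-tangents `x` close up all four triangles with angles `β`. -/
structure Closes (β : Fin 4 → ℝ) : Prop where
  mem : ∀ i, β i ∈ Set.Ioo 0 π
  eq : ∀ i, (inner ℝ (F.dirP x i) (F.dirQ x i) : ℝ) = cos (β i)

variable {F x}

/-- The folded polyhedron. -/
def fold {β : Fin 4 → ℝ} (h : F.Closes x β) : KokotsakisPolyhedron where
  A := F.A
  B := F.foldB x
  C := F.foldC x
  base_quad := F.quad
  side_quad i := by
    rw [sideQuad_fold, isPlanarQuad_place_iff (F.isFrame_axis x i)]
    exact F.simple i
  triangle i := by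
    have key : ∀ i, ¬ Collinear ℝ {F.A i, F.foldP x i, F.foldQ x i} := fun i =>
      not_collinear_of_inner_eq_cos (F.inner_dirP_self x i) (F.inner_dirQ_self x i) (h.eq i)
        (h.mem i) (F.ρ_pos i) (F.τ_pos i)
    have key' : ∀ i, ¬ Collinear ℝ {F.A i, F.foldQ x i, F.foldP x i} := fun i => by
      rw [Set.pair_comm]; exact key i
    fin_cases i
    exacts [key 0, key' 1, key 2, key' 3]

variable {β : Fin 4 → ℝ} (h : F.Closes x β)

lemma fold_P : (fold h).P = F.foldP x := by
  funext i
  fin_cases i <;> rfl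

lemma fold_Q : (fold h).Q = F.foldQ x := by
  funext i
  fin_cases i <;> rfl

lemma fold_side (i : Fin 4) :
    (fold h).side i = place (F.A i) (eDir F.A i) (F.axis x i) ∘ F.flatSide i :=
  F.sideQuad_fold x i

lemma unit_areaNormal_fold_side (i : Fin 4) :
    unit (areaNormal (place (F.A i) (eDir F.A i) (F.axis x i) ∘ F.flatSide i)) =
      (-1 : ℝ) • cross (eDir F.A i) (F.axis x i) := by
  have ha : area₂ (F.flatSide i) < 0 := F.area_neg i
  have hn := norm_cross_frame (F.isFrame_axis x i)
  rw [areaNormal_place, ← neg_smul_neg, unit_smul_of_pos (by linarith), unit_neg, unit, hn]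
  simp

lemma fold_uniformAngles :
    (fold h).UniformAngles F.p F.q β (fun i => interiorAngle F.A i) where
  base i := rfl
  tri i := by
    have e1 : (fold h).P i -ᵥ (fold h).A i = F.ρ i • F.dirP x i := by
      rw [fold_P, foldP, vsub_eq_sub]; exact add_sub_cancel_left _ _
    have e2 : (fold h).Q i -ᵥ (fold h).A i = F.τ i • F.dirQ x i := by
      rw [fold_Q, foldQ, vsub_eq_sub]; exact add_sub_cancel_left _ _
    have n1 : ‖F.dirP x i‖ = 1 := by
      rw [@norm_eq_sqrt_real_inner E3, inner_dirP_self, sqrt_one]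
    have n2 : ‖F.dirQ x i‖ = 1 := by
      rw [@norm_eq_sqrt_real_inner E3, inner_dirQ_self, sqrt_one]
    rw [EuclideanGeometry.angle, e1, e2, InnerProductGeometry.angle_smul_left_of_pos _ _ (F.ρ_pos i),
      InnerProductGeometry.angle_smul_right_of_pos _ _ (F.τ_pos i), InnerProductGeometry.angle,
      n1, n2, h.eq, mul_one, div_one, arccos_cos (h.mem i).1.le (h.mem i).2.le]
  angle_p i := by
    have hm := F.p_mem i
    rw [fold_side]
    refine interiorAngle_place (F.isFrame_axis x i) (F.simple i) (ω := -1) (l := F.ρ i)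
      (l' := ‖F.A (i + 1) - F.A i‖) (c := cos (F.p i)) (s := sin (F.p i)) (c' := 1) (s' := 0)
      (unit_areaNormal_fold_side i) (F.ρ_pos i)
      (norm_pos_iff.mpr (sub_ne_zero.mpr (F.quad.ne i))) ?_ ?_ (by rw [add_comm, sin_sq_add_cos_sq])
      (by norm_num) ⟨hm.1.le, by linarith [hm.2, pi_pos]⟩ (by ring) (by ring)
    · simp [flat]
    · simp [flat]
  angle_q i := by
    have hm := F.q_mem (i + 1)
    rw [fold_side]
    refine interiorAngle_place (F.isFrame_axis x i) (F.simple i) (ω := -1)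
      (l := ‖F.A (i + 1) - F.A i‖) (l' := F.τ (i + 1)) (c := -1) (s := 0) (c' := -cos (F.q (i + 1)))
      (s' := sin (F.q (i + 1))) (unit_areaNormal_fold_side i)
      (norm_pos_iff.mpr (sub_ne_zero.mpr (F.quad.ne i))) (F.τ_pos (i + 1)) ?_ ?_ (by norm_num)
      (by rw [neg_sq, add_comm, sin_sq_add_cos_sq]) ⟨hm.1.le, by linarith [hm.2, pi_pos]⟩
      (by ring) (by ring)
    · simp [flat]
    · simp [flat]

/-- A folded polyhedron has the dihedral angles by which its pattern was folded. -/
lemma fold_halfTans : (fold h).halfTans = x := by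
  funext i
  have H := F.quad.frame i
  have e := (fold h).unit_areaNormal_side i
  have hA : (fold h).A = F.A := rfl
  rw [fold_side, unit_areaNormal_fold_side, axis, cross_eDir_foldDir F.quad, smul_neg, neg_smul,
    neg_neg, one_smul, hA] at e
  have hm : (fold h).dihedral i ∈ Set.Ioc (-π) π := Complex.arg_mem_Ioc _
  have a7 : (inner ℝ (cross (nDir F.A) (eDir F.A i)) (nDir F.A) : ℝ) = 0 := by
    rw [real_inner_comm]; simp
  apply ext_of_hcos_hsin
  · rw [KokotsakisPolyhedron.halfTans, hcos_halfTan hm]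
    have e1 := congrArg (fun v => (inner ℝ v (nDir F.A) : ℝ)) e
    simp only [inner_add_left, real_inner_smul_left, H.inner_n, a7] at e1
    linarith
  · rw [KokotsakisPolyhedron.halfTans, hsin_halfTan hm]
    have e1 := congrArg (fun v => (inner ℝ v (cross (nDir F.A) (eDir F.A i)) : ℝ)) e
    simp only [inner_add_left, real_inner_smul_left, H.inner_m, inner_self_cross] at e1
    linarith

end FlapPattern

lemma congruent_triple {a b c a' b' c' : E3} (h1 : dist a b = dist a' b')
    (h2 : dist a c = dist a' c') (h3 : dist b c = dist b' c') :
    Congruent ![a, b, c] ![a', b', c'] := by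
  rw [congruent_iff_dist_eq]
  intro i j
  fin_cases i <;> fin_cases j <;> simp [h1, h2, h3, dist_comm b a, dist_comm b' a', dist_comm c a,
    dist_comm c' a', dist_comm c b, dist_comm c' b']

namespace FlapPattern

variable {F : FlapPattern} {x y : Fin 4 → OnePoint ℝ} {β : Fin 4 → ℝ}

lemma dist_foldP (i : Fin 4) : dist (F.A i) (F.foldP x i) = F.ρ i := by
  rw [foldP, dist_self_add_right, norm_smul, Real.norm_of_nonneg (F.ρ_pos i).le,
    @norm_eq_sqrt_real_inner E3, inner_dirP_self, sqrt_one, mul_one]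

lemma dist_foldQ (i : Fin 4) : dist (F.A i) (F.foldQ x i) = F.τ i := by
  rw [foldQ, dist_self_add_right, norm_smul, Real.norm_of_nonneg (F.τ_pos i).le,
    @norm_eq_sqrt_real_inner E3, inner_dirQ_self, sqrt_one, mul_one]

lemma dist_foldP_foldQ (h : F.Closes x β) (i : Fin 4) : dist (F.foldP x i) (F.foldQ x i) =
    √(F.ρ i ^ 2 - 2 * F.ρ i * F.τ i * cos (β i) + F.τ i ^ 2) := by
  rw [dist_eq_norm, @norm_eq_sqrt_real_inner E3, foldP, foldQ, add_sub_add_left_eq_sub]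
  congr 1
  simp only [inner_sub_left, inner_sub_right, real_inner_smul_left, real_inner_smul_right,
    inner_dirP_self, inner_dirQ_self, h.eq i, real_inner_comm (F.dirP x i) (F.dirQ x i)]
  ring

/-- All foldings of a pattern that close up with the same angles are isometric. -/
lemma isometric_fold (h : F.Closes x β) (h' : F.Closes y β) : (fold h).Isometric (fold h') where
  base := Congruent.refl _
  side i := by
    rw [fold_side, fold_side, congruent_iff_dist_eq]
    intro j k
    simp only [Function.comp_apply]
    rw [dist_place (F.isFrame_axis x i), dist_place (F.isFrame_axis y i)]
  tri i := by
    have e1 : ∀ i, dist (F.A i) (F.foldP x i) = dist (F.A i) (F.foldP y i) := fun i => by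
      rw [dist_foldP, dist_foldP]
    have e2 : ∀ i, dist (F.A i) (F.foldQ x i) = dist (F.A i) (F.foldQ y i) := fun i => by
      rw [dist_foldQ, dist_foldQ]
    have e3 : ∀ i, dist (F.foldP x i) (F.foldQ x i) = dist (F.foldP y i) (F.foldQ y i) :=
      fun i => by rw [dist_foldP_foldQ h, dist_foldP_foldQ h']
    have e4 : ∀ i, dist (F.foldQ x i) (F.foldP x i) = dist (F.foldQ y i) (F.foldP y i) :=
      fun i => by rw [dist_comm, e3, dist_comm]
    fin_cases i
    exacts [congruent_triple (e1 0) (e2 0) (e3 0), congruent_triple (e2 1) (e1 1) (e4 1),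
      congruent_triple (e1 2) (e2 2) (e3 2), congruent_triple (e2 3) (e1 3) (e4 3)]

/-- The distance between `A (i - 1)` and the end of an edge at `A i` determines the cosine of the
dihedral angle between. -/
lemma hcos_eq_of_congruent (h : F.Closes x β) (h' : F.Closes y β)
    (hc : Congruent (fold h).vertices (fold h').vertices) (i : Fin 4)
    (hδ : sin (interiorAngle F.A i) ≠ 0) : hcos (x i) = hcos (y i) := by
  have hP : ∀ z (hz : F.Closes z β), F.foldP z i =
      (fold hz).vertices ((![1, 2, 1, 2] : Fin 4 → Fin 3) i, i) := fun z hz => by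
    fin_cases i <;> rfl
  have hA : ∀ z (hz : F.Closes z β) j, F.A j = (fold hz).vertices (0, j) := fun z hz j => rfl
  have e := inner_sub_sub_of_congruent hc ((![1, 2, 1, 2] : Fin 4 → Fin 3) i, i) (0, i)
    (0, i - 1) (0, i)
  rw [← hP, ← hP, ← hA, ← hA, ← hA, ← hA] at e
  have key : ∀ z, (inner ℝ (F.foldP z i - F.A i) (F.A (i - 1) - F.A i) : ℝ) =
      F.ρ i * ‖F.A (i - 1) - F.A i‖ * (cos (F.p i) * cos (interiorAngle F.A i) -
        sin (F.p i) * sin (interiorAngle F.A i) * hcos (z i)) := fun z => by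
    have H := F.quad.frame i
    have a7 : (inner ℝ (cross (nDir F.A) (eDir F.A i)) (eDir F.A i) : ℝ) = 0 := by
      rw [real_inner_comm]; simp
    conv_lhs => rw [← norm_smul_unit (F.A (i - 1) - F.A i), F.quad.unit_sub_one_eq, ← eDir, ← nDir,
      foldP, add_sub_cancel_left, dirP, axis, foldDir]
    simp only [inner_add_left, inner_add_right, real_inner_smul_left, real_inner_smul_right,
      H.inner_u, H.inner_nu, H.inner_m, a7, inner_self_cross, inner_self_cross_right]
    ring
  rw [key, key] at e
  have h1 := norm_pos_iff.mpr (sub_ne_zero.mpr (F.quad.ne_sub_one i))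
  have h2 := mul_left_cancel₀ (mul_pos (F.ρ_pos i) h1).ne' e
  have h3 := sin_pos_of_mem_Ioo (F.p_mem i)
  exact mul_left_cancel₀ (mul_ne_zero h3.ne' hδ) (by linarith)

lemma continuous_fold_vertices {X : Type*} [TopologicalSpace X] {f : X → Fin 4 → OnePoint ℝ}
    (hf : Continuous f) (h : ∀ t, F.Closes (f t) β) :
    Continuous fun t => (fold (h t)).vertices := by
  have ha : ∀ i, Continuous fun t => F.axis (f t) i := fun i => by
    have h1 := continuous_hcos.comp ((continuous_apply i).comp hf)
    have h2 := continuous_hsin.comp ((continuous_apply i).comp hf)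
    exact (h1.neg.smul continuous_const).add (h2.smul continuous_const)
  have hP : ∀ i, Continuous fun t => F.foldP (f t) i := fun i => by
    have := ha i
    unfold foldP dirP
    fun_prop
  have hQ : ∀ i, Continuous fun t => F.foldQ (f t) i := fun i => by
    have := ha (i - 1)
    unfold foldQ dirQ
    fun_prop
  refine continuous_pi ?_
  rintro ⟨j, i⟩
  fin_cases j
  · exact continuous_const
  · fin_cases i
    exacts [hP 0, hQ 1, hP 2, hQ 3]
  · fin_cases i
    exacts [hQ 0, hP 1, hQ 2, hP 3]

end FlapPattern

/-! ### The configuration space of a polyhedron -/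

namespace KokotsakisPolyhedron

variable {K : KokotsakisPolyhedron} {p q β δ : Fin 4 → ℝ}

lemma hcos_halfTans (K : KokotsakisPolyhedron) (i : Fin 4) :
    hcos (K.halfTans i) = cos (K.dihedral i) := hcos_halfTan (Complex.arg_mem_Ioc _)

lemma hsin_halfTans (K : KokotsakisPolyhedron) (i : Fin 4) :
    hsin (K.halfTans i) = sin (K.dihedral i) := hsin_halfTan (Complex.arg_mem_Ioc _)

namespace UniformAngles

variable (h : K.UniformAngles p q β δ)

include h

lemma P_eq (i : Fin 4) : K.P i = K.A i + ‖K.P i - K.A i‖ • (cos (p i) • eDir K.A i +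
    sin (p i) • foldDir K.A i (cos (K.dihedral i)) (sin (K.dihedral i))) := by
  rw [← h.angle_p, ← K.unit_P_sub, norm_smul_unit]
  abel

lemma Q_eq (i : Fin 4) : K.Q (i + 1) = K.A (i + 1) + ‖K.Q (i + 1) - K.A (i + 1)‖ •
    (-cos (q (i + 1)) • eDir K.A i +
      sin (q (i + 1)) • foldDir K.A i (cos (K.dihedral i)) (sin (K.dihedral i))) := by
  rw [← h.angle_q, ← K.unit_Q_sub, norm_smul_unit]
  abel

lemma side_eq_place (i : Fin 4) : K.side i =
    place (K.A i) (eDir K.A i) (foldDir K.A i (cos (K.dihedral i)) (sin (K.dihedral i))) ∘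
      flat ‖K.A (i + 1) - K.A i‖ ‖K.P i - K.A i‖ ‖K.Q (i + 1) - K.A (i + 1)‖ (p i)
        (q (i + 1)) := by
  have h2 : K.A (i + 1) = ‖K.A (i + 1) - K.A i‖ • eDir K.A i + K.A i := by
    rw [eDir, norm_smul_unit]; abel
  rw [side_eq]
  funext j
  fin_cases j
  · simp only [Fin.zero_eta, Matrix.cons_val_zero, Function.comp_apply, place_apply, flat,
      zero_smul, add_zero]
    exact h2
  · simp [place_apply, flat]
  · simp only [Fin.reduceFinMk, Matrix.cons_val, Function.comp_apply, place_apply, flat]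
    conv_lhs => rw [h.P_eq i]
    module
  · simp only [Fin.reduceFinMk, Matrix.cons_val, Function.comp_apply, place_apply, flat]
    conv_lhs => rw [h.Q_eq i]
    nth_rw 1 [h2]
    module

/-- The flat pattern of a polyhedron. -/
def pattern (hp : ∀ i, p i ∈ Set.Ioo 0 π) (hq : ∀ i, q i ∈ Set.Ioo 0 π) : FlapPattern where
  A := K.A
  ρ i := ‖K.P i - K.A i‖
  τ i := ‖K.Q i - K.A i‖
  p := p
  q := q
  quad := K.base_quad
  ρ_pos i := norm_pos_iff.mpr (sub_ne_zero.mpr (K.P_ne i))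
  τ_pos i := by
    have := K.Q_ne (i - 1)
    rw [sub_add_cancel] at this
    exact norm_pos_iff.mpr (sub_ne_zero.mpr this)
  p_mem := hp
  q_mem := hq
  simple i := by
    have hs : IsPlanarQuad (K.side i) := K.side_quad i
    rw [h.side_eq_place, isPlanarQuad_place_iff
      (isFrame_foldDir K.base_quad i (cos_sq_add_sin_sq _))] at hs
    exact hs
  area_neg i := by
    have hs : IsPlanarQuad (K.side i) := K.side_quad i
    have hF := isFrame_foldDir K.base_quad i (cos_sq_add_sin_sq (K.dihedral i))
    have e := norm_smul_unit (areaNormal (K.side i))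
    have hn := norm_pos_iff.mpr hs.areaNormal_ne_zero
    rw [K.unit_areaNormal_side, ← neg_eq_iff_eq_neg.mpr (cross_eDir_foldDir K.base_quad i _ _)] at e
    nth_rw 2 [h.side_eq_place] at e
    rw [areaNormal_place, smul_neg, ← neg_smul] at e
    have e2 := smul_left_injective ℝ (cross_frame_ne_zero hF) e
    have e3 : _ = area₂ _ := e2
    rw [← e3]
    linarith

variable (hp : ∀ i, p i ∈ Set.Ioo 0 π) (hq : ∀ i, q i ∈ Set.Ioo 0 π) (hβ : ∀ i, β i ∈ Set.Ioo 0 π)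

include hβ

/-- The dihedral angles of every polyhedron with the same planar angles close up the pattern
of `K`. -/
lemma closes {L : KokotsakisPolyhedron} (hL : L.UniformAngles p q β δ) :
    (h.pattern hp hq).Closes L.halfTans β where
  mem := hβ
  eq i := by
    have e := L.sphCos_eq hL i
    rw [← hcos_halfTans, ← hsin_halfTans, ← hcos_halfTans, ← hsin_halfTans, ← h.base] at e
    rw [FlapPattern.inner_dirP_dirQ]
    exact e

/-- Folding the pattern of `K` by the dihedral angles of `K` gives back `K`. -/
lemma fold_closes : FlapPattern.fold (h.closes hp hq hβ h) = K := by
  apply ext_of_P_Q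
  · rfl
  · rw [FlapPattern.fold_P]
    funext i
    rw [h.P_eq, FlapPattern.foldP, FlapPattern.dirP, FlapPattern.axis, hcos_halfTans,
      hsin_halfTans]
    rfl
  · rw [FlapPattern.fold_Q]
    funext i
    obtain ⟨j, rfl⟩ : ∃ j, i = j + 1 := ⟨i - 1, (sub_add_cancel _ _).symm⟩
    rw [h.Q_eq, FlapPattern.foldQ, FlapPattern.dirQ, FlapPattern.axis, add_sub_cancel_right,
      hcos_halfTans, hsin_halfTans]
    rfl

end UniformAngles

lemma HasPlanarAngles.of_isometric {K L : KokotsakisPolyhedron} {α β γ δ : Fin 4 → ℝ}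
    (h : K.HasPlanarAngles α β γ δ) (hKL : K.Isometric L) : L.HasPlanarAngles α β γ δ := by
  have hs := fun i j => interiorAngle_congr (hKL.side i) j
  refine ⟨fun i => by rw [← interiorAngle_congr hKL.base, h.base], fun i => ?_, ?_, ?_, ?_, ?_, ?_,
    ?_, ?_, ?_⟩
  · have e := EuclideanGeometry.angle_eq_of_congruent (hKL.tri i) 1 0 2
    rw [← h.tri i]
    exact e.symm
  all_goals rw [← hs]
  exacts [h.α₀, h.α₁, h.α₂, h.α₃, h.γ₀, h.γ₁, h.γ₂, h.γ₃]

/-- The points of the configuration space are exactly the ways to close up the flat pattern. -/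
lemma configSpace_eq {K : KokotsakisPolyhedron} {α β γ δ : Fin 4 → ℝ}
    (h : K.HasPlanarAngles α β γ δ) (hp : ∀ i, angP α γ i ∈ Set.Ioo 0 π)
    (hq : ∀ i, angQ α γ i ∈ Set.Ioo 0 π) (hβ : ∀ i, β i ∈ Set.Ioo 0 π) :
    K.configSpace = {e | ((hasPlanarAngles_iff.mp h).pattern hp hq).Closes e β} := by
  ext e
  constructor
  · rintro ⟨L, hL, rfl⟩
    exact (hasPlanarAngles_iff.mp h).closes hp hq hβ (hasPlanarAngles_iff.mp (h.of_isometric hL))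
  · intro he
    refine ⟨FlapPattern.fold he, ?_, FlapPattern.fold_halfTans he⟩
    have := FlapPattern.isometric_fold
      ((hasPlanarAngles_iff.mp h).closes hp hq hβ (hasPlanarAngles_iff.mp h)) he
    rwa [UniformAngles.fold_closes _ hp hq hβ] at this

/-- A path in the configuration space which starts at `K` and along which two dihedral angles are
never both equal to their initial values up to sign makes `K` flexible. -/
lemma isFlexible_of_path {K : KokotsakisPolyhedron} {α β γ δ : Fin 4 → ℝ}
    (h : K.HasPlanarAngles α β γ δ) (hp : ∀ i, angP α γ i ∈ Set.Ioo 0 π)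
    (hq : ∀ i, angQ α γ i ∈ Set.Ioo 0 π) (hβ : ∀ i, β i ∈ Set.Ioo 0 π)
    (hδ : ∀ i, sin (δ i) ≠ 0) {f : unitInterval → Fin 4 → OnePoint ℝ} (hf : Continuous f)
    (hmem : ∀ s, f s ∈ K.configSpace) (h0 : f 0 = K.halfTans)
    (hne : ∀ s, 0 < s → ∃ i, hcos (f s i) ≠ hcos (f 0 i)) : K.IsFlexible := by
  have hu := hasPlanarAngles_iff.mp h
  rw [configSpace_eq h hp hq hβ] at hmem
  have hK : FlapPattern.fold (hmem 0) = K := by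
    have : ∀ x (hx : (hu.pattern hp hq).Closes x β), x = K.halfTans → FlapPattern.fold hx = K := by
      rintro x hx rfl
      exact hu.fold_closes hp hq hβ
    exact this _ _ h0
  refine ⟨fun s => FlapPattern.fold (hmem s), FlapPattern.continuous_fold_vertices hf hmem, hK,
    fun s => ?_, fun s hs hc => ?_⟩
  · nth_rw 1 [← hK]
    exact FlapPattern.isometric_fold _ _
  · obtain ⟨i, hi⟩ := hne s hs
    have hc' := congrArg KokotsakisPolyhedron.vertices hK
    rw [← hc'] at hc
    have hi' : sin (interiorAngle (hu.pattern hp hq).A i) ≠ 0 := by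
      have : interiorAngle K.A i = δ i := hu.base i
      exact fun h0 => hδ i (by rw [← this]; exact h0)
    exact hi (FlapPattern.hcos_eq_of_congruent _ _ hc i hi').symm

end KokotsakisPolyhedron

/-! ### A base quadrilateral with prescribed angles -/

/-- If a closed quadrilateral turns counterclockwise around the origin at every side, then its
opposite sides are disjoint. The contradiction comes from the Plücker relation between the
determinants of four plane vectors. -/
lemma disjoint_segment_of_det₂_pos {a b c d : ℝ × ℝ} (hab : 0 < det₂ a b) (hbc : 0 < det₂ b c)
    (hcd : 0 < det₂ c d) (hda : 0 < det₂ d a) : Disjoint (segment ℝ a b) (segment ℝ c d) := by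
  rw [Set.disjoint_left]
  rintro x ⟨s, t, hs, ht, hst, rfl⟩ ⟨s', t', hs', ht', -, h⟩
  have h1 : s * a.1 + t * b.1 = s' * c.1 + t' * d.1 := by
    have := congrArg Prod.fst h
    simp only [Prod.fst_add, Prod.smul_fst, smul_eq_mul] at this
    linarith
  have h2 : s * a.2 + t * b.2 = s' * c.2 + t' * d.2 := by
    have := congrArg Prod.snd h
    simp only [Prod.snd_add, Prod.smul_snd, smul_eq_mul] at this
    linarith
  have plu : det₂ a b * det₂ c d - det₂ a c * det₂ b d + det₂ a d * det₂ b c = 0 := by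
    unfold det₂; ring
  -- the point is `s a + t b`; compare it with `d` and with `c`
  have e1 : t * det₂ b d - s * det₂ d a = s' * det₂ c d := by
    unfold det₂
    linear_combination d.2 * h1 - d.1 * h2
  have e2 : s * det₂ c a - t * det₂ b c = t' * det₂ c d := by
    unfold det₂
    linear_combination c.1 * h2 - c.2 * h1
  have hca : det₂ a c = -det₂ c a := by unfold det₂; ring
  have had : det₂ a d = -det₂ d a := by unfold det₂; ring
  rw [hca, had] at plu
  have i1 : s * det₂ d a ≤ t * det₂ b d := by nlinarith [mul_nonneg hs' hcd.le]
  have i2 : t * det₂ b c ≤ s * det₂ c a := by nlinarith [mul_nonneg ht' hcd.le]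
  rcases hs.eq_or_lt with rfl | hs0
  · have : t = 1 := by linarith
    subst this
    linarith
  · have t0 : 0 < t := by
      rcases ht.eq_or_lt with rfl | h
      · have := mul_pos hs0 hda
        linarith
      · exact h
    have i3 := mul_le_mul i1 i2 (mul_nonneg ht hbc.le)
      ((mul_nonneg hs hda.le).trans i1)
    have i4 : s * t * (det₂ d a * det₂ b c) ≤ s * t * (det₂ b d * det₂ c a) := by linarith
    have i5 := le_of_mul_le_mul_left i4 (mul_pos hs0 t0)
    nlinarith [mul_pos hab hcd]

/-- There is a planar quadrilateral with prescribed angles `δ i ≠ π` of sum `2π`. It is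
circumscribed about the unit circle: the sides lie on the tangents at the points with angles `θ i`,
and the tangential distances `k i = cot (δ i / 2)` from `A i` may be negative, but their sums over
consecutive vertices are positive. -/
lemma exists_planarQuad {δ : Fin 4 → ℝ} (hpos : ∀ i, 0 < δ i)
    (hsum : δ 0 + δ 1 + δ 2 + δ 3 = 2 * π) (hsin : ∀ i, sin (δ i) ≠ 0) :
    ∃ A, IsPlanarQuad A ∧ ∀ i, interiorAngle A i = δ i := by
  have p0 := hpos 0
  have p1 := hpos 1
  have p2 := hpos 2
  have p3 := hpos 3
  set θ : Fin 4 → ℝ := ![0, π - δ 1, 2 * π - δ 1 - δ 2, 3 * π - δ 1 - δ 2 - δ 3] with hθ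
  have hturn : ∀ i, ∃ m : ℤ, θ (i + 1) = θ i + π - δ (i + 1) + m * (2 * π) := fun i => by
    fin_cases i
    · exact ⟨0, by simp [hθ]⟩
    · exact ⟨0, by simp [hθ]; ring⟩
    · exact ⟨0, by simp [hθ]; ring⟩
    · exact ⟨-1, by simp [hθ]; linarith⟩
  have hcosθ : ∀ i, cos (θ (i + 1)) =
      -(cos (θ i) * cos (δ (i + 1)) + sin (θ i) * sin (δ (i + 1))) := fun i => by
    obtain ⟨m, hm⟩ := hturn i
    rw [hm, cos_add_int_mul_two_pi, add_sub_right_comm, cos_add_pi, cos_sub]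
  have hsinθ : ∀ i, sin (θ (i + 1)) =
      -(sin (θ i) * cos (δ (i + 1)) - cos (θ i) * sin (δ (i + 1))) := fun i => by
    obtain ⟨m, hm⟩ := hturn i
    rw [hm, sin_add_int_mul_two_pi, add_sub_right_comm, sin_add_pi, sin_sub]
  have hlt : ∀ i, δ i < 2 * π := fun i => by fin_cases i <;> simp <;> linarith
  have hlt2 : ∀ i, δ i + δ (i + 1) < 2 * π := fun i => by fin_cases i <;> simp <;> linarith
  have hS : ∀ i, 0 < sin (δ i / 2) := fun i =>
    sin_pos_of_pos_of_lt_pi (by linarith [hpos i]) (by linarith [hlt i])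
  set k : Fin 4 → ℝ := fun i => cos (δ i / 2) / sin (δ i / 2) with hk
  have hdbl : ∀ i, cos (δ i) = 2 * cos (δ i / 2) ^ 2 - 1 ∧
      sin (δ i) = 2 * sin (δ i / 2) * cos (δ i / 2) := fun i => by
    rw [← cos_two_mul, ← sin_two_mul, mul_div_cancel₀ _ two_ne_zero]
    exact ⟨rfl, rfl⟩
  have hk1 : ∀ i, k i * sin (δ i) = 1 + cos (δ i) := fun i => by
    have := (hS i).ne'
    rw [(hdbl i).1, (hdbl i).2]
    simp only [hk]
    field_simp
    ring
  have hk2 : ∀ i, k i * (1 - cos (δ i)) = sin (δ i) := fun i => by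
    have := (hS i).ne'
    have h2 := sin_sq_add_cos_sq (δ i / 2)
    rw [(hdbl i).1, (hdbl i).2]
    simp only [hk]
    field_simp
    linear_combination (-2 * cos (δ i / 2)) * h2
  have hl : ∀ i, 0 < k i + k (i + 1) := fun i => by
    have h1 := hS i
    have h2 := hS (i + 1)
    have e : k i + k (i + 1) = sin (δ i / 2 + δ (i + 1) / 2) /
        (sin (δ i / 2) * sin (δ (i + 1) / 2)) := by
      rw [sin_add]
      simp only [hk]
      field_simp
      ring
    rw [e]
    exact div_pos (sin_pos_of_pos_of_lt_pi (by linarith [hpos i, hpos (i + 1)])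
      (by linarith [hlt2 i])) (by positivity)
  -- the vertex `i` on the tangent number `i`, and on the tangent number `i - 1`
  set x : Fin 4 → ℝ × ℝ := fun i =>
    (cos (θ i) + k i * sin (θ i), sin (θ i) - k i * cos (θ i)) with hx
  have hx' : ∀ i, x (i + 1) = (cos (θ i) - k (i + 1) * sin (θ i),
      sin (θ i) + k (i + 1) * cos (θ i)) := fun i => by
    have e1 := hk1 (i + 1)
    have e2 := hk2 (i + 1)
    simp only [hx]
    rw [hcosθ, hsinθ]
    refine Prod.ext ?_ ?_
    · linear_combination cos (θ i) * e1 + sin (θ i) * e2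
    · linear_combination sin (θ i) * e1 - cos (θ i) * e2
  have hdiff : ∀ i, x (i + 1) - x i =
      ((k i + k (i + 1)) * -sin (θ i), (k i + k (i + 1)) * cos (θ i)) := fun i => by
    rw [hx']
    refine Prod.ext ?_ ?_ <;> simp only [hx, Prod.fst_sub, Prod.snd_sub] <;> ring
  have hdet : ∀ i, det₂ (x i) (x (i + 1)) = k i + k (i + 1) := fun i => by
    rw [hx', det₂]
    simp only [hx]
    linear_combination (k i + k (i + 1)) * sin_sq_add_cos_sq (θ i)
  have hdpos : ∀ i, 0 < det₂ (x i) (x (i + 1)) := fun i => (hdet i).symm ▸ hl i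
  have hsimple : IsSimpleQuad x := by
    refine ⟨fun i => ?_, disjoint_segment_of_det₂_pos (hdpos 0) (hdpos 1) (hdpos 2) (hdpos 3),
      disjoint_segment_of_det₂_pos (hdpos 1) (hdpos 2) (hdpos 3) (hdpos 0)⟩
    have e1 := hdiff i
    have e2 := hdiff (i + 1)
    have e3 : x (i + 2) - x i = (x (i + 1 + 1) - x (i + 1)) + (x (i + 1) - x i) := by
      rw [sub_add_sub_cancel, add_assoc]; rfl
    have e4 : det₂ (x (i + 1) - x i) (x (i + 2) - x i) =
        (k i + k (i + 1)) * (k (i + 1) + k (i + 1 + 1)) * sin (δ (i + 1)) := by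
      rw [e3, e2, e1, det₂, Prod.fst_add, Prod.snd_add, hcosθ, hsinθ]
      linear_combination (k i + k (i + 1)) * (k (i + 1) + k (i + 1 + 1)) * sin (δ (i + 1)) *
        sin_sq_add_cos_sq (θ i)
    rw [e4]
    exact mul_ne_zero (mul_pos (hl _) (hl _)).ne' (hsin _)
  have harea : 0 < area₂ x := by
    have : area₂ x = det₂ (x 0) (x 1) + det₂ (x 1) (x 2) + det₂ (x 2) (x 3) + det₂ (x 3) (x 0) := by
      simp only [area₂, det₂, Prod.fst_sub, Prod.snd_sub]; ring
    rw [this]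
    have h0 : 0 < det₂ (x 0) (x 1) := hdpos 0
    have h1 : 0 < det₂ (x 1) (x 2) := hdpos 1
    have h2 : 0 < det₂ (x 2) (x 3) := hdpos 2
    have h3 : 0 < det₂ (x 3) (x 0) := hdpos 3
    positivity
  have hF : IsFrame (EuclideanSpace.single 0 1 : E3) (EuclideanSpace.single 1 1) :=
    ⟨by simp, by simp, by rw [inner_eq_sum]; simp⟩
  refine ⟨place 0 _ _ ∘ x, (isPlanarQuad_place_iff hF).mpr hsimple, fun i => ?_⟩
  obtain ⟨j, rfl⟩ : ∃ j, i = j + 1 := ⟨i - 1, (sub_add_cancel _ _).symm⟩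
  refine interiorAngle_place hF hsimple (ω := 1) (l := k (j + 1) + k (j + 1 + 1))
    (c := -sin (θ (j + 1))) (s := cos (θ (j + 1))) (l' := k j + k (j + 1)) (c' := sin (θ j))
    (s' := -cos (θ j)) ?_ (hl _) (hl _) (hdiff _) ?_ (by rw [neg_sq, sin_sq_add_cos_sq])
    (by rw [neg_sq, sin_sq_add_cos_sq]) ⟨(hpos _).le, hlt _⟩ ?_ ?_
  · rw [areaNormal_place, unit_smul_of_pos harea, one_smul, unit, norm_cross_frame hF, inv_one,
      one_smul]
  · rw [add_sub_cancel_right, ← neg_sub, hdiff]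
    refine Prod.ext ?_ ?_ <;> simp
  · rw [hcosθ, hsinθ]
    linear_combination cos (δ (j + 1)) * sin_sq_add_cos_sq (θ j)
  · rw [hcosθ, hsinθ]
    linear_combination sin (δ (j + 1)) * sin_sq_add_cos_sq (θ j)

/-! ### Side faces with prescribed angles -/

/-- A trapezoid of height `h` with prescribed angles at its base of length `l`. -/
lemma isSimpleQuad_trapezoid {l p q h : ℝ} (hp : p ∈ Set.Ioo 0 π)
    (hq : q ∈ Set.Ioo 0 π) (hl : 0 < l) (hh : 0 < h)
    (hlt : h * (cos p / sin p + cos q / sin q) < l) :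
    IsSimpleQuad (flat l (h / sin p) (h / sin q) p q) ∧
      area₂ (flat l (h / sin p) (h / sin q) p q) < 0 := by
  have sp := sin_pos_of_mem_Ioo hp
  have sq := sin_pos_of_mem_Ioo hq
  obtain ⟨a, b, hab, e⟩ : ∃ a b : ℝ, a < b ∧
      flat l (h / sin p) (h / sin q) p q = ![(l, 0), (0, 0), (a, h), (b, h)] := by
    refine ⟨h * (cos p / sin p), l - h * (cos q / sin q), by linarith, ?_⟩
    rw [flat]
    congr! 4 <;> field_simp
  rw [e]
  refine ⟨⟨fun i => ?_, ?_, ?_⟩, ?_⟩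
  · have h1 : h * (b - a) ≠ 0 := mul_ne_zero hh.ne' (by linarith)
    have h2 : h * l ≠ 0 := mul_ne_zero hh.ne' hl.ne'
    fin_cases i <;> simp [det₂]
    · exact ⟨hl.ne', hh.ne'⟩
    · exact fun h0 => h1 (by linarith)
    · exact ⟨by linarith, hh.ne'⟩
    · exact fun h0 => h2 (by linarith)
  · rw [Set.disjoint_left]
    rintro _ ⟨s, t, hs, ht, hst, rfl⟩ ⟨s', t', hs', ht', hst', hx⟩
    have := congrArg Prod.snd hx
    simp at this
    rw [← add_mul, hst', one_mul] at this
    exact hh.ne' this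
  · rw [Set.disjoint_left]
    rintro _ ⟨s, t, hs, ht, hst, rfl⟩ ⟨s', t', hs', ht', hst', hx⟩
    have h1 := congrArg Prod.fst hx
    have h2 := congrArg Prod.snd hx
    simp at h1 h2
    have h3 := h2.resolve_right hh.ne'
    subst h3
    have h4 : t' * l = s' * (a - b) := by linarith
    have h5 : s' * (a - b) ≤ 0 := mul_nonpos_of_nonneg_of_nonpos ht (by linarith)
    have h6 : t' = 0 := by
      by_contra h0
      have := mul_pos (lt_of_le_of_ne ht' (Ne.symm h0)) hl
      linarith
    rw [h6, zero_mul, eq_comm, mul_eq_zero] at h4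
    rcases h4 with h4 | h4 <;> linarith
  · simp [area₂, det₂]
    nlinarith

/-- Trapezoids of a sufficiently small height can be attached to all sides of the base. -/
lemma exists_flapPattern {A : Fin 4 → E3} (hA : IsPlanarQuad A) {p q : Fin 4 → ℝ}
    (hp : ∀ i, p i ∈ Set.Ioo 0 π) (hq : ∀ i, q i ∈ Set.Ioo 0 π) :
    ∃ F : FlapPattern, F.A = A ∧ F.p = p ∧ F.q = q := by
  obtain ⟨h, hlt, hh⟩ : ∃ h : ℝ, (∀ i, h * (cos (p i) / sin (p i) + cos (q (i + 1)) /
      sin (q (i + 1))) < ‖A (i + 1) - A i‖) ∧ 0 < h := by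
    have ev : ∀ᶠ h : ℝ in nhdsWithin 0 (Set.Ioi 0), ∀ i, h * (cos (p i) / sin (p i) +
        cos (q (i + 1)) / sin (q (i + 1))) < ‖A (i + 1) - A i‖ := by
      rw [Filter.eventually_all]
      intro i
      apply Filter.Eventually.filter_mono nhdsWithin_le_nhds
      have hc : Continuous fun h : ℝ => h * (cos (p i) / sin (p i) + cos (q (i + 1)) /
        sin (q (i + 1))) := continuous_id.mul continuous_const
      exact hc.continuousAt.eventually_lt continuousAt_const (by
        rw [zero_mul]; exact norm_pos_iff.mpr (sub_ne_zero.mpr (hA.ne i)))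
    obtain ⟨h, h1, h2⟩ := (ev.and self_mem_nhdsWithin).exists
    exact ⟨h, h1, h2⟩
  have ht := fun i => isSimpleQuad_trapezoid (hp i) (hq (i + 1))
    (norm_pos_iff.mpr (sub_ne_zero.mpr (hA.ne i))) hh (hlt i)
  exact ⟨⟨A, fun i => h / sin (p i), fun i => h / sin (q i), p, q, hA,
    fun i => div_pos hh (sin_pos_of_mem_Ioo (hp i)),
    fun i => div_pos hh (sin_pos_of_mem_Ioo (hq i)), hp, hq, fun i => (ht i).1,
    fun i => (ht i).2⟩, rfl, rfl, rfl⟩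

/-! ### Choosing the enumeration -/

/-- Some cyclic shift produces the signs `+ + - -`. Here `ρ i` is positive exactly if `a i`
and `a (i - 1)` have opposite signs, and it exceeds `16` if moreover `a i` is the negative one of
the two. If no `ρ i` exceeded `16`, then all of them would be positive, the signs of `a` would
alternate, and some `ρ i` would exceed `16` after all. -/
lemma exists_shift {a ρ : Fin 4 → ℝ} (hρ : ∀ i, 0 < -(a i * a (i - 1)) * ρ i)
    (hbig : ∀ i, a i < 0 → 0 < a (i - 1) → 16 < ρ i) (h2 : ∀ i, ρ (i + 2) = ρ i)
    (hsum : ∀ i, ρ i + ρ (i + 1) = 16) :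
    ∃ k, 0 < a k ∧ 0 < a (k + 1) ∧ a (k + 2) < 0 ∧ a (k + 3) < 0 ∧ 16 < ρ k := by
  have hpos : ∀ i, 0 < ρ i → a i * a (i - 1) < 0 := fun i h => by
    have := (pos_iff_pos_of_mul_pos (hρ i)).mpr h
    linarith
  have hneg : ∀ i, ρ i < 0 → 0 < a i * a (i - 1) := fun i h => by
    have := (neg_iff_neg_of_mul_pos (hρ i)).mpr h
    linarith
  have hne : ∀ i, ρ i ≠ 0 := fun i h => by simpa [h] using hρ i
  -- it suffices to find a vertex with `16 < ρ i`; the same holds at the opposite one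
  suffices ∃ i, 16 < ρ i by
    obtain ⟨i, hi⟩ := this
    have hi1 : ρ (i + 1) < 0 := by linarith [hsum i]
    have hi2 : 16 < ρ (i + 2) := by rw [h2]; exact hi
    have hi3 : ρ (i + 3) < 0 := by
      have : i + 3 = i + 1 + 2 := by rw [add_assoc]; rfl
      rw [this, h2]; exact hi1
    have q1 := hneg (i + 1) hi1
    have q2 := hpos (i + 2) (by linarith)
    have q3 := hneg (i + 3) hi3
    have e1 : i + 1 - 1 = i := add_sub_cancel_right _ _
    have e2 : i + 2 - 1 = i + 1 := by rw [add_sub_assoc]; rfl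
    have e3 : i + 3 - 1 = i + 2 := by rw [add_sub_assoc]; rfl
    rw [e1] at q1
    rw [e2] at q2
    rw [e3] at q3
    rcases lt_or_ge (a i) 0 with hs | hs
    · have r1 : a (i + 1) < 0 := by
        by_contra! h
        nlinarith
      have r2 : 0 < a (i + 2) := by
        by_contra! h
        nlinarith
      have r3 : 0 < a (i + 3) := by
        by_contra! h
        nlinarith
      have f1 : i + 2 + 1 = i + 3 := by rw [add_assoc]; rfl
      have f2 : i + 2 + 2 = i := by rw [add_assoc]; exact add_zero i
      have f3 : i + 2 + 3 = i + 1 := by rw [add_assoc]; rfl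
      exact ⟨i + 2, r2, by rwa [f1], by rwa [f2], by rwa [f3], hi2⟩
    · have r0 : 0 < a i := hs.lt_of_ne fun h => by simp [← h] at q1
      have r1 : 0 < a (i + 1) := by
        by_contra! h
        nlinarith
      have r2 : a (i + 2) < 0 := by
        by_contra! h
        nlinarith
      have r3 : a (i + 3) < 0 := by
        by_contra! h
        nlinarith
      exact ⟨i, r0, r1, r2, r3, hi⟩
  by_contra! hle
  have p : ∀ i, 0 < ρ i := fun i =>
    lt_of_le_of_ne (by linarith [hsum i, hle (i + 1)]) (hne i).symm
  have q0 := hpos 0 (p 0)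
  have q1 := hpos 1 (p 1)
  have e0 : (0 : Fin 4) - 1 = 3 := rfl
  have e1 : (1 : Fin 4) - 1 = 0 := rfl
  rw [e0] at q0
  rw [e1] at q1
  rcases lt_or_ge (a 0) 0 with hs | hs
  · have : 0 < a 3 := by
      by_contra! h
      nlinarith
    linarith [hbig 0 hs (by rwa [e0]), hle 0]
  · have r0 : 0 < a 0 := hs.lt_of_ne fun h => by simp [← h] at q0
    have : a 1 < 0 := by
      by_contra! h
      nlinarith
    linarith [hbig 1 this (by rwa [e1]), hle 1]

/-- Recovers `|ν|` from `ν ^ 2 / (x y) = 16 z ^ 2`. -/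
lemma abs_eq_of_sq_eq {ν x y z : ℝ} (hx : 0 ≤ x) (hy : 0 ≤ y) (hz : 0 ≤ z)
    (h : ν ^ 2 = 16 * (x * y) * z ^ 2) : |ν| = 4 * (√x * √y) * z := by
  rw [← sq_eq_sq₀ (abs_nonneg _) (by positivity), sq_abs, h, mul_pow, mul_pow, mul_pow,
    sq_sqrt hx, sq_sqrt hy]
  ring

lemma shiftLam_zero (lam mu : Fin 4 → ℝ) (k : Fin 4) :
    shiftLam lam mu k 0 = angP lam mu k := by
  fin_cases k <;> simp [shiftLam, angP, show ¬ Even 3 by decide]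

lemma shiftLam_two (lam mu : Fin 4 → ℝ) (k : Fin 4) :
    shiftLam lam mu k 2 = angP lam mu (k + 2) := by
  fin_cases k <;> simp [shiftLam, angP, show ¬ Even 3 by decide]

lemma shiftMu_zero (lam mu : Fin 4 → ℝ) (k : Fin 4) :
    shiftMu lam mu k 0 = angQ lam mu k := by
  fin_cases k <;> simp [shiftMu, angQ, show ¬ Even 3 by decide]

lemma shiftMu_two (lam mu : Fin 4 → ℝ) (k : Fin 4) :
    shiftMu lam mu k 2 = angQ lam mu (k + 2) := by
  fin_cases k <;> simp [shiftMu, angQ, show ¬ Even 3 by decide]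

lemma nuOf_eq (δ lam mu : Fin 4 → ℝ) (i : Fin 4) : nuOf δ lam mu i =
    (angP lam mu i - 1) * (angQ lam mu i - 1) / cos (δ i) := by
  fin_cases i
  exacts [rfl, by rw [mul_comm]; rfl, rfl, by rw [mul_comm]; rfl]

lemma lam_mul_mu (lam mu : Fin 4 → ℝ) (i : Fin 4) : lam i * mu i = angP lam mu i * angQ lam mu i := by
  fin_cases i
  exacts [rfl, mul_comm _ _, rfl, mul_comm _ _]

namespace GeometricAssumptions

variable {δ lam mu α β γ : Fin 4 → ℝ} (H : GeometricAssumptions δ lam mu α β γ)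

include H

lemma angP_mem (i : Fin 4) : angP α γ i ∈ Set.Ioo 0 π := by
  fin_cases i
  exacts [H.α_mem 0, H.γ_mem 1, H.α_mem 2, H.γ_mem 3]

lemma angQ_mem (i : Fin 4) : angQ α γ i ∈ Set.Ioo 0 π := by
  fin_cases i
  exacts [H.γ_mem 0, H.α_mem 1, H.γ_mem 2, H.α_mem 3]

lemma cos_angP (i : Fin 4) : cos (angP α γ i) ≠ 0 := by
  fin_cases i
  exacts [H.cos_α 0, H.cos_γ 1, H.cos_α 2, H.cos_γ 3]

lemma cos_angQ (i : Fin 4) : cos (angQ α γ i) ≠ 0 := by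
  fin_cases i
  exacts [H.cos_γ 0, H.cos_α 1, H.cos_γ 2, H.cos_α 3]

lemma tan_angP (i : Fin 4) : tan (angP α γ i) =
    (angP lam mu i - 1) / (angP lam mu i + 1) * tan (δ i) := by
  fin_cases i
  exacts [H.tan_α 0, H.tan_γ 1, H.tan_α 2, H.tan_γ 3]

lemma tan_angQ (i : Fin 4) : tan (angQ α γ i) =
    (angQ lam mu i - 1) / (angQ lam mu i + 1) * tan (δ i) := by
  fin_cases i
  exacts [H.tan_γ 0, H.tan_α 1, H.tan_γ 2, H.tan_α 3]

lemma cos_β_eq (i : Fin 4) : cos (β i) = cos (angP α γ i) * cos (angQ α γ i) / cos (δ i) := by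
  fin_cases i
  exacts [H.cos_β 0, (H.cos_β 1).trans (by rw [mul_comm]; rfl), H.cos_β 2,
    (H.cos_β 3).trans (by rw [mul_comm]; rfl)]

lemma angP_add_one (i : Fin 4) : angP lam mu i + 1 ≠ 0 := by
  fin_cases i
  exacts [H.lam_add_one 0, H.mu_add_one 1, H.lam_add_one 2, H.mu_add_one 3]

lemma angQ_add_one (i : Fin 4) : angQ lam mu i + 1 ≠ 0 := by
  fin_cases i
  exacts [H.mu_add_one 0, H.lam_add_one 1, H.mu_add_one 2, H.lam_add_one 3]

lemma angP_ne (i : Fin 4) : angP lam mu i ≠ 0 := by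
  fin_cases i
  exacts [H.lam_ne 0, H.mu_ne 1, H.lam_ne 2, H.mu_ne 3]

/-- The two involution factors at a base edge are opposite. -/
lemma angQ_eq (i : Fin 4) : angQ lam mu i = -angP lam mu (i - 1) := by
  fin_cases i
  · exact H.mu_opp₁
  · exact (neg_eq_iff_eq_neg.mpr H.lam_opp₁).symm
  · exact (neg_eq_iff_eq_neg.mpr H.mu_opp₂).symm
  · exact (neg_eq_iff_eq_neg.mpr H.lam_opp₂).symm

lemma sin_δ_ne (i : Fin 4) : sin (δ i) ≠ 0 := fun h => by
  have h1 := H.tan_α i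
  have h2 := (sin_pos_of_mem_Ioo (H.α_mem i)).ne'
  rw [tan_eq_sin_div_cos (δ i), h, zero_div, mul_zero, tan_eq_sin_div_cos, div_eq_zero_iff] at h1
  exact h1.elim h2 (H.cos_α i)

lemma nuOf_ne (i : Fin 4) : nuOf δ lam mu i ≠ 0 := by
  have h1 : lam i - 1 ≠ 0 := fun h => by
    have h1 := H.tan_α i
    rw [h, zero_div, zero_mul, tan_eq_sin_div_cos, div_eq_zero_iff] at h1
    exact h1.elim (sin_pos_of_mem_Ioo (H.α_mem i)).ne' (H.cos_α i)
  have h2 : mu i - 1 ≠ 0 := fun h => by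
    have h1 := H.tan_γ i
    rw [h, zero_div, zero_mul, tan_eq_sin_div_cos, div_eq_zero_iff] at h1
    exact h1.elim (sin_pos_of_mem_Ioo (H.γ_mem i)).ne' (H.cos_γ i)
  exact div_ne_zero (mul_ne_zero h1 h2) (H.δ_not_right i)

/-- At a vertex with two negative involution factors, `ν² > 16 λ μ`: for negative `λ ≠ -1`
one has `(λ - 1)² > 4 |λ|`. -/
lemma lt_nuOf_sq {i : Fin 4} (h1 : angP lam mu i < 0) (h2 : angQ lam mu i < 0) :
    16 < nuOf δ lam mu i ^ 2 / (angP lam mu i * angQ lam mu i) := by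
  rw [lt_div_iff₀ (mul_pos_of_neg_of_neg h1 h2), nuOf_eq]
  have n1 := H.angP_add_one i
  have n2 := H.angQ_add_one i
  have hδ := H.δ_not_right i
  generalize angP lam mu i = a at *
  generalize angQ lam mu i = b at *
  have ha : -(4 * a) < (a - 1) ^ 2 := by
    have : 0 < (a + 1) ^ 2 := by positivity
    linarith
  have hb : -(4 * b) < (b - 1) ^ 2 := by
    have : 0 < (b + 1) ^ 2 := by positivity
    linarith
  have hab : 16 * (a * b) < ((a - 1) * (b - 1)) ^ 2 := by
    rw [mul_pow]
    have := mul_lt_mul'' ha hb (by linarith) (by linarith)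
    linarith
  rw [div_pow]
  refine hab.trans_le (le_div_self (sq_nonneg _) (by positivity) (cos_sq_le_one _))

/-- The enumeration in which the equations have their normal form. -/
lemma exists_normalForm : ∃ k, NormalForm (shiftLam lam mu k) (shiftMu lam mu k)
    (fun i => nuOf δ lam mu (i + k)) := by
  set a := angP lam mu with ha
  have hb := H.angQ_eq
  set ρ : Fin 4 → ℝ := fun i => nuOf δ lam mu i ^ 2 / (lam i * mu i) with hρ
  have hρ' : ∀ i, ρ i = nuOf δ lam mu i ^ 2 / (a i * -a (i - 1)) := fun i => by
    simp only [hρ]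
    rw [lam_mul_mu, hb]
  have hsq : ∀ i, nuOf δ lam mu i ^ 2 = -(a i * a (i - 1)) * ρ i := fun i => by
    have h1 := H.angP_ne i
    have h2 := H.angP_ne (i - 1)
    rw [← ha] at h1 h2
    rw [hρ']
    field_simp
  have hper : ∀ i, ρ (i + 2) = ρ i := fun i => by
    fin_cases i
    exacts [H.prop₁.symm, H.prop₂.symm, H.prop₁, H.prop₂]
  have hsum : ∀ i, ρ i + ρ (i + 1) = 16 := fun i => by
    have h : ρ 0 + ρ 1 = 16 := H.prop₃
    have h2 : ρ 2 = ρ 0 := hper 0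
    have h3 : ρ 3 = ρ 1 := hper 1
    fin_cases i
    · exact h
    · change ρ 1 + ρ 2 = 16
      linarith
    · change ρ 2 + ρ 3 = 16
      linarith
    · change ρ 3 + ρ 0 = 16
      linarith
  obtain ⟨k, k0, k1, k2, k3, hk⟩ := exists_shift (a := a) (ρ := ρ)
    (fun i => by rw [← hsq]; have := H.nuOf_ne i; positivity)
    (fun i h1 h2 => by
      have h3 : angQ lam mu i < 0 := by rw [hb]; linarith
      have := H.lt_nuOf_sq h1 h3
      rwa [hb, ← hρ'] at this)
    hper hsum
  refine ⟨k, ?_⟩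
  have hk2 := hper k
  have hk1 : ρ (k + 1) = 16 - ρ k := by linarith [hsum k]
  have hk3 : ρ (k + 3) = 16 - ρ k := by
    have : k + 3 = k + 1 + 2 := by rw [add_assoc]; rfl
    rw [this, hper, hk1]
  have e0 : k - 1 = k + 3 := by rw [sub_eq_add_neg]; rfl
  have e1 : k + 1 - 1 = k := add_sub_cancel_right _ _
  have e2 : k + 2 - 1 = k + 1 := by rw [add_sub_assoc]; rfl
  have e3 : k + 3 - 1 = k + 2 := by rw [add_sub_assoc]; rfl
  have s0 := hsq k
  have s1 := hsq (k + 1)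
  have s2 := hsq (k + 2)
  have s3 := hsq (k + 3)
  rw [e0] at s0
  rw [e1, hk1] at s1
  rw [e2, hk2] at s2
  rw [e3, hk3] at s3
  have l0 := shiftLam_zero lam mu k
  have l2 := shiftLam_two lam mu k
  have m0 := shiftMu_zero lam mu k
  have m2 := shiftMu_two lam mu k
  rw [hb, ← ha, e0] at m0
  rw [hb, ← ha, e2] at m2
  rw [← ha] at l0 l2
  have hζ : zetaOne (shiftLam lam mu k) (shiftMu lam mu k) (fun i => nuOf δ lam mu (i + k)) ^ 2 =
      ρ k / 16 := by
    rw [zetaOne, l0, m0, zero_add, div_pow, sq_abs, mul_pow, sq_sqrt (by nlinarith), s0]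
    have := k3.ne
    field_simp
    ring
  have hζ0 : 0 ≤ zetaOne (shiftLam lam mu k) (shiftMu lam mu k)
      (fun i => nuOf δ lam mu (i + k)) := by
    rw [zetaOne]; positivity
  have hζ1 : 1 < zetaOne (shiftLam lam mu k) (shiftMu lam mu k)
      (fun i => nuOf δ lam mu (i + k)) := by
    by_contra! h
    nlinarith
  refine ⟨by rwa [l0], by rw [m0]; linarith, by rwa [l2], by rw [m2]; linarith, hζ1, ?_, ?_, ?_⟩
  · refine abs_eq_of_sq_eq (by rw [m2]; linarith) (by rw [l0]; linarith) (sqrt_nonneg _) ?_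
    rw [sq_sqrt_sq_sub_one hζ1, hζ, m2, l0, add_comm, s1]
    ring
  · refine abs_eq_of_sq_eq (by rw [l2]; linarith) (by rw [m2]; linarith) hζ0 ?_
    rw [hζ, m2, l2, add_comm, s2]
    ring
  · refine abs_eq_of_sq_eq (by rw [m0]; linarith) (by rw [l2]; linarith) (sqrt_nonneg _) ?_
    rw [sq_sqrt_sq_sub_one hζ1, hζ, m0, l2, add_comm, s3]
    ring

end GeometricAssumptions

/-! ### Polyhedra and branches -/

namespace GeometricAssumptions

variable {δ lam mu α β γ : Fin 4 → ℝ} (H : GeometricAssumptions δ lam mu α β γ)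

include H

/-- A pattern with the prescribed angles closes up if and only if the half-tangents satisfy the
coupled equations at all four vertices of the base. -/
lemma closes_iff {F : FlapPattern} (hp : F.p = angP α γ) (hq : F.q = angQ α γ)
    (hA : ∀ i, interiorAngle F.A i = δ i) (e : Fin 4 → OnePoint ℝ) :
    F.Closes e β ↔ ∀ i, Coupled (angP lam mu i) (angQ lam mu i) (nuOf δ lam mu i)
      (e i) (e (i - 1)) := by
  have key : ∀ i, (inner ℝ (F.dirP e i) (F.dirQ e i) : ℝ) = cos (β i) ↔
      Coupled (angP lam mu i) (angQ lam mu i) (nuOf δ lam mu i) (e i) (e (i - 1)) := fun i => by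
    rw [F.inner_dirP_dirQ, hp, hq, hA,
      sphCos_eq_iff (sin_pos_of_mem_Ioo (H.angP_mem i)).ne' (H.cos_angP i) (H.cos_angQ i)
        (H.δ_not_right i) (H.angP_add_one i) (H.angQ_add_one i) (H.tan_angP i) (H.tan_angQ i)
        (H.cos_β_eq i), Coupled, nuOf_eq]
  exact ⟨fun h i => (key i).mp (h.eq i), fun h => ⟨H.β_mem, fun i => (key i).mpr (h i)⟩⟩

/-- The solutions of the coupled equations, read in the enumeration shifted by `k`, are the points of
the branches. -/
lemma coupled_iff_exists_branch {k : Fin 4} (hN : NormalForm (shiftLam lam mu k)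
    (shiftMu lam mu k) (fun i => nuOf δ lam mu (i + k))) (e : Fin 4 → OnePoint ℝ) :
    (∀ i, Coupled (angP lam mu i) (angQ lam mu i) (nuOf δ lam mu i) (e i) (e (i - 1))) ↔
      ∃ η ε : ℤˣ, ∃ t ∈ Set.Ico 0 (2 * π), ∀ j, e (j + k) = branch (shiftLam lam mu k)
        (shiftMu lam mu k) (fun i => nuOf δ lam mu (i + k)) η ε t j := by
  have e0 : k - 1 = 3 + k := by rw [sub_eq_add_neg, add_comm]; rfl
  have e1 : 1 + k - 1 = k := add_sub_cancel_left _ _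
  have e2 : 2 + k - 1 = 1 + k := by rw [add_comm, add_sub_assoc, add_comm]; rfl
  have e3 : 3 + k - 1 = 2 + k := by rw [add_comm, add_sub_assoc, add_comm]; rfl
  have b := H.angQ_eq
  have b0 := b (2 + k)
  have b1 := b (1 + k)
  have b2 := b (3 + k)
  have b3 := b k
  rw [e2] at b0
  rw [e1] at b1
  rw [e3] at b2
  rw [e0] at b3
  have l0 := shiftLam_zero lam mu k
  have l2 := shiftLam_two lam mu k
  have m0 := shiftMu_zero lam mu k
  have m2 := shiftMu_two lam mu k
  rw [add_comm] at l2 m2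
  have h := hN.coupled_iff_exists_branch fun j => e (j + k)
  simp only [l0, l2, m0, m2, zero_add] at h
  rw [← b1, ← b2, b0, b3, neg_neg, neg_neg, ← b0, ← b3] at h
  rw [← h]
  constructor
  · intro hc
    have c0 := hc k
    have c1 := hc (1 + k)
    have c2 := hc (2 + k)
    have c3 := hc (3 + k)
    rw [e0] at c0
    rw [e1] at c1
    rw [e2] at c2
    rw [e3] at c3
    exact ⟨c0, c1, c2, c3⟩
  · rintro ⟨c0, c1, c2, c3⟩ i
    obtain ⟨j, rfl⟩ : ∃ j, i = j + k := ⟨i - k, (sub_add_cancel _ _).symm⟩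
    fin_cases j
    · simp only [Fin.zero_eta, zero_add, e0]
      exact c0
    · simp only [Fin.mk_one, e1]
      exact c1
    · simp only [Fin.reduceFinMk, e2]
      exact c2
    · simp only [Fin.reduceFinMk, e3]
      exact c3

/-- Any point of any branch, here that of parameter `0`, folds a pattern with the prescribed angles
into a polyhedron. -/
lemma exists_polyhedron : ∃ K : KokotsakisPolyhedron, K.HasPlanarAngles α β γ δ := by
  obtain ⟨k, hN⟩ := H.exists_normalForm
  obtain ⟨A, hA, hAδ⟩ := exists_planarQuad H.δ_pos H.δ_sum H.sin_δ_ne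
  obtain ⟨F, rfl, hp, hq⟩ := exists_flapPattern hA H.angP_mem H.angQ_mem
  have hc := (H.closes_iff hp hq hAδ _).mpr ((H.coupled_iff_exists_branch hN
    fun i => branch (shiftLam lam mu k) (shiftMu lam mu k) (fun i => nuOf δ lam mu (i + k)) 1 1 0
      (i - k)).mpr ⟨1, 1, 0, ⟨le_rfl, two_pi_pos⟩, fun j => by rw [add_sub_cancel_right]⟩)
  refine ⟨FlapPattern.fold hc, KokotsakisPolyhedron.hasPlanarAngles_iff.mpr ?_⟩
  have := FlapPattern.fold_uniformAngles hc
  rwa [hp, hq, funext hAδ] at this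

lemma configSpace_eq_branches {k : Fin 4} (hN : NormalForm (shiftLam lam mu k)
    (shiftMu lam mu k) (fun i => nuOf δ lam mu (i + k))) {K : KokotsakisPolyhedron}
    (hK : K.HasPlanarAngles α β γ δ) :
    K.configSpace = {e | ∃ η ε : ℤˣ, ∃ t ∈ Set.Ico 0 (2 * π), ∀ j, e (j + k) =
      branch (shiftLam lam mu k) (shiftMu lam mu k) (fun i => nuOf δ lam mu (i + k)) η ε t j} := by
  rw [KokotsakisPolyhedron.configSpace_eq hK H.angP_mem H.angQ_mem H.β_mem]
  ext e
  rw [Set.mem_ofPred_eq, Set.mem_ofPred_eq, ← H.coupled_iff_exists_branch hN e]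
  exact H.closes_iff
    (F := (KokotsakisPolyhedron.hasPlanarAngles_iff.mp hK).pattern H.angP_mem H.angQ_mem)
    rfl rfl hK.base e

/-- Moving the parameter of the branch through `K` by less than a full period changes one of the
cosines of the dihedral angles at two adjacent base edges. -/
lemma isFlexible {K : KokotsakisPolyhedron} (hK : K.HasPlanarAngles α β γ δ) : K.IsFlexible := by
  obtain ⟨k, hN⟩ := H.exists_normalForm
  have hcs := H.configSpace_eq_branches hN hK
  have hself : K.halfTans ∈ K.configSpace :=
    ⟨K, ⟨Congruent.refl _, fun _ => Congruent.refl _, fun _ => Congruent.refl _⟩, rfl⟩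
  rw [hcs] at hself
  obtain ⟨η, ε, t₀, -, ht₀⟩ := hself
  refine KokotsakisPolyhedron.isFlexible_of_path hK H.angP_mem H.angQ_mem H.β_mem H.sin_δ_ne
    (f := fun s i => branch (shiftLam lam mu k) (shiftMu lam mu k)
      (fun i => nuOf δ lam mu (i + k)) η ε (t₀ + s) (i - k)) ?_ ?_ ?_ ?_
  · refine continuous_pi fun i => (continuous_apply (i - k)).comp ((hN.continuous_branch η ε).comp ?_)
    fun_prop
  · intro s
    rw [hcs]
    obtain ⟨t, ht, hb⟩ := (hN.periodic_branch η ε).exists_mem_Ico₀ two_pi_pos (t₀ + s)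
    exact ⟨η, ε, t, ht, fun j => by simp only [add_sub_cancel_right, hb]⟩
  · funext i
    have := ht₀ (i - k)
    rw [sub_add_cancel] at this
    simp [this]
  · intro s hs
    by_contra! hcon
    have h0 := hcon (0 + k)
    have h3 := hcon (3 + k)
    simp only [add_sub_cancel_right] at h0 h3
    obtain ⟨hX, hY⟩ := hN.curve_eq_of_hcos_branch_eq h0 h3
    obtain ⟨hc, hsn⟩ := cos_sin_eq_of_curve_eq hN.one_lt_zeta hX hY
    have hs0 : (0 : ℝ) < s := hs
    have hs1 : (s : ℝ) ≤ 1 := s.2.2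
    have h1 : cos (s : ℝ) = 1 := by
      have e : (s : ℝ) = (t₀ + s) - (t₀ + (0 : unitInterval)) := by simp
      rw [e, cos_sub, hc, hsn, ← sq, ← sq, cos_sq_add_sin_sq]
    have hpi := pi_gt_three
    rw [cos_eq_one_iff_of_lt_of_lt (by linarith) (by linarith)] at h1
    exact hs0.ne' h1

end GeometricAssumptions

end Kokotsakis

end

theorem mainTheorem3 (δ lam mu α β γ : Fin 4 → ℝ)
    (hyp : Kokotsakis.GeometricAssumptions δ lam mu α β γ) :
    -- a polyhedron with these planar angles exists
    (∃ K : Kokotsakis.KokotsakisPolyhedron, K.HasPlanarAngles α β γ δ) ∧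
    -- after a cyclic re-enumeration `k` of the vertices, the sign condition holds and `ζ₁ > 1`
    ∃ k : Fin 4, ∃ lam' mu' nu' : Fin 4 → ℝ,
      lam' = Kokotsakis.shiftLam lam mu k ∧ mu' = Kokotsakis.shiftMu lam mu k ∧
      (∀ i, nu' i = Kokotsakis.nuOf δ lam mu (i + k)) ∧
      0 < lam' 0 ∧ 0 < mu' 0 ∧ lam' 2 < 0 ∧ mu' 2 < 0 ∧
      1 < Kokotsakis.zetaOne lam' mu' nu' ∧
      -- the four branches are disjoint simple closed curves, non-constant in each variable
      (∀ η ε, Continuous (Kokotsakis.branch lam' mu' nu' η ε) ∧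
        Function.Periodic (Kokotsakis.branch lam' mu' nu' η ε) (2 * Real.pi) ∧
        Set.InjOn (Kokotsakis.branch lam' mu' nu' η ε) (Set.Ico 0 (2 * Real.pi)) ∧
        ∀ j, ∃ t t', Kokotsakis.branch lam' mu' nu' η ε t j ≠
          Kokotsakis.branch lam' mu' nu' η ε t' j) ∧
      (∀ η ε η₂ ε₂, (η, ε) ≠ (η₂, ε₂) →
        Disjoint (Set.range (Kokotsakis.branch lam' mu' nu' η ε))
          (Set.range (Kokotsakis.branch lam' mu' nu' η₂ ε₂))) ∧
      -- every polyhedron with these planar angles is flexible, and the branches are exactly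
      -- the dihedral angles of all polyhedra isometric to it
      ∀ K : Kokotsakis.KokotsakisPolyhedron, K.HasPlanarAngles α β γ δ →
        K.IsFlexible ∧
        K.configSpace = {e | ∃ η ε : ℤˣ, ∃ t ∈ Set.Ico 0 (2 * Real.pi),
          ∀ j, e (j + k) = Kokotsakis.branch lam' mu' nu' η ε t j} := by
  obtain ⟨k, hN⟩ := hyp.exists_normalForm
  exact ⟨hyp.exists_polyhedron, k, _, _, _, rfl, rfl, fun _ => rfl, hN.lam_zero, hN.mu_zero,
    hN.lam_two, hN.mu_two, hN.one_lt_zeta,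
    fun η ε => ⟨hN.continuous_branch η ε, hN.periodic_branch η ε, hN.injOn_branch η ε,
      hN.branch_nonconstant η ε⟩,
    fun _ _ _ _ h => hN.disjoint_range_branch h,
    fun _ hK => ⟨hyp.isFlexible hK, hyp.configSpace_eq_branches hN hK⟩⟩
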